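/- Conventions. Simplicial model categories are tensored and cotensored over simplicial sets and satisfy Quillen's axiom (SM7); $\mathrm{Map}$ denotes simplicial mapping spaces. A model category is *combinatorial* if it is locally presentable and cofibrantly generated. Let $\mathcal I$ be an ordinary (locally small) category, let $\mathcal J$ be a small simplicial category, and let $\varphi:\mathcal J\to\mathcal I$ be a simplicial functor, where $\mathcal I$ is regarded as a simplicial category with discrete mapping spaces. A *simplicial Quillen presheaf* $\mathcal M$ on $\mathcal I$ is a pseudofunctor from $\mathcal I$ to the $(2,1)$-category of simplicial model categories, simplicial Quillen adjunctions $\alpha_!\dashv\alpha^*$ (in the direction of the left adjoints) and simplicial natural isomorphisms. Its total category $\int\mathcal M$ has as objects the pairs $(i,X)$ with $i\in\mathcal I$ and $X\in\mathcal M(i)$, and is a simplicial category over $\mathcal I$ with $$\mathrm{Map}\big((i,X),(i',Y)\big)=\coprod_{\alpha:i\to i'}\mathrm{Map}_{\mathcal M(i')}(\alpha_!X,Y).$$ Let $\mathrm{Sec}_{\mathcal J}(\mathcal M)$ be the category of simplicial functors $s:\mathcal J\to\int\mathcal M$ over $\mathcal I$ and simplicial natural transformations over $\mathcal I$; thus $s$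 has values $s(j)\in\mathcal M(\varphi(j))$ and a morphism $T:s\to t$ has components $T(j):s(j)\to t(j)$ in $\mathcal M(\varphi(j))$. It is enriched in simplicial sets, the $n$-simplices of $\mathrm{Map}(s,t)$ being the simplicially natural families of $n$-simplices of the spaces $\mathrm{Map}_{\mathcal M(\varphi(j))}(s(j),t(j))$, $j\in\mathcal J$. **Proposition.** Let $\mathcal M$ be a simplicial Quillen presheaf on $\mathcal I$ such that $\mathcal M(i)$ is combinatorial for every $i\in\mathcal I$. Then there is a model structure on $\mathrm{Sec}_{\mathcal J}(\mathcal M)$ (the *projective model structure*) such that: 1. with the enrichment above, it is a combinatorial simplicial model category; 2. a map $T$ is a weak equivalence (resp. a fibration) if and only if $T(j)$ is a weak equivalence (resp. a fibration) in $\mathcal M(\varphi(j))$ for every $j\in\mathcal J$; 3. the cofibrations are the maps having the left lifting property with respect to the maps that are levelwise both fibrations and weak equivalences; 4. it is transferred along free sections: for every $j\in\mathcal J$ the evaluation functor $\mathrm{Sec}_{\mathcal J}(\mathcal M)\to\mathcal M(\varphi(j))$, $s\mapsto s(j)$, has a left adjoint $X\mapsto s_{j,X}$, with $$s_{j,X}(j')\cong\coprod_{\alpha:\varphi(j)\to\varphi(j')}\mathrm{Map}^{\alpha}_{\mathcal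 J}(j,j')\otimes\alpha_!X$$ via the maps induced by the unit $X\to s_{j,X}(j)$ and the action of $\mathrm{Map}^{\alpha}_{\mathcal J}(j,j')$, where $\mathrm{Map}^{\alpha}_{\mathcal J}(j,j')\subseteq\mathrm{Map}_{\mathcal J}(j,j')$ is the preimage of $\alpha$. Moreover, if for every $j\in\mathcal J$ the trivial fibrations (resp. the fibrations) of $\mathcal M(\varphi(j))$ are the maps with the right lifting property with respect to a class $S_j$ of morphisms, then the trivial fibrations (resp. the fibrations) of $\mathrm{Sec}_{\mathcal J}(\mathcal M)$ are the maps with the right lifting property with respect to $\bigcup_{j\in\mathcal J}\{s_{j,X}\to s_{j,Y}\mid (X\to Y)\in S_j\}$. -/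

import Mathlib

universe w u u₁

open CategoryTheory MonoidalCategory Opposite Limits HomotopicalAlgebra

namespace SimplicialSections

section Simplices

/-- The `n`-simplex of a product of simplicial sets given by a pair of `n`-simplices. -/
def pair {K L : SSet.{w}} {n : SimplexCategoryᵒᵖ} (x : K.obj n) (y : L.obj n) : (K ⊗ L).obj n :=
  (x, y)

lemma map_id_apply (K : SSet.{w}) {n : SimplexCategoryᵒᵖ} (x : K.obj n) : K.map (𝟙 n) x = x := by
  rw [Functor.map_id_apply]

lemma map_comp_apply (K : SSet.{w}) {n m k : SimplexCategoryᵒᵖ} (θ : n ⟶ m) (θ' : m ⟶ k)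
    (x : K.obj n) : K.map (θ ≫ θ') x = K.map θ' (K.map θ x) := by
  rw [Functor.map_comp_apply]

variable {C : Type u} [EnrichedCategory SSet.{w} C]

/-- The `n`-simplex of `Map(X, X)` given by the identity of `X`. -/
def sId (X : C) (n : SimplexCategoryᵒᵖ) : (X ⟶[SSet.{w}] X).obj n :=
  (eId SSet.{w} X).app n PUnit.unit

/-- The composition (in diagrammatic order) of `n`-simplices of mapping spaces. -/
def sComp {X Y Z : C} {n : SimplexCategoryᵒᵖ} (f : (X ⟶[SSet.{w}] Y).obj n)
    (g : (Y ⟶[SSet.{w}] Z).obj n) : (X ⟶[SSet.{w}] Z).obj n :=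
  (eComp SSet.{w} X Y Z).app n (pair f g)

lemma sId_sComp {X Y : C} {n : SimplexCategoryᵒᵖ} (f : (X ⟶[SSet.{w}] Y).obj n) :
    sComp (sId X n) f = f :=
  ConcreteCategory.congr_hom (NatTrans.congr_app (e_id_comp SSet.{w} X Y) n) f

lemma sComp_sId {X Y : C} {n : SimplexCategoryᵒᵖ} (f : (X ⟶[SSet.{w}] Y).obj n) :
    sComp f (sId Y n) = f :=
  ConcreteCategory.congr_hom (NatTrans.congr_app (e_comp_id SSet.{w} X Y) n) f

lemma sComp_assoc {W X Y Z : C} {n : SimplexCategoryᵒᵖ} (f : (W ⟶[SSet.{w}] X).obj n)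
    (g : (X ⟶[SSet.{w}] Y).obj n) (h : (Y ⟶[SSet.{w}] Z).obj n) :
    sComp (sComp f g) h = sComp f (sComp g h) :=
  ConcreteCategory.congr_hom (NatTrans.congr_app (e_assoc SSet.{w} W X Y Z) n)
    (pair f (pair g h) :)

lemma map_sId (X : C) {m n : SimplexCategoryᵒᵖ} (θ : n ⟶ m) :
    (X ⟶[SSet.{w}] X).map θ (sId X n) = sId X m :=
  (NatTrans.naturality_apply (eId SSet.{w} X) θ PUnit.unit).symm

lemma map_sComp {X Y Z : C} {m n : SimplexCategoryᵒᵖ} (θ : n ⟶ m)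
    (f : (X ⟶[SSet.{w}] Y).obj n) (g : (Y ⟶[SSet.{w}] Z).obj n) :
    (X ⟶[SSet.{w}] Z).map θ (sComp f g) =
      sComp ((X ⟶[SSet.{w}] Y).map θ f) ((Y ⟶[SSet.{w}] Z).map θ g) :=
  (NatTrans.naturality_apply (eComp SSet.{w} X Y Z) θ (pair f g :)).symm

variable {D : Type u₁} [EnrichedCategory SSet.{w} D]

/-- The action of a simplicial functor on `n`-simplices of mapping spaces. -/
def sMap (F : EnrichedFunctor SSet.{w} C D) {X Y : C} {n : SimplexCategoryᵒᵖ}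
    (f : (X ⟶[SSet.{w}] Y).obj n) : (F.obj X ⟶[SSet.{w}] F.obj Y).obj n :=
  (F.map X Y).app n f

lemma sMap_sId (F : EnrichedFunctor SSet.{w} C D) (X : C) (n : SimplexCategoryᵒᵖ) :
    sMap F (sId X n) = sId (F.obj X) n :=
  ConcreteCategory.congr_hom (NatTrans.congr_app (F.map_id X) n) PUnit.unit

lemma sMap_sComp (F : EnrichedFunctor SSet.{w} C D) {X Y Z : C} {n : SimplexCategoryᵒᵖ}
    (f : (X ⟶[SSet.{w}] Y).obj n) (g : (Y ⟶[SSet.{w}] Z).obj n) :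
    sMap F (sComp f g) = sComp (sMap F f) (sMap F g) :=
  ConcreteCategory.congr_hom (NatTrans.congr_app (F.map_comp X Y Z) n) (pair f g :)

lemma map_sMap (F : EnrichedFunctor SSet.{w} C D) {X Y : C} {m n : SimplexCategoryᵒᵖ}
    (θ : n ⟶ m) (f : (X ⟶[SSet.{w}] Y).obj n) :
    (F.obj X ⟶[SSet.{w}] F.obj Y).map θ (sMap F f) = sMap F ((X ⟶[SSet.{w}] Y).map θ f) :=
  (NatTrans.naturality_apply (F.map X Y) θ f).symm

end Simplices

section Ordinary

variable {C : Type u} [Category.{w} C] [SimplicialCategory C]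

/-- The (degenerate) `n`-simplex of `Map(X, Y)` given by a morphism `X ⟶ Y`. -/
def sHomOf {X Y : C} (f : X ⟶ Y) (n : SimplexCategoryᵒᵖ) : (X ⟶[SSet.{w}] Y).obj n :=
  (eHomEquiv SSet.{w} f).app n PUnit.unit

lemma map_sHomOf {X Y : C} (f : X ⟶ Y) {m n : SimplexCategoryᵒᵖ} (θ : n ⟶ m) :
    (X ⟶[SSet.{w}] Y).map θ (sHomOf f n) = sHomOf f m :=
  (NatTrans.naturality_apply (eHomEquiv SSet.{w} f) θ PUnit.unit).symm

lemma sHomOf_id (X : C) (n : SimplexCategoryᵒᵖ) : sHomOf (𝟙 X) n = sId X n := by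
  simp only [sHomOf, sId, eHomEquiv_id]

lemma sHomOf_comp {X Y Z : C} (f : X ⟶ Y) (g : Y ⟶ Z) (n : SimplexCategoryᵒᵖ) :
    sHomOf (f ≫ g) n = sComp (sHomOf f n) (sHomOf g n) := by
  simp only [sHomOf, eHomEquiv_comp]
  rfl

lemma eHomWhiskerLeft_app (X : C) {Y Z : C} (g : Y ⟶ Z) {n : SimplexCategoryᵒᵖ}
    (f : (X ⟶[SSet.{w}] Y).obj n) :
    (eHomWhiskerLeft SSet.{w} X g).app n f = sComp f (sHomOf g n) := rfl

lemma eHomWhiskerRight_app {X Y : C} (f : X ⟶ Y) (Z : C) {n : SimplexCategoryᵒᵖ}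
    (g : (Y ⟶[SSet.{w}] Z).obj n) :
    (eHomWhiskerRight SSet.{w} f Z).app n g = sComp (sHomOf f n) g := rfl

lemma sHomOf_ext {X Y : C} {f g : X ⟶ Y} (h : ∀ n, sHomOf f n = sHomOf g n) : f = g := by
  apply (eHomEquiv SSet.{w}).injective
  ext n ⟨⟩
  exact h n

variable {D : Type u₁} [Category.{w} D] [SimplicialCategory D]

/-- The underlying ordinary functor of a simplicial functor. -/
def underlying (F : EnrichedFunctor SSet.{w} C D) : C ⥤ D where
  obj X := F.obj X
  map f := (eHomEquiv SSet.{w}).symm (eHomEquiv SSet.{w} f ≫ F.map _ _)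
  map_id X := by
    rw [eHomEquiv_id, F.map_id, ← eHomEquiv_id, Equiv.symm_apply_apply]
  map_comp f g := by
    apply (eHomEquiv SSet.{w}).injective
    simp only [Equiv.apply_symm_apply, eHomEquiv_comp, Category.assoc, F.map_comp]
    simp only [MonoidalCategory.tensorHom_comp_tensorHom_assoc]

lemma sHomOf_underlying_map (F : EnrichedFunctor SSet.{w} C D) {X Y : C} (f : X ⟶ Y)
    (n : SimplexCategoryᵒᵖ) : sHomOf ((underlying F).map f) n = sMap F (sHomOf f n) := by
  have h : eHomEquiv SSet.{w} ((underlying F).map f) = eHomEquiv SSet.{w} f ≫ F.map X Y :=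
    Equiv.apply_symm_apply _ _
  exact ConcreteCategory.congr_hom (NatTrans.congr_app h n) PUnit.unit

/-- A simplicial (i.e. `SSet`-enriched) natural isomorphism between simplicial functors. -/
structure SimplicialNatIso (F G : EnrichedFunctor SSet.{w} C D) where
  /-- the components -/
  app (X : C) : F.obj X ≅ G.obj X
  naturality (X Y : C) :
    F.map X Y ≫ eHomWhiskerLeft SSet.{w} (F.obj X) (app Y).hom =
      G.map X Y ≫ eHomWhiskerRight SSet.{w} (app X).hom (G.obj Y)

lemma SimplicialNatIso.nat {F G : EnrichedFunctor SSet.{w} C D} (e : SimplicialNatIso F G)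
    {X Y : C} {n : SimplexCategoryᵒᵖ} (f : (X ⟶[SSet.{w}] Y).obj n) :
    sComp (sMap F f) (sHomOf (e.app Y).hom n) = sComp (sHomOf (e.app X).hom n) (sMap G f) :=
  ConcreteCategory.congr_hom (NatTrans.congr_app (e.naturality X Y) n) f

/-- A simplicial (i.e. `SSet`-enriched) adjunction. -/
structure SimplicialAdjunction (L : EnrichedFunctor SSet.{w} C D)
    (R : EnrichedFunctor SSet.{w} D C) where
  /-- the isomorphism of mapping spaces `Map(L X, Y) ≅ Map(X, R Y)` -/
  homIso (X : C) (Y : D) : (L.obj X ⟶[SSet.{w}] Y) ≅ (X ⟶[SSet.{w}] R.obj Y)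
  naturality_left (X X' : C) (Y : D) :
    L.map X X' ▷ _ ≫ eComp SSet.{w} (L.obj X) (L.obj X') Y ≫ (homIso X Y).hom =
      _ ◁ (homIso X' Y).hom ≫ eComp SSet.{w} X X' (R.obj Y)
  naturality_right (X : C) (Y Y' : D) :
    eComp SSet.{w} (L.obj X) Y Y' ≫ (homIso X Y').hom =
      ((homIso X Y).hom ⊗ₘ R.map Y Y') ≫ eComp SSet.{w} X (R.obj Y) (R.obj Y')

/-- A tensor `K ⊗ X` of an object `X` of a simplicial category by a simplicial set `K`:
an object together with a map `K ⟶ Map(X, K ⊗ X)` inducing isomorphisms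
`Map(K ⊗ X, Y) ≅ Map(K, Map(X, Y))` of simplicial sets, which is expressed by testing on
maps from an arbitrary simplicial set `L`. -/
structure SimplicialTensor (K : SSet.{w}) (X : C) where
  /-- the tensor `K ⊗ X` -/
  obj : C
  /-- the universal map -/
  unit : K ⟶ (X ⟶[SSet.{w}] obj)
  bijective (Y : C) (L : SSet.{w}) : Function.Bijective
    (fun (f : L ⟶ (obj ⟶[SSet.{w}] Y)) ↦ (unit ⊗ₘ f) ≫ eComp SSet.{w} X obj Y)

/-- A cotensor `Y ^ K` of an object `Y` of a simplicial category by a simplicial set `K`: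
an object together with a map `K ⟶ Map(Y ^ K, Y)` inducing isomorphisms
`Map(X, Y ^ K) ≅ Map(K, Map(X, Y))` of simplicial sets, which is expressed by testing on
maps from an arbitrary simplicial set `L`. -/
structure SimplicialCotensor (K : SSet.{w}) (Y : C) where
  /-- the cotensor `Y ^ K` -/
  obj : C
  /-- the universal map -/
  counit : K ⟶ (obj ⟶[SSet.{w}] Y)
  bijective (X : C) (L : SSet.{w}) : Function.Bijective
    (fun (f : L ⟶ (X ⟶[SSet.{w}] obj)) ↦ (f ⊗ₘ counit) ≫ eComp SSet.{w} X obj Y)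

end Ordinary

section Model

variable (C : Type u) [Category.{w} C] [ModelCategory C]

/-- A model category is combinatorial if its underlying category is locally presentable and it is
cofibrantly generated: there are (small) sets of morphisms which detect by the right lifting
property the trivial fibrations and the fibrations respectively. (In a locally presentable category
every set of morphisms permits the small object argument.) -/
structure IsCombinatorial : Prop where
  isLocallyPresentable : IsLocallyPresentable.{w} C
  exists_generating_cofibrations :
    ∃ S : MorphismProperty C, MorphismProperty.IsSmall.{w} S ∧ trivialFibrations C = S.rlp
  exists_generating_trivialCofibrations :
    ∃ S : MorphismProperty C, MorphismProperty.IsSmall.{w} S ∧ fibrations C = S.rlp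

variable [SimplicialCategory C]

/-- A simplicial model category: a model category with a simplicial enrichment which is
tensored and cotensored over simplicial sets, and which satisfies Quillen's axiom (SM7):
for a cofibration `i : A ⟶ B` and a fibration `p : X ⟶ Y`, the map
`π : Map(B, X) ⟶ Map(A, X) ×_{Map(A, Y)} Map(B, Y)` is a Kan fibration (right lifting property
for the horn inclusions), and a trivial Kan fibration (right lifting property for the boundary
inclusions) if `i` or `p` is moreover a weak equivalence. -/
structure IsSimplicialModelCategory : Prop where
  tensored (K : SSet.{w}) (X : C) : Nonempty (SimplicialTensor K X)
  cotensored (K : SSet.{w}) (X : C) : Nonempty (SimplicialCotensor K X)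
  kanFibration {A B X Y : C} (i : A ⟶ B) (p : X ⟶ Y) (hi : Cofibration i) (hp : Fibration p)
    (sq : (SimplicialCategory.sHomFunctor C).PullbackObjObj i p) :
    SSet.modelCategoryQuillen.J.rlp sq.π
  trivialKanFibration {A B X Y : C} (i : A ⟶ B) (p : X ⟶ Y) (hi : Cofibration i)
    (hp : Fibration p) (h : WeakEquivalence i ∨ WeakEquivalence p)
    (sq : (SimplicialCategory.sHomFunctor C).PullbackObjObj i p) :
    SSet.modelCategoryQuillen.I.rlp sq.π

end Model

set_option linter.checkUnivs false in
/-- A (bundled) simplicial model category. -/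
structure SimplicialModelCat where
  /-- the objects -/
  carrier : Type u
  /-- the underlying category -/
  [category : Category.{w} carrier]
  /-- the simplicial enrichment -/
  [simplicialCategory : SimplicialCategory carrier]
  /-- the model structure -/
  [modelCategory : ModelCategory carrier]
  isSimplicialModelCategory : IsSimplicialModelCategory carrier

instance : CoeSort SimplicialModelCat.{w, u} (Type u) := ⟨SimplicialModelCat.carrier⟩

attribute [instance] SimplicialModelCat.category SimplicialModelCat.simplicialCategory
  SimplicialModelCat.modelCategory

/-- A simplicial Quillen adjunction between simplicial model categories. -/
structure SimplicialQuillenAdjunction (C D : SimplicialModelCat.{w, u}) where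
  /-- the left adjoint -/
  left : EnrichedFunctor SSet.{w} C D
  /-- the right adjoint -/
  right : EnrichedFunctor SSet.{w} D C
  /-- the adjunction -/
  adj : SimplicialAdjunction left right
  cofibration_map {X Y : C} (f : X ⟶ Y) (hf : cofibrations C f) :
    cofibrations D ((underlying left).map f)
  trivialCofibration_map {X Y : C} (f : X ⟶ Y) (hf : trivialCofibrations C f) :
    trivialCofibrations D ((underlying left).map f)

/-- A simplicial Quillen presheaf on an ordinary category `I`: a pseudofunctor `M` from `I`
to the `(2,1)`-category of simplicial model categories, simplicial Quillen adjunctions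
(in the direction of their left adjoints) and simplicial natural isomorphisms (between left
adjoints). The comparison isomorphism for the composition is indexed by a factorization
`f ≫ g = fg`, so that the coherence conditions can be stated without transport. -/
structure SimplicialQuillenPresheaf (I : Type u₁) [Category.{w} I] where
  /-- the values -/
  obj : I → SimplicialModelCat.{w, u}
  /-- the transition adjunctions `α_! ⊣ α^*` -/
  map {i j : I} (α : i ⟶ j) : SimplicialQuillenAdjunction (obj i) (obj j)
  /-- `(𝟙 i)_! ≅ 𝟙` -/
  mapId (i : I) : SimplicialNatIso (map (𝟙 i)).left (EnrichedFunctor.id SSet.{w} (obj i))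
  /-- `(α ≫ β)_! ≅ β_! α_!` -/
  mapComp {i j k : I} (α : i ⟶ j) (β : j ⟶ k) (γ : i ⟶ k) (h : α ≫ β = γ) :
    SimplicialNatIso (map γ).left ((map α).left.comp SSet.{w} (map β).left)
  id_comp {i j : I} (α : i ⟶ j) (X : obj i) :
    ((mapComp (𝟙 i) α α (Category.id_comp α)).app X).hom ≫
      (underlying (map α).left).map ((mapId i).app X).hom = 𝟙 ((map α).left.obj X)
  comp_id {i j : I} (α : i ⟶ j) (X : obj i) :
    ((mapComp α (𝟙 j) α (Category.comp_id α)).app X).hom ≫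
      ((mapId j).app ((map α).left.obj X)).hom = 𝟙 ((map α).left.obj X)
  assoc {i j k l : I} (α : i ⟶ j) (β : j ⟶ k) (γ : k ⟶ l) (αβ : i ⟶ k) (βγ : j ⟶ l)
    (δ : i ⟶ l) (hαβ : α ≫ β = αβ) (hβγ : β ≫ γ = βγ) (h : αβ ≫ γ = δ) (h' : α ≫ βγ = δ)
    (X : obj i) :
    ((mapComp αβ γ δ h).app X).hom ≫
      (underlying (map γ).left).map ((mapComp α β αβ hαβ).app X).hom =
    ((mapComp α βγ δ h').app X).hom ≫ ((mapComp β γ βγ hβγ).app ((map α).left.obj X)).hom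


namespace SimplicialQuillenPresheaf

variable {I : Type u₁} [Category.{w} I] (M : SimplicialQuillenPresheaf.{w, u} I)

/-- The object `α_! X`. -/
abbrev push {i j : I} (α : i ⟶ j) (X : M.obj i) : M.obj j := (M.map α).left.obj X

/-- The action of `α_!` on `n`-simplices of mapping spaces. -/
def pushMap {i j : I} (α : i ⟶ j) {X Y : M.obj i} {n : SimplexCategoryᵒᵖ}
    (f : (X ⟶[SSet.{w}] Y).obj n) : (M.push α X ⟶[SSet.{w}] M.push α Y).obj n :=
  sMap (M.map α).left f

/-- The isomorphism `(𝟙 i)_! X ⟶ X`. -/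
def idHom (i : I) (X : M.obj i) : M.push (𝟙 i) X ⟶ X := ((M.mapId i).app X).hom

/-- The isomorphism `γ_! X ⟶ β_! α_! X` when `α ≫ β = γ`. -/
def compHom {i j k : I} (α : i ⟶ j) (β : j ⟶ k) (γ : i ⟶ k) (h : α ≫ β = γ) (X : M.obj i) :
    M.push γ X ⟶ M.push β (M.push α X) := ((M.mapComp α β γ h).app X).hom

lemma pushMap_sId {i j : I} (α : i ⟶ j) (X : M.obj i) (n : SimplexCategoryᵒᵖ) :
    M.pushMap α (sId X n) = sId (M.push α X) n := sMap_sId _ _ _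

lemma pushMap_sComp {i j : I} (α : i ⟶ j) {X Y Z : M.obj i} {n : SimplexCategoryᵒᵖ}
    (f : (X ⟶[SSet.{w}] Y).obj n) (g : (Y ⟶[SSet.{w}] Z).obj n) :
    M.pushMap α (sComp f g) = sComp (M.pushMap α f) (M.pushMap α g) := sMap_sComp _ _ _

lemma map_pushMap {i j : I} (α : i ⟶ j) {X Y : M.obj i} {m n : SimplexCategoryᵒᵖ} (θ : n ⟶ m)
    (f : (X ⟶[SSet.{w}] Y).obj n) :
    (M.push α X ⟶[SSet.{w}] M.push α Y).map θ (M.pushMap α f) =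
      M.pushMap α ((X ⟶[SSet.{w}] Y).map θ f) := map_sMap _ _ _

lemma idHom_nat {i : I} {X Y : M.obj i} {n : SimplexCategoryᵒᵖ} (f : (X ⟶[SSet.{w}] Y).obj n) :
    sComp (M.pushMap (𝟙 i) f) (sHomOf (M.idHom i Y) n) = sComp (sHomOf (M.idHom i X) n) f :=
  (M.mapId i).nat f

lemma compHom_nat {i j k : I} (α : i ⟶ j) (β : j ⟶ k) (γ : i ⟶ k) (h : α ≫ β = γ)
    {X Y : M.obj i} {n : SimplexCategoryᵒᵖ} (f : (X ⟶[SSet.{w}] Y).obj n) :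
    sComp (M.pushMap γ f) (sHomOf (M.compHom α β γ h Y) n) =
      sComp (sHomOf (M.compHom α β γ h X) n) (M.pushMap β (M.pushMap α f)) :=
  (M.mapComp α β γ h).nat f

lemma compHom_idHom_left {i j : I} (α : i ⟶ j) (X : M.obj i) (n : SimplexCategoryᵒᵖ) :
    sComp (sHomOf (M.compHom (𝟙 i) α α (Category.id_comp α) X) n)
      (M.pushMap α (sHomOf (M.idHom i X) n)) = sId (M.push α X) n := by
  have h := congrArg (fun f ↦ sHomOf f n) (M.id_comp α X)
  exact ((sHomOf_comp _ _ n).trans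
    (congrArg (sComp _) (sHomOf_underlying_map _ _ n))).symm.trans (h.trans (sHomOf_id _ n))

lemma compHom_idHom_right {i j : I} (α : i ⟶ j) (X : M.obj i) (n : SimplexCategoryᵒᵖ) :
    sComp (sHomOf (M.compHom α (𝟙 j) α (Category.comp_id α) X) n)
      (sHomOf (M.idHom j (M.push α X)) n) = sId (M.push α X) n := by
  have h := congrArg (fun f ↦ sHomOf f n) (M.comp_id α X)
  exact (sHomOf_comp _ _ n).symm.trans (h.trans (sHomOf_id _ n))

lemma compHom_assoc {i j k l : I} (α : i ⟶ j) (β : j ⟶ k) (γ : k ⟶ l) (αβ : i ⟶ k) (βγ : j ⟶ l)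
    (δ : i ⟶ l) (hαβ : α ≫ β = αβ) (hβγ : β ≫ γ = βγ) (h : αβ ≫ γ = δ) (h' : α ≫ βγ = δ)
    (X : M.obj i) (n : SimplexCategoryᵒᵖ) :
    sComp (sHomOf (M.compHom αβ γ δ h X) n) (M.pushMap γ (sHomOf (M.compHom α β αβ hαβ X) n)) =
      sComp (sHomOf (M.compHom α βγ δ h' X) n)
        (sHomOf (M.compHom β γ βγ hβγ (M.push α X)) n) := by
  have e := congrArg (fun f ↦ sHomOf f n) (M.assoc α β γ αβ βγ δ hαβ hβγ h h' X)
  exact ((sHomOf_comp _ _ n).trans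
    (congrArg (sComp _) (sHomOf_underlying_map _ _ n))).symm.trans (e.trans (sHomOf_comp _ _ n))

end SimplicialQuillenPresheaf

section Discrete

/-- An ordinary category `I`, regarded as a simplicial category with discrete mapping spaces. -/
structure Disc (I : Type u₁) where
  /-- the object of `I` -/
  as : I

variable {I : Type u₁} [Category.{w} I]

instance : EnrichedCategory SSet.{w} (Disc I) where
  Hom X Y := (Functor.const _).obj (X.as ⟶ Y.as)
  id X := { app _ := ↾fun _ ↦ 𝟙 X.as }
  comp X Y Z := { app _ := ↾fun p ↦ p.1 ≫ p.2 }
  id_comp X Y := by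
    ext n (f : X.as ⟶ Y.as)
    exact Category.id_comp f
  comp_id X Y := by
    ext n (f : X.as ⟶ Y.as)
    exact Category.comp_id f
  assoc W X Y Z := by
    ext n ⟨(f : W.as ⟶ X.as), (g : X.as ⟶ Y.as), (h : Y.as ⟶ Z.as)⟩
    exact Category.assoc f g h

end Discrete

section Total

variable {I : Type u₁} [Category.{w} I]

/-- The objects of the total category `∫ M` of a simplicial Quillen presheaf. -/
structure Total (M : SimplicialQuillenPresheaf.{w, u} I) where
  /-- the object of the base -/
  base : I
  /-- the object of the fiber -/
  fiber : M.obj base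

variable {M : SimplicialQuillenPresheaf.{w, u} I}

namespace Total

/-- The mapping space `Map((i, X), (j, Y)) = ∐_{α : i ⟶ j} Map(α_! X, Y)` in `∫ M`. -/
def Map (A B : Total M) : SSet.{w} where
  obj n := Σ α : A.base ⟶ B.base, (M.push α A.fiber ⟶[SSet.{w}] B.fiber).obj n
  map θ := ↾fun f ↦
    ⟨f.1, (M.push f.1 A.fiber ⟶[SSet.{w}] B.fiber).map θ f.2⟩
  map_id n := by
    ext ⟨α, f⟩
    · rfl
    · have h : (M.push α A.fiber ⟶[SSet.{w}] B.fiber).map (𝟙 n) f = f := map_id_apply _ f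
      exact heq_of_eq h
  map_comp θ θ' := by
    ext ⟨α, f⟩
    · rfl
    · have h : (M.push α A.fiber ⟶[SSet.{w}] B.fiber).map (θ ≫ θ') f =
          (M.push α A.fiber ⟶[SSet.{w}] B.fiber).map θ'
            ((M.push α A.fiber ⟶[SSet.{w}] B.fiber).map θ f) := map_comp_apply _ θ θ' f
      exact heq_of_eq h

/-- The `n`-simplex of `Map((i, X), (j, Y))` given by `α : i ⟶ j` and an `n`-simplex
of `Map(α_! X, Y)`. -/
def mk' {A B : Total M} {n : SimplexCategoryᵒᵖ} (α : A.base ⟶ B.base)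
    (f : (M.push α A.fiber ⟶[SSet.{w}] B.fiber).obj n) : (Map A B).obj n := ⟨α, f⟩

lemma map_mk' {A B : Total M} {m n : SimplexCategoryᵒᵖ} (θ : n ⟶ m) (α : A.base ⟶ B.base)
    (f : (M.push α A.fiber ⟶[SSet.{w}] B.fiber).obj n) :
    (Map A B).map θ (mk' α f) =
      mk' α ((M.push α A.fiber ⟶[SSet.{w}] B.fiber).map θ f) := rfl

/-- The composition in `∫ M` of `n`-simplices lying over `α` and `β`, where `α ≫ β = γ`:
the composite `γ_! X ≅ β_! α_! X ⟶ β_! Y ⟶ Z`. -/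
def compAux {A B C : Total M} {n : SimplexCategoryᵒᵖ} (α : A.base ⟶ B.base)
    (β : B.base ⟶ C.base) (γ : A.base ⟶ C.base) (h : α ≫ β = γ)
    (f : (M.push α A.fiber ⟶[SSet.{w}] B.fiber).obj n)
    (g : (M.push β B.fiber ⟶[SSet.{w}] C.fiber).obj n) :
    (M.push γ A.fiber ⟶[SSet.{w}] C.fiber).obj n :=
  sComp (sHomOf (M.compHom α β γ h A.fiber) n) (sComp (M.pushMap β f) g)

/-- The composition of `n`-simplices in `∫ M`. -/
def comp {A B C : Total M} {n : SimplexCategoryᵒᵖ} (f : (Map A B).obj n) (g : (Map B C).obj n) :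
    (Map A C).obj n :=
  mk' (f.1 ≫ g.1) (compAux f.1 g.1 (f.1 ≫ g.1) rfl f.2 g.2)

lemma comp_mk' {A B C : Total M} {n : SimplexCategoryᵒᵖ} (α : A.base ⟶ B.base)
    (β : B.base ⟶ C.base) (γ : A.base ⟶ C.base) (h : α ≫ β = γ)
    (f : (M.push α A.fiber ⟶[SSet.{w}] B.fiber).obj n)
    (g : (M.push β B.fiber ⟶[SSet.{w}] C.fiber).obj n) :
    comp (mk' α f) (mk' β g) = mk' γ (compAux α β γ h f g) := by
  subst h
  rfl

/-- The identity `n`-simplices in `∫ M`. -/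
def id (A : Total M) (n : SimplexCategoryᵒᵖ) : (Map A A).obj n :=
  mk' (𝟙 A.base) (sHomOf (M.idHom A.base A.fiber) n)

lemma id_comp {A B : Total M} {n : SimplexCategoryᵒᵖ} (f : (Map A B).obj n) :
    comp (id A n) f = f := by
  obtain ⟨α, f⟩ := f
  refine (comp_mk' (𝟙 A.base) α α (Category.id_comp α) _ f).trans (congrArg (mk' α) ?_)
  rw [compAux, ← sComp_assoc, M.compHom_idHom_left, sId_sComp]

lemma comp_id {A B : Total M} {n : SimplexCategoryᵒᵖ} (f : (Map A B).obj n) :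
    comp f (id B n) = f := by
  obtain ⟨α, f⟩ := f
  refine (comp_mk' α (𝟙 B.base) α (Category.comp_id α) f _).trans (congrArg (mk' α) ?_)
  rw [compAux, M.idHom_nat, ← sComp_assoc, M.compHom_idHom_right, sId_sComp]

lemma assoc {A B C D : Total M} {n : SimplexCategoryᵒᵖ} (f : (Map A B).obj n)
    (g : (Map B C).obj n) (h : (Map C D).obj n) :
    comp (comp f g) h = comp f (comp g h) := by
  obtain ⟨α, f⟩ := f
  obtain ⟨β, g⟩ := g
  obtain ⟨γ, h⟩ := h
  refine (comp_mk' (α ≫ β) γ ((α ≫ β) ≫ γ) rfl (compAux α β _ rfl f g) h).trans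
    (Eq.trans (congrArg (mk' _) ?_)
      (comp_mk' α (β ≫ γ) ((α ≫ β) ≫ γ) (Category.assoc _ _ _).symm f
        (compAux β γ _ rfl g h)).symm)
  have e := M.compHom_assoc α β γ (α ≫ β) (β ≫ γ) _ rfl rfl rfl
    (Category.assoc _ _ _).symm A.fiber n
  have e' := M.compHom_nat β γ (β ≫ γ) rfl f
  simp only [compAux, M.pushMap_sComp, ← sComp_assoc]
  rw [e]
  simp only [sComp_assoc]
  congr 1
  simp only [← sComp_assoc]
  rw [e']

lemma map_id' (A : Total M) {m n : SimplexCategoryᵒᵖ} (θ : n ⟶ m) :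
    (Map A A).map θ (id A n) = id A m :=
  congrArg (mk' (𝟙 A.base)) (map_sHomOf _ θ)

lemma map_compAux {A B C : Total M} {m n : SimplexCategoryᵒᵖ} (θ : n ⟶ m)
    (α : A.base ⟶ B.base) (β : B.base ⟶ C.base) (γ : A.base ⟶ C.base) (h : α ≫ β = γ)
    (f : (M.push α A.fiber ⟶[SSet.{w}] B.fiber).obj n)
    (g : (M.push β B.fiber ⟶[SSet.{w}] C.fiber).obj n) :
    (M.push γ A.fiber ⟶[SSet.{w}] C.fiber).map θ (compAux α β γ h f g) =
      compAux α β γ h ((M.push α A.fiber ⟶[SSet.{w}] B.fiber).map θ f)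
        ((M.push β B.fiber ⟶[SSet.{w}] C.fiber).map θ g) := by
  rw [compAux, compAux, map_sComp, map_sHomOf, map_sComp, M.map_pushMap]

lemma map_comp' {A B C : Total M} {m n : SimplexCategoryᵒᵖ} (θ : n ⟶ m) (f : (Map A B).obj n)
    (g : (Map B C).obj n) :
    (Map A C).map θ (comp f g) = comp ((Map A B).map θ f) ((Map B C).map θ g) :=
  congrArg (mk' (f.1 ≫ g.1)) (map_compAux θ f.1 g.1 _ rfl f.2 g.2)

/-- The total category `∫ M` is a simplicial category. -/
instance : EnrichedCategory SSet.{w} (Total M) where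
  Hom A B := Map A B
  id A :=
    { app n := ↾fun _ ↦ id A n
      naturality _ _ θ := by
        ext ⟨⟩
        exact (map_id' A θ).symm }
  comp A B C :=
    { app n := ↾fun p ↦ comp p.1 p.2
      naturality _ _ θ := by
        ext ⟨f, g⟩
        exact (map_comp' θ f g).symm }
  id_comp A B := by
    ext n f
    exact id_comp f
  comp_id A B := by
    ext n f
    exact comp_id f
  assoc A B C D := by
    ext n ⟨f, g, h⟩
    exact assoc f g h

variable (M) in
/-- The projection `∫ M ⟶ I`. -/
def proj : EnrichedFunctor SSet.{w} (Total M) (Disc I) where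
  obj A := ⟨A.base⟩
  map A B := { app _ := ↾fun f ↦ f.1 }
  map_id A := rfl
  map_comp A B C := rfl

/-- The inclusion of the summand `Map(α_! X, Y)` of `Map((i, X), (j, Y))`. -/
def incl {i j : I} (X : M.obj i) (Y : M.obj j) (α : i ⟶ j) :
    (M.push α X ⟶[SSet.{w}] Y) ⟶
      ((⟨i, X⟩ : Total M) ⟶[SSet.{w}] (⟨j, Y⟩ : Total M)) where
  app _ := ↾fun f ↦ ⟨α, f⟩

/-- The inclusion `M(i) ⟶ ∫ M` of a fiber, on `n`-simplices of mapping spaces. -/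
def fiberIncl {i : I} {X Y : M.obj i} {n : SimplexCategoryᵒᵖ} (f : (X ⟶[SSet.{w}] Y).obj n) :
    (Map (⟨i, X⟩ : Total M) ⟨i, Y⟩).obj n :=
  mk' (A := ⟨i, X⟩) (B := ⟨i, Y⟩) (𝟙 i) (sComp (sHomOf (M.idHom i X) n) f)

/-- The composition in `∫ M` with an `n`-simplex of a mapping space of a fiber `M(i)`. -/
def post {A : Total M} {i : I} {X Y : M.obj i} {n : SimplexCategoryᵒᵖ}
    (f : (Map A ⟨i, X⟩).obj n) (g : (X ⟶[SSet.{w}] Y).obj n) : (Map A ⟨i, Y⟩).obj n :=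
  mk' (B := ⟨i, Y⟩) f.1 (sComp f.2 g)

/-- The precomposition in `∫ M` with an `n`-simplex of a mapping space of a fiber `M(i)`. -/
def pre {B : Total M} {i : I} {X Y : M.obj i} {n : SimplexCategoryᵒᵖ}
    (g : (X ⟶[SSet.{w}] Y).obj n) (f : (Map ⟨i, Y⟩ B).obj n) : (Map ⟨i, X⟩ B).obj n :=
  mk' (A := ⟨i, X⟩) f.1 (sComp (M.pushMap f.1 g) f.2)

lemma post_eq_comp {A : Total M} {i : I} {X Y : M.obj i} {n : SimplexCategoryᵒᵖ}
    (f : (Map A ⟨i, X⟩).obj n) (g : (X ⟶[SSet.{w}] Y).obj n) :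
    post f g = comp f (fiberIncl g) := by
  obtain ⟨α, f⟩ := f
  refine Eq.trans (congrArg (mk' (B := ⟨i, Y⟩) α) ?_)
    (comp_mk' (B := ⟨i, X⟩) (C := ⟨i, Y⟩) α (𝟙 i) α (Category.comp_id α) f
      (sComp (sHomOf (M.idHom i X) n) g)).symm
  rw [compAux, ← sComp_assoc (M.pushMap _ f), M.idHom_nat, ← sComp_assoc, ← sComp_assoc,
    M.compHom_idHom_right, sId_sComp]

lemma pre_eq_comp {B : Total M} {i : I} {X Y : M.obj i} {n : SimplexCategoryᵒᵖ}
    (g : (X ⟶[SSet.{w}] Y).obj n) (f : (Map ⟨i, Y⟩ B).obj n) :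
    pre g f = comp (fiberIncl g) f := by
  obtain ⟨α, f⟩ := f
  refine Eq.trans (congrArg (mk' (A := ⟨i, X⟩) α) ?_)
    (comp_mk' (A := ⟨i, X⟩) (B := ⟨i, Y⟩) (𝟙 i) α α (Category.id_comp α)
      (sComp (sHomOf (M.idHom i X) n) g) f).symm
  rw [compAux, M.pushMap_sComp, ← sComp_assoc, ← sComp_assoc, M.compHom_idHom_left, sId_sComp]

lemma post_sId {A : Total M} {i : I} {X : M.obj i} {n : SimplexCategoryᵒᵖ}
    (f : (Map A ⟨i, X⟩).obj n) : post f (sId X n) = f :=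
  congrArg (mk' (B := ⟨i, X⟩) f.1) (sComp_sId f.2)

lemma pre_sId {B : Total M} {i : I} {X : M.obj i} {n : SimplexCategoryᵒᵖ}
    (f : (Map ⟨i, X⟩ B).obj n) : pre (sId X n) f = f := by
  refine congrArg (mk' (A := ⟨i, X⟩) f.1) ?_
  rw [M.pushMap_sId, sId_sComp]

lemma post_sComp {A : Total M} {i : I} {X Y Z : M.obj i} {n : SimplexCategoryᵒᵖ}
    (f : (Map A ⟨i, X⟩).obj n) (g : (X ⟶[SSet.{w}] Y).obj n) (h : (Y ⟶[SSet.{w}] Z).obj n) :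
    post f (sComp g h) = post (post f g) h :=
  congrArg (mk' (B := ⟨i, Z⟩) f.1) (sComp_assoc _ _ _).symm

lemma pre_sComp {B : Total M} {i : I} {X Y Z : M.obj i} {n : SimplexCategoryᵒᵖ}
    (g : (X ⟶[SSet.{w}] Y).obj n) (h : (Y ⟶[SSet.{w}] Z).obj n) (f : (Map ⟨i, Z⟩ B).obj n) :
    pre (sComp g h) f = pre g (pre h f) := by
  refine congrArg (mk' (A := ⟨i, X⟩) f.1) (Eq.trans ?_ (sComp_assoc _ _ _))
  rw [M.pushMap_sComp]
  rfl

lemma post_pre {i j : I} {X Y : M.obj i} {Z W : M.obj j} {n : SimplexCategoryᵒᵖ}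
    (g : (X ⟶[SSet.{w}] Y).obj n) (f : (Map (⟨i, Y⟩ : Total M) ⟨j, Z⟩).obj n)
    (h : (Z ⟶[SSet.{w}] W).obj n) : post (pre g f) h = pre g (post f h) :=
  congrArg (mk' (A := ⟨i, X⟩) (B := ⟨j, W⟩) f.1) (sComp_assoc _ _ _)

end Total

end Total

section Sections

variable {I : Type u₁} [Category.{w} I] {J : Type w} [EnrichedCategory SSet.{w} J]

/-- A simplicial section of `M` along `φ : J ⟶ I`: a simplicial functor `J ⟶ ∫ M` over `I`,
given by objects `obj j` of `M(φ j)` and the action on mapping spaces of a simplicial functor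
which sends `j` to `(φ j, obj j)`. -/
structure SimplicialSection (φ : EnrichedFunctor SSet.{w} J (Disc I))
    (M : SimplicialQuillenPresheaf.{w, u} I) where
  /-- the values -/
  obj (j : J) : M.obj (φ.obj j).as
  /-- the action on mapping spaces -/
  map (j j' : J) : (j ⟶[SSet.{w}] j') ⟶
    ((⟨(φ.obj j).as, obj j⟩ : Total M) ⟶[SSet.{w}] (⟨(φ.obj j').as, obj j'⟩ : Total M))
  map_id (j : J) : eId SSet.{w} j ≫ map j j = eId SSet.{w} (⟨(φ.obj j).as, obj j⟩ : Total M)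
  map_comp (j j' j'' : J) : eComp SSet.{w} j j' j'' ≫ map j j'' =
    (map j j' ⊗ₘ map j' j'') ≫ eComp SSet.{w} (⟨(φ.obj j).as, obj j⟩ : Total M)
      ⟨(φ.obj j').as, obj j'⟩ ⟨(φ.obj j'').as, obj j''⟩
  map_proj (j j' : J) : map j j' ≫ (Total.proj M).map ⟨(φ.obj j).as, obj j⟩
    ⟨(φ.obj j').as, obj j'⟩ = φ.map j j'

variable {φ : EnrichedFunctor SSet.{w} J (Disc I)} {M : SimplicialQuillenPresheaf.{w, u} I}

namespace SimplicialSection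

/-- The simplicial functor `J ⟶ ∫ M` given by a simplicial section. -/
def toEnrichedFunctor (s : SimplicialSection φ M) : EnrichedFunctor SSet.{w} J (Total M) where
  obj j := ⟨(φ.obj j).as, s.obj j⟩
  map := s.map
  map_id := s.map_id
  map_comp := s.map_comp

lemma toEnrichedFunctor_comp_proj (s : SimplicialSection φ M) :
    s.toEnrichedFunctor.comp SSet.{w} (Total.proj M) = φ :=
  EnrichedFunctor.ext _ (fun _ ↦ rfl) (fun j j' ↦ (Category.comp_id _).trans (s.map_proj j j'))

/-- The action of a simplicial section on `n`-simplices of mapping spaces. -/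
def act (s : SimplicialSection φ M) {j j' : J} {n : SimplexCategoryᵒᵖ}
    (γ : (j ⟶[SSet.{w}] j').obj n) :
    (Total.Map (⟨(φ.obj j).as, s.obj j⟩ : Total M) ⟨(φ.obj j').as, s.obj j'⟩).obj n :=
  (s.map j j').app n γ

/-- The naturality condition on a family of `n`-simplices `T j` of the mapping spaces
`Map(s(j), t(j))`: for every simplex `γ` of a mapping space `Map(j, j')`, the square in `∫ M`
given by the actions of `s` and `t` on `γ` and by (the restrictions of) `T j` and `T j'`
commutes. -/
def IsNatural {s t : SimplicialSection φ M} {n : SimplexCategoryᵒᵖ}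
    (T : ∀ j, (s.obj j ⟶[SSet.{w}] t.obj j).obj n) : Prop :=
  ∀ ⦃m : SimplexCategoryᵒᵖ⦄ (θ : n ⟶ m) ⦃j j' : J⦄ (γ : (j ⟶[SSet.{w}] j').obj m),
    Total.post (s.act γ) ((s.obj j' ⟶[SSet.{w}] t.obj j').map θ (T j')) =
      Total.pre ((s.obj j ⟶[SSet.{w}] t.obj j).map θ (T j)) (t.act γ)

lemma IsNatural.map {s t : SimplicialSection φ M} {m n : SimplexCategoryᵒᵖ}
    {T : ∀ j, (s.obj j ⟶[SSet.{w}] t.obj j).obj n} (hT : IsNatural T) (θ : n ⟶ m) :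
    IsNatural (fun j ↦ (s.obj j ⟶[SSet.{w}] t.obj j).map θ (T j)) := by
  intro k θ' j j' γ
  have h := hT (θ ≫ θ') γ
  rwa [Functor.map_comp_apply, Functor.map_comp_apply] at h

lemma IsNatural.id (s : SimplicialSection φ M) (n : SimplexCategoryᵒᵖ) :
    IsNatural (fun j ↦ sId (s.obj j) n) := by
  intro m θ j j' γ
  rw [map_sId, map_sId, Total.post_sId, Total.pre_sId]

lemma IsNatural.comp {s t r : SimplicialSection φ M} {n : SimplexCategoryᵒᵖ}
    {T : ∀ j, (s.obj j ⟶[SSet.{w}] t.obj j).obj n} (hT : IsNatural T)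
    {T' : ∀ j, (t.obj j ⟶[SSet.{w}] r.obj j).obj n} (hT' : IsNatural T') :
    IsNatural (fun j ↦ sComp (T j) (T' j)) := by
  intro m θ j j' γ
  rw [map_sComp, map_sComp, Total.post_sComp, hT θ γ, Total.post_pre, hT' θ γ, Total.pre_sComp]

/-- Morphisms of simplicial sections: simplicial natural transformations over `I`. -/
@[ext]
structure Hom (s t : SimplicialSection φ M) where
  /-- the components -/
  app (j : J) : s.obj j ⟶ t.obj j
  naturality ⦃n : SimplexCategoryᵒᵖ⦄ ⦃j j' : J⦄ (γ : (j ⟶[SSet.{w}] j').obj n) :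
    Total.post (s.act γ) (sHomOf (app j') n) = Total.pre (sHomOf (app j) n) (t.act γ)

instance : Category.{w} (SimplicialSection φ M) where
  Hom s t := Hom s t
  id s :=
    { app j := 𝟙 (s.obj j)
      naturality n j j' γ := by
        rw [sHomOf_id, sHomOf_id, Total.post_sId, Total.pre_sId] }
  comp f g :=
    { app j := f.app j ≫ g.app j
      naturality n j j' γ := by
        rw [sHomOf_comp, sHomOf_comp, Total.post_sComp, f.naturality, Total.post_pre,
          g.naturality, Total.pre_sComp] }
  id_comp f := Hom.ext (funext fun j ↦ Category.id_comp (f.app j))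
  comp_id f := Hom.ext (funext fun j ↦ Category.comp_id (f.app j))
  assoc f g h := Hom.ext (funext fun j ↦ Category.assoc (f.app j) (g.app j) (h.app j))

variable (φ M) in
/-- The evaluation functor `s ↦ s(j)`. -/
def ev (j : J) : SimplicialSection φ M ⥤ M.obj (φ.obj j).as where
  obj s := s.obj j
  map f := f.app j
  map_id _ := rfl
  map_comp _ _ := rfl

/-- The mapping space `Map(s, t)`: its `n`-simplices are the natural families of `n`-simplices
of the mapping spaces `Map(s(j), t(j))`. -/
def Map (s t : SimplicialSection φ M) : SSet.{w} where
  obj n := { T : ∀ j, (s.obj j ⟶[SSet.{w}] t.obj j).obj n // IsNatural T }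
  map θ := ↾fun T ↦ ⟨fun j ↦ (s.obj j ⟶[SSet.{w}] t.obj j).map θ (T.1 j), T.2.map θ⟩
  map_id n := by
    ext T j
    exact map_id_apply _ (T.1 j)
  map_comp θ θ' := by
    ext T j
    exact map_comp_apply _ θ θ' (T.1 j)

/-- The projection `Map(s, t) ⟶ Map(s(j), t(j))`. -/
def Map.ev (s t : SimplicialSection φ M) (j : J) : Map s t ⟶ (s.obj j ⟶[SSet.{w}] t.obj j) where
  app n := ↾fun T ↦ T.1 j

/-- The simplicial set of natural families is an enrichment of the category of simplicial
sections. -/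
instance : EnrichedCategory SSet.{w} (SimplicialSection φ M) where
  Hom s t := Map s t
  id s :=
    { app n := ↾fun _ ↦ ⟨fun j ↦ sId (s.obj j) n, IsNatural.id s n⟩
      naturality _ _ θ := by
        ext ⟨⟩
        exact Subtype.ext (funext fun j ↦ (map_sId (s.obj j) θ).symm) }
  comp s t r :=
    { app n := ↾fun p ↦ ⟨fun j ↦ sComp (p.1.1 j) (p.2.1 j), p.1.2.comp p.2.2⟩
      naturality _ _ θ := by
        ext ⟨T, T'⟩
        exact Subtype.ext (funext fun j ↦ (map_sComp θ (T.1 j) (T'.1 j)).symm) }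
  id_comp s t := by
    ext n T
    exact Subtype.ext (funext fun j ↦ sId_sComp (T.1 j))
  comp_id s t := by
    ext n T
    exact Subtype.ext (funext fun j ↦ sComp_sId (T.1 j))
  assoc s t r q := by
    ext n ⟨T, T', T''⟩
    exact Subtype.ext (funext fun j ↦ sComp_assoc (T.1 j) (T'.1 j) (T''.1 j))

/-- Morphisms of simplicial sections identify with the vertices of the mapping spaces. -/
def homEquiv (s t : SimplicialSection φ M) : (s ⟶ t) ≃ (𝟙_ SSet.{w} ⟶ (s ⟶[SSet.{w}] t)) where
  toFun f :=
    { app n := ↾fun _ ↦ ⟨fun j ↦ sHomOf (f.app j) n, fun m θ j j' γ ↦ by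
        rw [map_sHomOf, map_sHomOf]
        exact f.naturality γ⟩
      naturality _ _ θ := by
        ext ⟨⟩
        exact Subtype.ext (funext fun j ↦ (map_sHomOf (f.app j) θ).symm) }
  invFun x :=
    { app j := (eHomEquiv SSet.{w}).symm (x ≫ Map.ev s t j)
      naturality n j j' γ := by
        have h (j : J) : sHomOf ((eHomEquiv SSet.{w}).symm (x ≫ Map.ev s t j)) n =
            (x.app n PUnit.unit).1 j :=
          ConcreteCategory.congr_hom (NatTrans.congr_app
            (Equiv.apply_symm_apply (eHomEquiv SSet.{w}) (x ≫ Map.ev s t j)) n) PUnit.unit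
        rw [h, h]
        have := (x.app n PUnit.unit).2 (𝟙 n) γ
        rwa [Functor.map_id_apply, Functor.map_id_apply] at this }
  left_inv f := Hom.ext (funext fun j ↦ (Equiv.symm_apply_eq _).2 rfl)
  right_inv x := by
    ext n ⟨⟩
    exact Subtype.ext (funext fun j ↦ ConcreteCategory.congr_hom (NatTrans.congr_app
      (Equiv.apply_symm_apply (eHomEquiv SSet.{w}) (x ≫ Map.ev s t j)) n) PUnit.unit)

/-- The category of simplicial sections is a simplicial category. -/
instance : SimplicialCategory (SimplicialSection φ M) where
  homEquiv {s t} := homEquiv s t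
  homEquiv_id s := by
    ext n ⟨⟩
    exact Subtype.ext (funext fun j ↦ sHomOf_id (s.obj j) n)
  homEquiv_comp f g := by
    ext n ⟨⟩
    exact Subtype.ext (funext fun j ↦ sHomOf_comp (f.app j) (g.app j) n)

end SimplicialSection

/-- The simplicial subset `Map^α(j, j')` of `Map(j, j')` which is the preimage of `α`. -/
def mapOver (φ : EnrichedFunctor SSet.{w} J (Disc I)) {j j' : J}
    (α : (φ.obj j).as ⟶ (φ.obj j').as) : (j ⟶[SSet.{w}] j').Subcomplex where
  obj n := { γ | (φ.map j j').app n γ = α }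
  map {n m} θ γ hγ := by
    have h : (φ.map j j').app n γ = α := hγ
    have h' := NatTrans.naturality_apply (φ.map j j') θ γ
    exact h'.trans h

namespace SimplicialSection

/-- The condition that `η : X ⟶ s(j)` exhibits the section `s` as the free section `s_{j, X}`,
i.e. for every `j'` the maps `Map^α(j, j') ⊗ α_! X ⟶ Map^α(j, j') ⊗ α_! s(j) ⟶ s(j')` (induced
by `η` and by the action of `s`) exhibit `s(j')` as the coproduct
`∐_{α : φ j ⟶ φ j'} Map^α(j, j') ⊗ α_! X`. -/
def IsFreeSection {j : J} {X : M.obj (φ.obj j).as} {s : SimplicialSection φ M}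
    (η : X ⟶ s.obj j) : Prop :=
  ∀ (j' : J) (T : ∀ α : (φ.obj j).as ⟶ (φ.obj j').as,
      SimplicialTensor ((mapOver φ α : (j ⟶[SSet.{w}] j').Subcomplex) : SSet.{w}) (M.push α X)),
    ∃ c : ∀ α, (T α).obj ⟶ s.obj j',
      (∀ α (n : SimplexCategoryᵒᵖ) (γ : ((mapOver φ α) : SSet.{w}).obj n),
        Total.mk' (A := ⟨(φ.obj j).as, X⟩) (B := ⟨(φ.obj j').as, s.obj j'⟩) α
          (sComp ((T α).unit.app n γ) (sHomOf (c α) n)) =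
            Total.pre (sHomOf η n) (s.act γ.1)) ∧
      Nonempty (IsColimit (Cofan.mk (s.obj j') c))

variable (φ M)

/-- The levelwise weak equivalences between simplicial sections. -/
def levelwiseWeakEquivalences : MorphismProperty (SimplicialSection φ M) :=
  fun _ _ T ↦ ∀ j, weakEquivalences _ ((ev φ M j).map T)

/-- The levelwise fibrations between simplicial sections. -/
def levelwiseFibrations : MorphismProperty (SimplicialSection φ M) :=
  fun _ _ T ↦ ∀ j, fibrations _ ((ev φ M j).map T)

end SimplicialSection

end Sections

end SimplicialSections

open SimplicialSections

-- The projective structure is transferred along the evaluations `ev φ M j`. This needs levelwise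
-- limits, colimits and cotensors of sections, left adjoints of the evaluations, local
-- presentability, and an acyclicity statement for the generating trivial cofibrations.
--
-- A section amounts to objects `s(j)` together with maps `α_! s(j) ⟶ s(j')` indexed by the
-- simplices of `Map(j, j')` over `α`, subject to coherence. Since `α_!` is a simplicial left
-- adjoint it preserves weighted colimits, so the action on a levelwise weighted colimit `P` comes
-- from the universal property of `α_! P(j)`; on a levelwise weighted limit it comes from the
-- universal property of `P(j')`. Weighted diagrams treat ordinary (co)limits and (co)tensors at
-- once: `isUniversal_colimitSectionCocone`, `isUniversal_limitSectionCone`.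
--
-- The free section on `X` at `j` is a Yoneda construction: its value at `j'` is generated by copies
-- of `α_! X` indexed by the simplices `γ` of `Map(j, j')`, and `δ` acts by `γ ↦ γδ`. Its universal
-- property is `bijective_freeUnit_comp`.
--
-- The evaluations preserve colimits and are jointly conservative and faithful, so free sections on
-- strong generators form a strong generator of presentable objects
-- (`isLocallyPresentable_of_adjunctions`). The small object argument is thus available.
--
-- For acyclicity, the free section on a trivial cofibration `f` is levelwise a coproduct of maps
-- `Map^α(j, j') ⊗ α_! f`, hence a trivial cofibration by (SM7)
-- (`trivialCofibration_app_of_freeUnit_comp`). As evaluations commute with pushouts, transfinite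
-- compositions and retracts, the whole saturated class consists of levelwise trivial cofibrations,
-- and the retract argument concludes (`exists_modelCategory_of_adjunctions`).
--
-- Finally, (SM7) transposes to a statement on the maps `X ^ L ⟶ X ^ K ×_{Y ^ K} Y ^ L`. It involves
-- only limits, cotensors, fibrations and weak equivalences, all of which are levelwise.

universe v v'

namespace SimplicialSections

/-! ### Representable simplicial sets and morphisms as compatible families of simplices. -/

section Representable

/-- The simplicial set represented by `n`, whose `m`-simplices are the maps `n ⟶ m`
in `SimplexCategoryᵒᵖ`. -/
def repr (n : SimplexCategoryᵒᵖ) : SSet.{w} where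
  obj m := ULift.{w} (n ⟶ m)
  map ξ := ↾fun θ ↦ ⟨θ.down ≫ ξ⟩

/-- The map from a representable simplicial set given by an `n`-simplex. -/
def ofSimplex {K : SSet.{w}} {n : SimplexCategoryᵒᵖ} (x : K.obj n) : repr.{w} n ⟶ K where
  app m := ↾fun θ ↦ K.map θ.down x
  naturality m m' ξ := by
    ext θ
    exact map_comp_apply K θ.down ξ x

/-- The `m`-simplex of `repr n` given by a map `n ⟶ m`. -/
def reprMk {n m : SimplexCategoryᵒᵖ} (θ : n ⟶ m) : (repr.{w} n).obj m := ⟨θ⟩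

/-- Yoneda: a map out of `repr n` is determined by its value on the universal simplex `reprMk (𝟙
n)`. -/
lemma app_reprMk {K : SSet.{w}} {n m : SimplexCategoryᵒᵖ} (f : repr.{w} n ⟶ K) (θ : n ⟶ m) :
    f.app m (reprMk θ) = K.map θ (f.app n (reprMk (𝟙 n))) := by
  have e : (repr.{w} n).map θ (reprMk (𝟙 n)) = reprMk θ := ULift.ext _ _ (Category.id_comp θ)
  rw [← e]
  exact NatTrans.naturality_apply f θ (reprMk (𝟙 n))

lemma ofSimplex_id {K : SSet.{w}} {n : SimplexCategoryᵒᵖ} (x : K.obj n) :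
    (ofSimplex x).app n (reprMk (𝟙 n)) = x := map_id_apply K x

end Representable

section HomOfSimplices

variable {C : Type u} [Category.{w} C] [SimplicialCategory C]

/-- The unit simplicial set has one simplex in each degree, so a family of simplices compatible with
all simplicial operators is a map from the unit to `Map(X, Y)`, i.e. a morphism. This is how
ordinary morphisms are extracted from universal properties stated on simplices. -/
lemma exists_sHomOf_eq {X Y : C} (x : ∀ n, (X ⟶[SSet.{w}] Y).obj n)
    (hx : ∀ ⦃n m⦄ (θ : n ⟶ m), (X ⟶[SSet.{w}] Y).map θ (x n) = x m) :
    ∃ f : X ⟶ Y, ∀ n, sHomOf f n = x n := by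
  let g : 𝟙_ SSet.{w} ⟶ (X ⟶[SSet.{w}] Y) :=
    { app n := ↾fun _ ↦ x n
      naturality n m θ := by
        ext ⟨⟩
        exact (hx θ).symm }
  exact ⟨(eHomEquiv SSet.{w}).symm g, fun n ↦ ConcreteCategory.congr_hom (NatTrans.congr_app
    (Equiv.apply_symm_apply (eHomEquiv SSet.{w}) g) n) PUnit.unit⟩

end HomOfSimplices

/-! ### Weighted diagrams and their simplicial universal properties. -/

set_option linter.checkUnivs false in
/-- The shape of a weighted diagram: a type of indices `ι`, weights `wt a` for `a : ι`,
and types of arrows `E a b`. -/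
structure WeightedShape where
  /-- the type of indices -/
  ι : Type v
  /-- the weights -/
  wt : ι → SSet.{w}
  /-- the arrows -/
  E : ι → ι → Type v'

namespace WeightedShape

/-- The contravariant functoriality of the weights. -/
abbrev Restriction (S : WeightedShape.{w, v, v'}) :=
  ∀ ⦃a b : S.ι⦄, S.E a b → (S.wt b ⟶ S.wt a)

/-- The covariant functoriality of the weights. -/
abbrev Transition (S : WeightedShape.{w, v, v'}) :=
  ∀ ⦃a b : S.ι⦄, S.E a b → (S.wt a ⟶ S.wt b)

end WeightedShape

/-- A diagram of objects of a simplicial category of a given weighted shape: for `e : E a b`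
there is a map `arr e : obj a ⟶ obj b` (considered in all simplicial degrees). -/
structure WeightedDiagram (S : WeightedShape.{w, v, v'}) (C : Type u)
    [EnrichedCategory SSet.{w} C] where
  /-- the objects -/
  obj : S.ι → C
  /-- the maps between the objects -/
  arr {a b : S.ι} (e : S.E a b) (n : SimplexCategoryᵒᵖ) : (obj a ⟶[SSet.{w}] obj b).obj n

namespace WeightedDiagram

variable {S : WeightedShape.{w, v, v'}} {ρ : S.Restriction} {σ : S.Transition}

section

variable {C : Type u} [EnrichedCategory SSet.{w} C] {D : Type u₁} [EnrichedCategory SSet.{w} D]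

/-- The image of a weighted diagram by a simplicial functor. -/
abbrev map (G : EnrichedFunctor SSet.{w} C D) (A : WeightedDiagram S C) :
    WeightedDiagram S D where
  obj a := G.obj (A.obj a)
  arr e n := sMap G (A.arr e n)

variable {A : WeightedDiagram S C}

/-- A weighted cocone under a weighted diagram. -/
structure Cocone (A : WeightedDiagram S C) (ρ : S.Restriction) (P : C) where
  /-- the structure maps -/
  u (a : S.ι) : S.wt a ⟶ (A.obj a ⟶[SSet.{w}] P)
  arr_u {a b : S.ι} (e : S.E a b) (n : SimplexCategoryᵒᵖ) (x : (S.wt b).obj n) :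
    sComp (A.arr e n) ((u b).app n x) = (u a).app n ((ρ e).app n x)

/-- An `n`-simplex of the simplicial set of weighted cocones with target `Z`. -/
structure CoconeSimplex (A : WeightedDiagram S C) (ρ : S.Restriction) (Z : C)
    (n : SimplexCategoryᵒᵖ) where
  /-- the structure maps -/
  x (a : S.ι) {m : SimplexCategoryᵒᵖ} (θ : n ⟶ m) (k : (S.wt a).obj m) :
    (A.obj a ⟶[SSet.{w}] Z).obj m
  map_x (a : S.ι) {m m' : SimplexCategoryᵒᵖ} (θ : n ⟶ m) (θ' : m ⟶ m') (k : (S.wt a).obj m) :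
    (A.obj a ⟶[SSet.{w}] Z).map θ' (x a θ k) = x a (θ ≫ θ') ((S.wt a).map θ' k)
  arr_x {a b : S.ι} (e : S.E a b) {m : SimplexCategoryᵒᵖ} (θ : n ⟶ m) (k : (S.wt b).obj m) :
    sComp (A.arr e m) (x b θ k) = x a θ ((ρ e).app m k)

/-- A weighted cone over a weighted diagram. -/
structure Cone (A : WeightedDiagram S C) (σ : S.Transition) (P : C) where
  /-- the structure maps -/
  u (a : S.ι) : S.wt a ⟶ (P ⟶[SSet.{w}] A.obj a)
  u_arr {a b : S.ι} (e : S.E a b) (n : SimplexCategoryᵒᵖ) (x : (S.wt a).obj n) :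
    sComp ((u a).app n x) (A.arr e n) = (u b).app n ((σ e).app n x)

/-- An `n`-simplex of the simplicial set of weighted cones with source `Z`. -/
structure ConeSimplex (A : WeightedDiagram S C) (σ : S.Transition) (Z : C)
    (n : SimplexCategoryᵒᵖ) where
  /-- the structure maps -/
  x (a : S.ι) {m : SimplexCategoryᵒᵖ} (θ : n ⟶ m) (k : (S.wt a).obj m) :
    (Z ⟶[SSet.{w}] A.obj a).obj m
  map_x (a : S.ι) {m m' : SimplexCategoryᵒᵖ} (θ : n ⟶ m) (θ' : m ⟶ m') (k : (S.wt a).obj m) :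
    (Z ⟶[SSet.{w}] A.obj a).map θ' (x a θ k) = x a (θ ≫ θ') ((S.wt a).map θ' k)
  x_arr {a b : S.ι} (e : S.E a b) {m : SimplexCategoryᵒᵖ} (θ : n ⟶ m) (k : (S.wt a).obj m) :
    sComp (x a θ k) (A.arr e m) = x b θ ((σ e).app m k)

variable {P : C}

lemma Cocone.map_u (c : A.Cocone ρ P) (a : S.ι) {n m : SimplexCategoryᵒᵖ} (θ : n ⟶ m)
    (x : (S.wt a).obj n) :
    (A.obj a ⟶[SSet.{w}] P).map θ ((c.u a).app n x) = (c.u a).app m ((S.wt a).map θ x) :=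
  (NatTrans.naturality_apply (c.u a) θ x).symm

lemma Cone.map_u (c : A.Cone σ P) (a : S.ι) {n m : SimplexCategoryᵒᵖ} (θ : n ⟶ m)
    (x : (S.wt a).obj n) :
    (P ⟶[SSet.{w}] A.obj a).map θ ((c.u a).app n x) = (c.u a).app m ((S.wt a).map θ x) :=
  (NatTrans.naturality_apply (c.u a) θ x).symm

/-- The universal property of a weighted colimit. -/
def Cocone.IsUniversal (c : A.Cocone ρ P) : Prop :=
  ∀ (Z : C) (n : SimplexCategoryᵒᵖ) (s : A.CoconeSimplex ρ Z n),
    ∃! f : (P ⟶[SSet.{w}] Z).obj n, ∀ (a : S.ι) (m : SimplexCategoryᵒᵖ) (θ : n ⟶ m)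
      (k : (S.wt a).obj m), sComp ((c.u a).app m k) ((P ⟶[SSet.{w}] Z).map θ f) = s.x a θ k

/-- The universal property of a weighted limit. -/
def Cone.IsUniversal (c : A.Cone σ P) : Prop :=
  ∀ (Z : C) (n : SimplexCategoryᵒᵖ) (s : A.ConeSimplex σ Z n),
    ∃! f : (Z ⟶[SSet.{w}] P).obj n, ∀ (a : S.ι) (m : SimplexCategoryᵒᵖ) (θ : n ⟶ m)
      (k : (S.wt a).obj m), sComp ((Z ⟶[SSet.{w}] P).map θ f) ((c.u a).app m k) = s.x a θ k

/-- The simplex of cocones obtained by composing a cocone with a simplex of a mapping space. -/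
@[simps]
def Cocone.postcomp (c : A.Cocone ρ P) {Z : C} {n : SimplexCategoryᵒᵖ}
    (f : (P ⟶[SSet.{w}] Z).obj n) : A.CoconeSimplex ρ Z n where
  x a m θ k := sComp ((c.u a).app m k) ((P ⟶[SSet.{w}] Z).map θ f)
  map_x a m m' θ θ' k := by rw [map_sComp, c.map_u, ← map_comp_apply]
  arr_x e m θ k := by rw [← sComp_assoc, c.arr_u]

/-- The simplex of cones obtained by composing a simplex of a mapping space with a cone. -/
@[simps]
def Cone.precomp (c : A.Cone σ P) {Z : C} {n : SimplexCategoryᵒᵖ}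
    (f : (Z ⟶[SSet.{w}] P).obj n) : A.ConeSimplex σ Z n where
  x a m θ k := sComp ((Z ⟶[SSet.{w}] P).map θ f) ((c.u a).app m k)
  map_x a m m' θ θ' k := by rw [map_sComp, c.map_u, ← map_comp_apply]
  x_arr e m θ k := by rw [sComp_assoc, c.u_arr]

/-- Both simplices solve the universal problem posed by `c.postcomp g`. The hypothesis quantifies
over all restrictions `θ`, since the weights may have simplices in every degree. -/
lemma Cocone.IsUniversal.hom_ext {c : A.Cocone ρ P} (hc : c.IsUniversal) {Z : C}
    {n : SimplexCategoryᵒᵖ} {f g : (P ⟶[SSet.{w}] Z).obj n}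
    (h : ∀ (a : S.ι) (m : SimplexCategoryᵒᵖ) (θ : n ⟶ m) (k : (S.wt a).obj m),
      sComp ((c.u a).app m k) ((P ⟶[SSet.{w}] Z).map θ f) =
        sComp ((c.u a).app m k) ((P ⟶[SSet.{w}] Z).map θ g)) : f = g :=
  (hc Z n (c.postcomp g)).unique h (fun _ _ _ _ ↦ rfl)

lemma Cone.IsUniversal.hom_ext {c : A.Cone σ P} (hc : c.IsUniversal) {Z : C}
    {n : SimplexCategoryᵒᵖ} {f g : (Z ⟶[SSet.{w}] P).obj n}
    (h : ∀ (a : S.ι) (m : SimplexCategoryᵒᵖ) (θ : n ⟶ m) (k : (S.wt a).obj m),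
      sComp ((Z ⟶[SSet.{w}] P).map θ f) ((c.u a).app m k) =
        sComp ((Z ⟶[SSet.{w}] P).map θ g) ((c.u a).app m k)) : f = g :=
  (hc Z n (c.precomp g)).unique h (fun _ _ _ _ ↦ rfl)

/-- The simplex induced by the universal property of a weighted colimit. -/
noncomputable def Cocone.IsUniversal.desc {c : A.Cocone ρ P} (hc : c.IsUniversal) {Z : C}
    {n : SimplexCategoryᵒᵖ} (s : A.CoconeSimplex ρ Z n) : (P ⟶[SSet.{w}] Z).obj n :=
  (hc Z n s).choose

lemma Cocone.IsUniversal.fac {c : A.Cocone ρ P} (hc : c.IsUniversal) {Z : C}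
    {n : SimplexCategoryᵒᵖ} (s : A.CoconeSimplex ρ Z n) (a : S.ι) {m : SimplexCategoryᵒᵖ}
    (θ : n ⟶ m) (k : (S.wt a).obj m) :
    sComp ((c.u a).app m k) ((P ⟶[SSet.{w}] Z).map θ (hc.desc s)) = s.x a θ k :=
  (hc Z n s).choose_spec.1 a m θ k

/-- The simplex induced by the universal property of a weighted limit. -/
noncomputable def Cone.IsUniversal.lift {c : A.Cone σ P} (hc : c.IsUniversal) {Z : C}
    {n : SimplexCategoryᵒᵖ} (s : A.ConeSimplex σ Z n) : (Z ⟶[SSet.{w}] P).obj n :=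
  (hc Z n s).choose

lemma Cone.IsUniversal.fac {c : A.Cone σ P} (hc : c.IsUniversal) {Z : C}
    {n : SimplexCategoryᵒᵖ} (s : A.ConeSimplex σ Z n) (a : S.ι) {m : SimplexCategoryᵒᵖ}
    (θ : n ⟶ m) (k : (S.wt a).obj m) :
    sComp ((Z ⟶[SSet.{w}] P).map θ (hc.lift s)) ((c.u a).app m k) = s.x a θ k :=
  (hc Z n s).choose_spec.1 a m θ k

/-- The image of a weighted cocone by a simplicial functor. -/
def Cocone.map (G : EnrichedFunctor SSet.{w} C D) (c : A.Cocone ρ P) :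
    (A.map G).Cocone ρ (G.obj P) where
  u a := c.u a ≫ G.map _ _
  arr_u {a b} e n x := by
    refine (sMap_sComp G _ _).symm.trans (congrArg (sMap G) (c.arr_u e n x))

end

section

variable {C : Type u} [Category.{w} C] [SimplicialCategory C] {D : Type u₁} [Category.{w} D]
  [SimplicialCategory D]
  {A : WeightedDiagram S C} {P : C}

/-- A morphism out of a weighted colimit. -/
lemma Cocone.IsUniversal.exists_hom {c : A.Cocone ρ P} (hc : c.IsUniversal) {Z : C}
    (c' : A.Cocone ρ Z) :
    ∃ f : P ⟶ Z, ∀ (a : S.ι) (n : SimplexCategoryᵒᵖ) (k : (S.wt a).obj n),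
      sComp ((c.u a).app n k) (sHomOf f n) = (c'.u a).app n k := by
  -- An ordinary cocone yields a constant simplex of cocones in each degree, independent of `θ`.
  let s (n : SimplexCategoryᵒᵖ) : A.CoconeSimplex ρ Z n :=
    { x a m _ k := (c'.u a).app m k
      map_x a m m' θ θ' k := c'.map_u a θ' k
      arr_x e m θ k := c'.arr_u e m k }
  -- Uniqueness forces the induced simplices in different degrees to be restrictions of one another,
  -- so they come from a morphism.
  obtain ⟨f, hf⟩ := exists_sHomOf_eq (fun n ↦ hc.desc (s n)) (fun n m θ ↦ hc.hom_ext
    (fun a m' θ' k ↦ by rw [hc.fac (s m), ← map_comp_apply, hc.fac (s n)]))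
  refine ⟨f, fun a n k ↦ ?_⟩
  have h := hc.fac (s n) a (𝟙 n) k
  rwa [map_id_apply, ← hf] at h

lemma Cocone.IsUniversal.ordinary_hom_ext {c : A.Cocone ρ P} (hc : c.IsUniversal) {Z : C}
    {f g : P ⟶ Z} (h : ∀ (a : S.ι) (n : SimplexCategoryᵒᵖ) (k : (S.wt a).obj n),
      sComp ((c.u a).app n k) (sHomOf f n) = sComp ((c.u a).app n k) (sHomOf g n)) : f = g :=
  sHomOf_ext (fun n ↦ hc.hom_ext (fun a m θ k ↦ by rw [map_sHomOf, map_sHomOf, h]))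

/-- A morphism to a weighted limit. -/
lemma Cone.IsUniversal.exists_hom {c : A.Cone σ P} (hc : c.IsUniversal) {Z : C}
    (c' : A.Cone σ Z) :
    ∃ f : Z ⟶ P, ∀ (a : S.ι) (n : SimplexCategoryᵒᵖ) (k : (S.wt a).obj n),
      sComp (sHomOf f n) ((c.u a).app n k) = (c'.u a).app n k := by
  let s (n : SimplexCategoryᵒᵖ) : A.ConeSimplex σ Z n :=
    { x a m _ k := (c'.u a).app m k
      map_x a m m' θ θ' k := c'.map_u a θ' k
      x_arr e m θ k := c'.u_arr e m k }
  obtain ⟨f, hf⟩ := exists_sHomOf_eq (fun n ↦ hc.lift (s n)) (fun n m θ ↦ hc.hom_ext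
    (fun a m' θ' k ↦ by rw [hc.fac (s m), ← map_comp_apply, hc.fac (s n)]))
  refine ⟨f, fun a n k ↦ ?_⟩
  have h := hc.fac (s n) a (𝟙 n) k
  rwa [map_id_apply, ← hf] at h

lemma Cone.IsUniversal.ordinary_hom_ext {c : A.Cone σ P} (hc : c.IsUniversal) {Z : C}
    {f g : Z ⟶ P} (h : ∀ (a : S.ι) (n : SimplexCategoryᵒᵖ) (k : (S.wt a).obj n),
      sComp (sHomOf f n) ((c.u a).app n k) = sComp (sHomOf g n) ((c.u a).app n k)) : f = g :=
  sHomOf_ext (fun n ↦ hc.hom_ext (fun a m θ k ↦ by rw [map_sHomOf, map_sHomOf, h]))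

end

end WeightedDiagram

/-! ### Simplicial adjunctions on simplices, and preservation of weighted colimits. -/

namespace SimplicialAdjunction

variable {C : Type u} [Category.{w} C] [SimplicialCategory C] {D : Type u₁} [Category.{w} D]
  [SimplicialCategory D] {L : EnrichedFunctor SSet.{w} C D} {R : EnrichedFunctor SSet.{w} D C}
  (adj : SimplicialAdjunction L R)

/-- The bijection `Map(L X, Y)_n ≃ Map(X, R Y)_n`. -/
def simplexEquiv {X : C} {Y : D} (n : SimplexCategoryᵒᵖ) :
    (L.obj X ⟶[SSet.{w}] Y).obj n ≃ (X ⟶[SSet.{w}] R.obj Y).obj n :=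
  ((adj.homIso X Y).app n).toEquiv

lemma map_simplexEquiv {X : C} {Y : D} {n m : SimplexCategoryᵒᵖ} (θ : n ⟶ m)
    (f : (L.obj X ⟶[SSet.{w}] Y).obj n) :
    (X ⟶[SSet.{w}] R.obj Y).map θ (adj.simplexEquiv n f) =
      adj.simplexEquiv m ((L.obj X ⟶[SSet.{w}] Y).map θ f) :=
  (NatTrans.naturality_apply (adj.homIso X Y).hom θ f).symm

lemma map_simplexEquiv_symm {X : C} {Y : D} {n m : SimplexCategoryᵒᵖ} (θ : n ⟶ m)
    (f : (X ⟶[SSet.{w}] R.obj Y).obj n) :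
    (L.obj X ⟶[SSet.{w}] Y).map θ ((adj.simplexEquiv n).symm f) =
      (adj.simplexEquiv m).symm ((X ⟶[SSet.{w}] R.obj Y).map θ f) := by
  rw [Equiv.eq_symm_apply, ← map_simplexEquiv, Equiv.apply_symm_apply]

lemma simplexEquiv_sComp {X X' : C} {Y : D} {n : SimplexCategoryᵒᵖ}
    (f : (X ⟶[SSet.{w}] X').obj n) (g : (L.obj X' ⟶[SSet.{w}] Y).obj n) :
    adj.simplexEquiv n (sComp (sMap L f) g) = sComp f (adj.simplexEquiv n g) :=
  ConcreteCategory.congr_hom (NatTrans.congr_app (adj.naturality_left X X' Y) n) (pair f g :)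

end SimplicialAdjunction

namespace WeightedDiagram

variable {C : Type u} [Category.{w} C] [SimplicialCategory C] {D : Type u₁} [Category.{w} D]
  [SimplicialCategory D] {S : WeightedShape.{w, v, v'}} {ρ : S.Restriction}
  {A : WeightedDiagram S C} {P : C}

/-- Simplicial left adjoints preserve weighted colimits. -/
lemma Cocone.IsUniversal.map_of_adjunction {c : A.Cocone ρ P} (hc : c.IsUniversal)
    {L : EnrichedFunctor SSet.{w} C D} {R : EnrichedFunctor SSet.{w} D C}
    (adj : SimplicialAdjunction L R) : (c.map L).IsUniversal := by
  intro Z n s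
  let s' : A.CoconeSimplex ρ (R.obj Z) n :=
    { x a m θ k := adj.simplexEquiv m (s.x a θ k)
      map_x a m m' θ θ' k := by
        rw [adj.map_simplexEquiv]
        exact congrArg _ (s.map_x a θ θ' k)
      arr_x {a b} e m θ k := by
        rw [← adj.simplexEquiv_sComp]
        exact congrArg _ (s.arr_x e θ k) }
  -- By naturality of the adjunction, `f` solves the problem for the image cocone exactly when its
  -- transpose solves the transposed problem.
  have key (f : (L.obj P ⟶[SSet.{w}] Z).obj n) (a : S.ι) (m : SimplexCategoryᵒᵖ) (θ : n ⟶ m)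
      (k : (S.wt a).obj m) :
      sComp (((c.map L).u a).app m k) ((L.obj P ⟶[SSet.{w}] Z).map θ f) = s.x a θ k ↔
      sComp ((c.u a).app m k) ((P ⟶[SSet.{w}] R.obj Z).map θ (adj.simplexEquiv n f)) =
        s'.x a θ k := by
    rw [adj.map_simplexEquiv, ← adj.simplexEquiv_sComp]
    exact (adj.simplexEquiv m).injective.eq_iff.symm
  refine ⟨(adj.simplexEquiv n).symm (hc.desc s'), fun a m θ k ↦ ?_, fun f hf ↦ ?_⟩
  · rw [key, Equiv.apply_symm_apply, hc.fac]
  · rw [Equiv.eq_symm_apply]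
    exact hc.hom_ext (fun a m θ k ↦ ((key f a m θ k).1 (hf a m θ k)).trans (hc.fac s' a θ k).symm)

end WeightedDiagram

end SimplicialSections

namespace SimplicialSections

/-! ### Tensors, cotensors and ordinary (co)limits as weighted (co)limits. -/

namespace WeightedShape

/-- The weighted shape without arrows. -/
abbrev discrete {ι : Type v} (W : ι → SSet.{w}) : WeightedShape.{w, v, 0} where
  ι := ι
  wt := W
  E _ _ := PEmpty

/-- The weighted shape given by a category, with trivial weights. -/
abbrev conical (K : Type v) [Category.{v'} K] : WeightedShape.{w, v, v'} where
  ι := K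
  wt _ := 𝟙_ SSet.{w}
  E a b := a ⟶ b

/-- The contravariant functoriality of the weights of a shape without arrows. -/
abbrev discreteRestriction {ι : Type v} (W : ι → SSet.{w}) : (discrete W).Restriction :=
  fun _ _ e ↦ PEmpty.elim e

/-- The covariant functoriality of the weights of a shape without arrows. -/
abbrev discreteTransition {ι : Type v} (W : ι → SSet.{w}) : (discrete W).Transition :=
  fun _ _ e ↦ PEmpty.elim e

/-- The contravariant functoriality of trivial weights. -/
abbrev conicalRestriction (K : Type v) [Category.{v'} K] : (conical.{w} K).Restriction :=
  fun _ _ _ ↦ 𝟙 _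

/-- The covariant functoriality of trivial weights. -/
abbrev conicalTransition (K : Type v) [Category.{v'} K] : (conical.{w} K).Transition :=
  fun _ _ _ ↦ 𝟙 _

end WeightedShape

open WeightedShape

namespace WeightedDiagram

section

variable {C : Type u} [EnrichedCategory SSet.{w} C]

/-- The weighted diagram given by a family of objects. -/
abbrev discrete {ι : Type v} (W : ι → SSet.{w}) (X : ι → C) :
    WeightedDiagram (WeightedShape.discrete W) C where
  obj := X
  arr e _ := PEmpty.elim e

/-- The cocone under a family of objects given by a family of maps. -/
abbrev discreteCocone {ι : Type v} {W : ι → SSet.{w}} {X : ι → C} {P : C}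
    (u : ∀ a, W a ⟶ (X a ⟶[SSet.{w}] P)) : (discrete W X).Cocone (discreteRestriction W) P where
  u := u
  arr_u e := PEmpty.elim e

/-- The cone over a family of objects given by a family of maps. -/
abbrev discreteCone {ι : Type v} {W : ι → SSet.{w}} {X : ι → C} {P : C}
    (u : ∀ a, W a ⟶ (P ⟶[SSet.{w}] X a)) : (discrete W X).Cone (discreteTransition W) P where
  u := u
  u_arr e := PEmpty.elim e

end

variable {C : Type u} [Category.{w} C] [SimplicialCategory C]

/-- The weighted diagram given by a functor. -/
abbrev ofFunctor {K : Type v} [Category.{v'} K] (F : K ⥤ C) :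
    WeightedDiagram (conical.{w} K) C where
  obj := F.obj
  arr e n := sHomOf (F.map e) n

/-- The weighted cocone given by a cocone. -/
abbrev ofCocone {K : Type v} [Category.{v'} K] {F : K ⥤ C} (c : Limits.Cocone F) :
    (ofFunctor F).Cocone (conicalRestriction K) c.pt where
  u k := eHomEquiv SSet.{w} (c.ι.app k)
  arr_u e n x := (sHomOf_comp (F.map e) (c.ι.app _) n).symm.trans (by rw [c.w]; rfl)

/-- The weighted cone given by a cone. -/
abbrev ofCone {K : Type v} [Category.{v'} K] {F : K ⥤ C} (c : Limits.Cone F) :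
    (ofFunctor F).Cone (conicalTransition K) c.pt where
  u k := eHomEquiv SSet.{w} (c.π.app k)
  u_arr e n x := (sHomOf_comp (c.π.app _) (F.map e) n).symm.trans (by rw [c.w]; rfl)

end WeightedDiagram

open WeightedDiagram

variable {C : Type u} [Category.{w} C] [SimplicialCategory C]

/-- The universal property of a tensor. -/
lemma SimplicialTensor.isUniversal {K : SSet.{w}} {X : C} (T : SimplicialTensor K X) :
    (discreteCocone (X := fun _ : PUnit.{1} ↦ X) (fun _ ↦ T.unit)).IsUniversal := by
  intro Z n s
  -- A simplex of weighted cocones with the single weight `K` is the same as a map `K ⊗ repr n ⟶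
  -- Map(X, Z)`, so the defining bijection of the tensor is applied with `L = repr n`.
  let g : K ⊗ repr n ⟶ (X ⟶[SSet.{w}] Z) :=
    { app m := ↾fun p ↦ s.x PUnit.unit p.2.down p.1
      naturality m m' θ' := by
        ext ⟨k, ⟨θ⟩⟩
        exact (s.map_x PUnit.unit θ θ' k).symm }
  obtain ⟨f, hf⟩ := (T.bijective Z (repr n)).2 g
  have hf' (m : SimplexCategoryᵒᵖ) (θ : n ⟶ m) (k : K.obj m) :
      sComp (T.unit.app m k) (f.app m (reprMk θ)) = s.x PUnit.unit θ k :=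
    ConcreteCategory.congr_hom (NatTrans.congr_app hf m) (pair k (reprMk θ) :)
  have e (m : SimplexCategoryᵒᵖ) (θ : n ⟶ m) :
      (T.obj ⟶[SSet.{w}] Z).map θ (f.app n (reprMk (𝟙 n))) = f.app m (reprMk θ) :=
    (app_reprMk f θ).symm
  refine ⟨f.app n (reprMk (𝟙 n)), fun _ m θ k ↦ ?_, fun f' hf' ↦ ?_⟩
  · rw [e]
    exact hf' m θ k
  -- Another solution `f'` gives by Yoneda a map `ofSimplex f'` with the same image as `f` under the
  -- bijection.
  · have : f = ofSimplex f' := (T.bijective Z (repr n)).1 (by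
      refine hf.trans ?_
      apply NatTrans.ext
      ext m ⟨k, ⟨θ⟩⟩
      exact (hf' PUnit.unit m θ k).symm)
    rw [this, ofSimplex_id]

/-- The universal property of a cotensor. -/
lemma SimplicialCotensor.isUniversal {K : SSet.{w}} {X : C} (T : SimplicialCotensor K X) :
    (discreteCone (X := fun _ : PUnit.{1} ↦ X) (fun _ ↦ T.counit)).IsUniversal := by
  intro Z n s
  let g : repr n ⊗ K ⟶ (Z ⟶[SSet.{w}] X) :=
    { app m := ↾fun p ↦ s.x PUnit.unit p.1.down p.2
      naturality m m' θ' := by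
        ext ⟨⟨θ⟩, k⟩
        exact (s.map_x PUnit.unit θ θ' k).symm }
  obtain ⟨f, hf⟩ := (T.bijective Z (repr n)).2 g
  have hf' (m : SimplexCategoryᵒᵖ) (θ : n ⟶ m) (k : K.obj m) :
      sComp (f.app m (reprMk θ)) (T.counit.app m k) = s.x PUnit.unit θ k :=
    ConcreteCategory.congr_hom (NatTrans.congr_app hf m) (pair (reprMk θ) k :)
  have e (m : SimplexCategoryᵒᵖ) (θ : n ⟶ m) :
      (Z ⟶[SSet.{w}] T.obj).map θ (f.app n (reprMk (𝟙 n))) = f.app m (reprMk θ) :=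
    (app_reprMk f θ).symm
  refine ⟨f.app n (reprMk (𝟙 n)), fun _ m θ k ↦ ?_, fun f' hf' ↦ ?_⟩
  · rw [e]
    exact hf' m θ k
  · have : f = ofSimplex f' := (T.bijective Z (repr n)).1 (by
      refine hf.trans ?_
      apply NatTrans.ext
      ext m ⟨⟨θ⟩, k⟩
      exact (hf' PUnit.unit m θ k).symm)
    rw [this, ofSimplex_id]

/-- The tensor given by a weighted colimit. -/
def SimplicialTensor.ofIsUniversal {K : SSet.{w}} {X P : C} (unit : K ⟶ (X ⟶[SSet.{w}] P))
    (h : (discreteCocone (X := fun _ : PUnit.{1} ↦ X) (fun _ ↦ unit)).IsUniversal) :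
    SimplicialTensor K X where
  obj := P
  unit := unit
  bijective Y L := by
    refine ⟨fun f g hfg ↦ ?_, fun g ↦ ?_⟩
    · have hfg' (m : SimplexCategoryᵒᵖ) (k : K.obj m) (l : L.obj m) :
          sComp (unit.app m k) (f.app m l) = sComp (unit.app m k) (g.app m l) :=
        ConcreteCategory.congr_hom (NatTrans.congr_app hfg m) (pair k l :)
      apply NatTrans.ext
      ext n l
      refine h.hom_ext (fun _ m θ k ↦ ?_)
      exact (congrArg (sComp _) (NatTrans.naturality_apply f θ l).symm).trans
        ((hfg' m k (L.map θ l)).trans (congrArg (sComp _) (NatTrans.naturality_apply g θ l)))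
    -- Each simplex `l` of `L` curries `g` to a simplex of cocones; the induced simplices depend
    -- naturally on `l` by uniqueness and define the required map.
    · let s (n : SimplexCategoryᵒᵖ) (l : L.obj n) :
          (WeightedDiagram.discrete (fun _ : PUnit.{1} ↦ K) (fun _ ↦ X)).CoconeSimplex
            (discreteRestriction _) Y n :=
        { x _ m θ k := g.app m (pair k (L.map θ l) :)
          map_x _ m m' θ θ' k := by
            rw [map_comp_apply L θ θ' l]
            exact (NatTrans.naturality_apply g θ' (pair k (L.map θ l) :)).symm
          arr_x e := PEmpty.elim e }
      let f : L ⟶ (P ⟶[SSet.{w}] Y) :=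
        { app n := ↾fun l ↦ h.desc (s n l)
          naturality n m θ := by
            ext l
            refine h.hom_ext (fun a m' θ' k ↦ ?_)
            refine (h.fac (s m (L.map θ l)) a θ' k).trans (Eq.trans ?_
              (congrArg (sComp _) (map_comp_apply _ θ θ' (h.desc (s n l)))))
            refine Eq.trans ?_ (h.fac (s n l) a (θ ≫ θ') k).symm
            change g.app _ _ = g.app _ _
            rw [map_comp_apply] }
      refine ⟨f, ?_⟩
      apply NatTrans.ext
      ext n ⟨k, l⟩
      have := h.fac (s n l) PUnit.unit (𝟙 n) k
      rw [map_id_apply] at this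
      refine this.trans ?_
      change g.app _ _ = g.app _ _
      rw [map_id_apply]
      rfl

/-- The cotensor given by a weighted limit. -/
def SimplicialCotensor.ofIsUniversal {K : SSet.{w}} {X P : C} (counit : K ⟶ (P ⟶[SSet.{w}] X))
    (h : (discreteCone (X := fun _ : PUnit.{1} ↦ X) (fun _ ↦ counit)).IsUniversal) :
    SimplicialCotensor K X where
  obj := P
  counit := counit
  bijective Y L := by
    refine ⟨fun f g hfg ↦ ?_, fun g ↦ ?_⟩
    · have hfg' (m : SimplexCategoryᵒᵖ) (k : K.obj m) (l : L.obj m) :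
          sComp (f.app m l) (counit.app m k) = sComp (g.app m l) (counit.app m k) :=
        ConcreteCategory.congr_hom (NatTrans.congr_app hfg m) (pair l k :)
      apply NatTrans.ext
      ext n l
      refine h.hom_ext (fun _ m θ k ↦ ?_)
      exact (congrArg (sComp · _) (NatTrans.naturality_apply f θ l).symm).trans
        ((hfg' m k (L.map θ l)).trans (congrArg (sComp · _) (NatTrans.naturality_apply g θ l)))
    · let s (n : SimplexCategoryᵒᵖ) (l : L.obj n) :
          (WeightedDiagram.discrete (fun _ : PUnit.{1} ↦ K) (fun _ ↦ X)).ConeSimplex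
            (discreteTransition _) Y n :=
        { x _ m θ k := g.app m (pair (L.map θ l) k :)
          map_x _ m m' θ θ' k := by
            rw [map_comp_apply L θ θ' l]
            exact (NatTrans.naturality_apply g θ' (pair (L.map θ l) k :)).symm
          x_arr e := PEmpty.elim e }
      let f : L ⟶ (Y ⟶[SSet.{w}] P) :=
        { app n := ↾fun l ↦ h.lift (s n l)
          naturality n m θ := by
            ext l
            refine h.hom_ext (fun a m' θ' k ↦ ?_)
            refine (h.fac (s m (L.map θ l)) a θ' k).trans (Eq.trans ?_
              (congrArg (sComp · _) (map_comp_apply _ θ θ' (h.lift (s n l)))))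
            refine Eq.trans ?_ (h.fac (s n l) a (θ ≫ θ') k).symm
            change g.app _ _ = g.app _ _
            rw [map_comp_apply] }
      refine ⟨f, ?_⟩
      apply NatTrans.ext
      ext n ⟨l, k⟩
      have := h.fac (s n l) PUnit.unit (𝟙 n) k
      rw [map_id_apply] at this
      refine this.trans ?_
      change g.app _ _ = g.app _ _
      rw [map_id_apply]
      rfl

/-- Colimits in a cotensored simplicial category are conical colimits. -/
lemma isUniversal_ofCocone (hC : ∀ (K : SSet.{w}) (X : C), Nonempty (SimplicialCotensor K X))
    {K : Type v} [Category.{v'} K] {F : K ⥤ C} {c : Limits.Cocone F} (hc : IsColimit c) :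
    (ofCocone c).IsUniversal := by
  intro Z n s
  -- An `n`-simplex of `Map(X, Z)` is a morphism from `X` to the cotensor of `Z` by `repr n`, via
  -- evaluation at the universal simplex. `key` and `key'` are the surjectivity and injectivity of
  -- this correspondence; they reduce the simplicial universal property to the ordinary one with
  -- target the cotensor.
  obtain ⟨T⟩ := hC (repr n) Z
  have key (X : C) (x : (X ⟶[SSet.{w}] Z).obj n) :
      ∃ f : X ⟶ T.obj, sComp (sHomOf f n) (T.counit.app n (reprMk (𝟙 n))) = x := by
    obtain ⟨f, hf⟩ := T.isUniversal.exists_hom (discreteCone fun _ ↦ ofSimplex x)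
    exact ⟨f, (hf PUnit.unit n (reprMk (𝟙 n))).trans (ofSimplex_id x)⟩
  have key' (X : C) {f g : X ⟶ T.obj} (h : sComp (sHomOf f n) (T.counit.app n (reprMk (𝟙 n))) =
      sComp (sHomOf g n) (T.counit.app n (reprMk (𝟙 n)))) : f = g := by
    refine T.isUniversal.ordinary_hom_ext (fun _ m k ↦ ?_)
    obtain ⟨θ⟩ := k
    have h' := congrArg ((X ⟶[SSet.{w}] Z).map θ) h
    have e : T.counit.app m (reprMk θ) =
        (T.obj ⟶[SSet.{w}] Z).map θ (T.counit.app n (reprMk (𝟙 n))) :=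
      app_reprMk T.counit θ
    rw [map_sComp, map_sComp, map_sHomOf, map_sHomOf, ← e] at h'
    exact h'
  choose φ hφ using fun k ↦ key _ (s.x k (𝟙 n) PUnit.unit)
  let c' : Limits.Cocone F :=
    { pt := T.obj
      ι :=
        { app := φ
          naturality k k' e := by
            apply key'
            dsimp
            rw [sHomOf_comp, sComp_assoc, hφ, Category.comp_id, hφ]
            exact s.arr_x e (𝟙 n) PUnit.unit } }
  -- Because the weights are trivial, the condition in degree `n` for `θ = 𝟙 n` implies the one for
  -- every `θ`.
  have fac (k : K) (f : (c.pt ⟶[SSet.{w}] Z).obj n)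
      (hf : sComp (sHomOf (c.ι.app k) n) f = s.x k (𝟙 n) PUnit.unit)
      (m : SimplexCategoryᵒᵖ) (θ : n ⟶ m) : sComp (sHomOf (c.ι.app k) m)
        ((c.pt ⟶[SSet.{w}] Z).map θ f) = s.x k θ PUnit.unit := by
    have h := map_sComp θ (sHomOf (c.ι.app k) n) f
    rw [hf, map_sHomOf] at h
    refine h.symm.trans ((s.map_x k (𝟙 n) θ PUnit.unit).trans ?_)
    rw [Category.id_comp]
    rfl
  refine ⟨sComp (sHomOf (hc.desc c') n) (T.counit.app n (reprMk (𝟙 n))),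
    fun k m θ _ ↦ ?_, fun f hf ↦ ?_⟩
  · refine fac k _ ?_ m θ
    rw [← sComp_assoc, ← sHomOf_comp, hc.fac, ← hφ]
  · obtain ⟨f, rfl⟩ := key _ f
    congr 2
    refine hc.hom_ext (fun k ↦ key' _ ?_)
    rw [hc.fac, hφ, sHomOf_comp, sComp_assoc]
    have := hf k n (𝟙 n) PUnit.unit
    rwa [map_id_apply] at this

/-- Limits in a tensored simplicial category are conical limits. -/
lemma isUniversal_ofCone (hC : ∀ (K : SSet.{w}) (X : C), Nonempty (SimplicialTensor K X))
    {K : Type v} [Category.{v'} K] {F : K ⥤ C} {c : Limits.Cone F} (hc : IsLimit c) :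
    (ofCone c).IsUniversal := by
  intro Z n s
  -- Dually, an `n`-simplex of `Map(Z, X)` is a morphism to `X` from the tensor of `Z` by `repr n`.
  obtain ⟨T⟩ := hC (repr n) Z
  have key (X : C) (x : (Z ⟶[SSet.{w}] X).obj n) :
      ∃ f : T.obj ⟶ X, sComp (T.unit.app n (reprMk (𝟙 n))) (sHomOf f n) = x := by
    obtain ⟨f, hf⟩ := T.isUniversal.exists_hom (discreteCocone fun _ ↦ ofSimplex x)
    exact ⟨f, (hf PUnit.unit n (reprMk (𝟙 n))).trans (ofSimplex_id x)⟩
  have key' (X : C) {f g : T.obj ⟶ X} (h : sComp (T.unit.app n (reprMk (𝟙 n))) (sHomOf f n) =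
      sComp (T.unit.app n (reprMk (𝟙 n))) (sHomOf g n)) : f = g := by
    refine T.isUniversal.ordinary_hom_ext (fun _ m k ↦ ?_)
    obtain ⟨θ⟩ := k
    have h' := congrArg ((Z ⟶[SSet.{w}] X).map θ) h
    have e : T.unit.app m (reprMk θ) =
        (Z ⟶[SSet.{w}] T.obj).map θ (T.unit.app n (reprMk (𝟙 n))) :=
      app_reprMk T.unit θ
    rw [map_sComp, map_sComp, map_sHomOf, map_sHomOf, ← e] at h'
    exact h'
  choose φ hφ using fun k ↦ key _ (s.x k (𝟙 n) PUnit.unit)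
  let c' : Limits.Cone F :=
    { pt := T.obj
      π :=
        { app := φ
          naturality k k' e := by
            apply key'
            dsimp
            rw [Category.id_comp, sHomOf_comp, ← sComp_assoc, hφ, hφ]
            exact (s.x_arr e (𝟙 n) PUnit.unit).symm } }
  have fac (k : K) (f : (Z ⟶[SSet.{w}] c.pt).obj n)
      (hf : sComp f (sHomOf (c.π.app k) n) = s.x k (𝟙 n) PUnit.unit)
      (m : SimplexCategoryᵒᵖ) (θ : n ⟶ m) : sComp ((Z ⟶[SSet.{w}] c.pt).map θ f)
        (sHomOf (c.π.app k) m) = s.x k θ PUnit.unit := by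
    have h := map_sComp θ f (sHomOf (c.π.app k) n)
    rw [hf, map_sHomOf] at h
    refine h.symm.trans ((s.map_x k (𝟙 n) θ PUnit.unit).trans ?_)
    rw [Category.id_comp]
    rfl
  refine ⟨sComp (T.unit.app n (reprMk (𝟙 n))) (sHomOf (hc.lift c') n),
    fun k m θ _ ↦ ?_, fun f hf ↦ ?_⟩
  · refine fac k _ ?_ m θ
    rw [sComp_assoc, ← sHomOf_comp, hc.fac, ← hφ]
  · obtain ⟨f, rfl⟩ := key _ f
    congr 2
    refine hc.hom_ext (fun k ↦ key' _ ?_)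
    rw [hc.fac, hφ, sHomOf_comp, ← sComp_assoc]
    have := hf k n (𝟙 n) PUnit.unit
    rwa [map_id_apply] at this

/-- A conical colimit is a colimit. -/
lemma nonempty_isColimit_of_isUniversal {K : Type v} [Category.{v'} K] {F : K ⥤ C}
    {c : Limits.Cocone F} (hc : (ofCocone c).IsUniversal) : Nonempty (IsColimit c) := by
  choose f hf using fun c' : Limits.Cocone F ↦ hc.exists_hom (ofCocone c')
  exact ⟨{
    desc c' := f c'
    fac c' k := sHomOf_ext (fun n ↦ (sHomOf_comp _ _ n).trans (hf c' k n PUnit.unit))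
    uniq c' g hg := hc.ordinary_hom_ext (fun k n _ ↦
      Eq.trans ((sHomOf_comp _ _ n).symm.trans (congrArg (sHomOf · n) (hg k)))
        (hf c' k n PUnit.unit).symm) }⟩

/-- A conical limit is a limit. -/
lemma nonempty_isLimit_of_isUniversal {K : Type v} [Category.{v'} K] {F : K ⥤ C}
    {c : Limits.Cone F} (hc : (ofCone c).IsUniversal) : Nonempty (IsLimit c) := by
  choose f hf using fun c' : Limits.Cone F ↦ hc.exists_hom (ofCone c')
  exact ⟨{
    lift c' := f c'
    fac c' k := sHomOf_ext (fun n ↦ (sHomOf_comp _ _ n).trans (hf c' k n PUnit.unit))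
    uniq c' g hg := hc.ordinary_hom_ext (fun k n _ ↦
      Eq.trans ((sHomOf_comp _ _ n).symm.trans (congrArg (sHomOf · n) (hg k)))
        (hf c' k n PUnit.unit).symm) }⟩

/-- A coproduct of tensors is a weighted colimit. -/
lemma isUniversal_coproduct_tensor
    (hC : ∀ (K : SSet.{w}) (X : C), Nonempty (SimplicialCotensor K X))
    {ι : Type v} {W : ι → SSet.{w}} {X : ι → C} (T : ∀ a, SimplicialTensor (W a) (X a))
    {c : Cofan (fun a ↦ (T a).obj)} (hc : IsColimit c) :
    (discreteCocone (fun a ↦ (T a).unit ≫ eHomWhiskerLeft SSet.{w} (X a)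
      (c.inj a))).IsUniversal := by
  have hc' := isUniversal_ofCocone hC hc
  intro Z n s
  let t (a : ι) : (WeightedDiagram.discrete (fun _ : PUnit.{1} ↦ W a)
      (fun _ ↦ X a)).CoconeSimplex (discreteRestriction _) Z n :=
    { x _ m θ k := s.x a θ k
      map_x _ m m' θ θ' k := s.map_x a θ θ' k
      arr_x e := PEmpty.elim e }
  -- The universal property is applied in two stages: each tensor turns the data of index `a` into
  -- one simplex `y a`, and the coproduct then assembles the `y a`.
  let y (a : ι) := (T a).isUniversal.desc (t a)
  let r : (ofFunctor (Discrete.functor (fun a ↦ (T a).obj))).CoconeSimplex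
      (conicalRestriction _) Z n :=
    { x a m θ _ := ((T a.as).obj ⟶[SSet.{w}] Z).map θ (y a.as)
      map_x a m m' θ θ' _ := (map_comp_apply _ θ θ' (y a.as)).symm
      arr_x {a b} e m θ _ := by
        obtain rfl := Discrete.ext (Discrete.eq_of_hom e)
        obtain rfl : e = 𝟙 a := Subsingleton.elim _ _
        dsimp
        rw [CategoryTheory.Functor.map_id]
        exact (congrArg (sComp · _) (sHomOf_id _ m)).trans (sId_sComp _) }
  have key (f : (c.pt ⟶[SSet.{w}] Z).obj n) (a : ι) (m : SimplexCategoryᵒᵖ) (θ : n ⟶ m)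
      (k : (W a).obj m) :
      sComp (((T a).unit ≫ eHomWhiskerLeft SSet.{w} (X a) (c.inj a)).app m k)
        ((c.pt ⟶[SSet.{w}] Z).map θ f) = sComp ((T a).unit.app m k)
          (sComp (sHomOf (c.inj a) m) ((c.pt ⟶[SSet.{w}] Z).map θ f)) :=
    sComp_assoc _ _ _
  refine ⟨hc'.desc r, fun a m θ k ↦ ?_, fun f hf ↦ ?_⟩
  · rw [key]
    exact (congrArg (sComp _) (hc'.fac r ⟨a⟩ θ PUnit.unit)).trans
      ((T a).isUniversal.fac (t a) PUnit.unit θ k)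
  · refine hc'.hom_ext (fun a m θ _ ↦ ?_)
    obtain ⟨a⟩ := a
    refine Eq.trans ?_ (hc'.fac r ⟨a⟩ θ PUnit.unit).symm
    -- Equality on a summand is tested on the tensor; the extra restriction `θ'` is absorbed by
    -- using the hypotheses at `θ ≫ θ'`.
    refine (T a).isUniversal.hom_ext (fun _ m' θ' k ↦ ?_)
    have h1 := (key f a m' (θ ≫ θ') k).symm.trans (hf a m' (θ ≫ θ') k)
    have h2 := (T a).isUniversal.fac (t a) PUnit.unit (θ ≫ θ') k
    refine Eq.trans ?_ (h1.trans (h2.symm.trans ?_))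
    · congr 1
      refine (map_sComp _ _ _).trans ?_
      rw [map_comp_apply]
      congr 1
      exact map_sHomOf (c.inj a) θ'
    · dsimp
      rw [map_comp_apply]

end SimplicialSections

/-! ### Sections described by their actions over fixed morphisms of the base. -/

namespace SimplicialSections

open WeightedShape WeightedDiagram

variable {I : Type u₁} [Category.{w} I] {J : Type w} [EnrichedCategory SSet.{w} J]
  {φ : EnrichedFunctor SSet.{w} J (Disc I)} {M : SimplicialQuillenPresheaf.{w, u} I}

lemma Total.mk'_injective {A B : Total M} {n : SimplexCategoryᵒᵖ} (α : A.base ⟶ B.base) :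
    Function.Injective (Total.mk' (A := A) (B := B) (n := n) α) := by
  intro f g h
  exact eq_of_heq (Sigma.mk.inj h).2

/-- The morphism of `I` over which a simplex of a mapping space of `J` lies. -/
def baseHom (φ : EnrichedFunctor SSet.{w} J (Disc I)) {j j' : J} {n : SimplexCategoryᵒᵖ}
    (γ : (j ⟶[SSet.{w}] j').obj n) : (φ.obj j).as ⟶ (φ.obj j').as :=
  (φ.map j j').app n γ

lemma baseHom_map {j j' : J} {n m : SimplexCategoryᵒᵖ} (θ : n ⟶ m)
    (γ : (j ⟶[SSet.{w}] j').obj n) : baseHom φ ((j ⟶[SSet.{w}] j').map θ γ) = baseHom φ γ :=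
  NatTrans.naturality_apply (φ.map j j') θ γ

lemma baseHom_sId (j : J) (n : SimplexCategoryᵒᵖ) : baseHom φ (sId j n) = 𝟙 (φ.obj j).as :=
  sMap_sId φ j n

lemma baseHom_sComp {j j' j'' : J} {n : SimplexCategoryᵒᵖ} (γ : (j ⟶[SSet.{w}] j').obj n)
    (δ : (j' ⟶[SSet.{w}] j'').obj n) : baseHom φ (sComp γ δ) = baseHom φ γ ≫ baseHom φ δ :=
  sMap_sComp φ γ δ

namespace SimplicialSection

lemma act_fst (s : SimplicialSection φ M) {j j' : J} {n : SimplexCategoryᵒᵖ}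
    (γ : (j ⟶[SSet.{w}] j').obj n) : (s.act γ).1 = baseHom φ γ :=
  (ConcreteCategory.congr_hom (NatTrans.congr_app (s.map_proj _ _) n) γ :)

/-- The action `α_! s(j) ⟶ s(j')` of a simplex of `Map(j, j')` lying over `α`. -/
def actOver (s : SimplicialSection φ M) {j j' : J} {n : SimplexCategoryᵒᵖ}
    (γ : (j ⟶[SSet.{w}] j').obj n) (α : (φ.obj j).as ⟶ (φ.obj j').as) (h : baseHom φ γ = α) :
    (M.push α (s.obj j) ⟶[SSet.{w}] s.obj j').obj n :=
  ((s.act_fst γ).trans h) ▸ (s.act γ).2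

/-- This characterizes `actOver` without the transport in its definition. Together with
`Total.mk'_injective` it moves identities between actions into the total category, where they are
the functoriality of `s`. -/
lemma mk'_actOver (s : SimplicialSection φ M) {j j' : J} {n : SimplexCategoryᵒᵖ}
    (γ : (j ⟶[SSet.{w}] j').obj n) (α : (φ.obj j).as ⟶ (φ.obj j').as) (h : baseHom φ γ = α) :
    Total.mk' (A := ⟨(φ.obj j).as, s.obj j⟩) (B := ⟨(φ.obj j').as, s.obj j'⟩) α
      (s.actOver γ α h) = s.act γ := by
  obtain rfl := (s.act_fst γ).trans h
  rfl

lemma map_actOver (s : SimplicialSection φ M) {j j' : J} {n m : SimplexCategoryᵒᵖ}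
    (θ : n ⟶ m) (γ : (j ⟶[SSet.{w}] j').obj n) (α : (φ.obj j).as ⟶ (φ.obj j').as)
    (h : baseHom φ γ = α) :
    (M.push α (s.obj j) ⟶[SSet.{w}] s.obj j').map θ (s.actOver γ α h) =
      s.actOver ((j ⟶[SSet.{w}] j').map θ γ) α ((baseHom_map θ γ).trans h) := by
  apply Total.mk'_injective (A := ⟨(φ.obj j).as, s.obj j⟩) (B := ⟨(φ.obj j').as, s.obj j'⟩)
  rw [← Total.map_mk', mk'_actOver, mk'_actOver]
  exact (NatTrans.naturality_apply (s.map j j') θ γ).symm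

lemma actOver_sId (s : SimplicialSection φ M) (j : J) (n : SimplexCategoryᵒᵖ) :
    s.actOver (sId j n) (𝟙 _) (baseHom_sId j n) = sHomOf (M.idHom _ (s.obj j)) n := by
  apply Total.mk'_injective (A := ⟨(φ.obj j).as, s.obj j⟩) (B := ⟨(φ.obj j).as, s.obj j⟩)
  rw [mk'_actOver]
  exact ConcreteCategory.congr_hom (NatTrans.congr_app (s.map_id j) n) PUnit.unit

/-- Keeping `αβ` as a free variable with a proof of `α ≫ β = αβ` permits any expression for the
composite in the base, so no transport appears later. -/
lemma actOver_sComp (s : SimplicialSection φ M) {j j' j'' : J} {n : SimplexCategoryᵒᵖ}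
    (γ : (j ⟶[SSet.{w}] j').obj n) (δ : (j' ⟶[SSet.{w}] j'').obj n)
    (α : (φ.obj j).as ⟶ (φ.obj j').as) (β : (φ.obj j').as ⟶ (φ.obj j'').as)
    (αβ : (φ.obj j).as ⟶ (φ.obj j'').as) (hα : baseHom φ γ = α) (hβ : baseHom φ δ = β)
    (hαβ : α ≫ β = αβ) (h : baseHom φ (sComp γ δ) = αβ) :
    s.actOver (sComp γ δ) αβ h =
      sComp (sHomOf (M.compHom α β αβ hαβ (s.obj j)) n)
        (sComp (M.pushMap β (s.actOver γ α hα)) (s.actOver δ β hβ)) := by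
  apply Total.mk'_injective (A := ⟨(φ.obj j).as, s.obj j⟩) (B := ⟨(φ.obj j'').as, s.obj j''⟩)
  rw [mk'_actOver]
  refine Eq.trans ?_ (Total.comp_mk' (A := ⟨(φ.obj j).as, s.obj j⟩)
    (B := ⟨(φ.obj j').as, s.obj j'⟩) (C := ⟨(φ.obj j'').as, s.obj j''⟩) α β αβ hαβ
    (s.actOver γ α hα) (s.actOver δ β hβ))
  rw [mk'_actOver, mk'_actOver]
  exact ConcreteCategory.congr_hom (NatTrans.congr_app (s.map_comp j j' j'') n) (pair γ δ :)

/-- The square expressing the naturality of a family of simplices. -/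
lemma post_eq_pre_iff {s t : SimplicialSection φ M} {j j' : J} {n : SimplexCategoryᵒᵖ}
    (γ : (j ⟶[SSet.{w}] j').obj n) (α : (φ.obj j).as ⟶ (φ.obj j').as) (h : baseHom φ γ = α)
    (f : (s.obj j' ⟶[SSet.{w}] t.obj j').obj n) (g : (s.obj j ⟶[SSet.{w}] t.obj j).obj n) :
    Total.post (s.act γ) f = Total.pre g (t.act γ) ↔
      sComp (s.actOver γ α h) f = sComp (M.pushMap α g) (t.actOver γ α h) := by
  rw [← s.mk'_actOver γ α h, ← t.mk'_actOver γ α h]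
  exact (Total.mk'_injective (A := ⟨(φ.obj j).as, s.obj j⟩)
    (B := ⟨(φ.obj j').as, t.obj j'⟩) α).eq_iff

lemma IsNatural.actOver {s t : SimplicialSection φ M} {n : SimplexCategoryᵒᵖ}
    {T : ∀ j, (s.obj j ⟶[SSet.{w}] t.obj j).obj n} (hT : IsNatural T)
    {m : SimplexCategoryᵒᵖ} (θ : n ⟶ m) {j j' : J} (γ : (j ⟶[SSet.{w}] j').obj m)
    (α : (φ.obj j).as ⟶ (φ.obj j').as) (h : baseHom φ γ = α) :
    sComp (s.actOver γ α h) ((s.obj j' ⟶[SSet.{w}] t.obj j').map θ (T j')) =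
      sComp (M.pushMap α ((s.obj j ⟶[SSet.{w}] t.obj j).map θ (T j))) (t.actOver γ α h) :=
  (post_eq_pre_iff γ α h _ _).1 (hT θ γ)

lemma IsNatural.actOver_id {s t : SimplicialSection φ M} {n : SimplexCategoryᵒᵖ}
    {T : ∀ j, (s.obj j ⟶[SSet.{w}] t.obj j).obj n} (hT : IsNatural T)
    {j j' : J} (γ : (j ⟶[SSet.{w}] j').obj n)
    (α : (φ.obj j).as ⟶ (φ.obj j').as) (h : baseHom φ γ = α) :
    sComp (s.actOver γ α h) (T j') = sComp (M.pushMap α (T j)) (t.actOver γ α h) := by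
  have := hT.actOver (𝟙 n) γ α h
  rwa [map_id_apply, map_id_apply] at this

lemma isNatural_of_actOver {s t : SimplicialSection φ M} {n : SimplexCategoryᵒᵖ}
    {T : ∀ j, (s.obj j ⟶[SSet.{w}] t.obj j).obj n}
    (hT : ∀ ⦃m : SimplexCategoryᵒᵖ⦄ (θ : n ⟶ m) ⦃j j' : J⦄ (γ : (j ⟶[SSet.{w}] j').obj m)
      (α : (φ.obj j).as ⟶ (φ.obj j').as) (h : baseHom φ γ = α),
      sComp (s.actOver γ α h) ((s.obj j' ⟶[SSet.{w}] t.obj j').map θ (T j')) =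
        sComp (M.pushMap α ((s.obj j ⟶[SSet.{w}] t.obj j).map θ (T j))) (t.actOver γ α h)) :
    IsNatural T :=
  fun _ θ _ _ γ ↦ (post_eq_pre_iff γ _ rfl _ _).2 (hT θ γ _ rfl)

lemma Hom.actOver {s t : SimplicialSection φ M} (f : s ⟶ t) {n : SimplexCategoryᵒᵖ} {j j' : J}
    (γ : (j ⟶[SSet.{w}] j').obj n) (α : (φ.obj j).as ⟶ (φ.obj j').as) (h : baseHom φ γ = α) :
    sComp (s.actOver γ α h) (sHomOf (Hom.app f j') n) =
      sComp (M.pushMap α (sHomOf (Hom.app f j) n)) (t.actOver γ α h) :=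
  (post_eq_pre_iff γ α h _ _).1 (Hom.naturality f γ)

section Constructor

variable (obj : ∀ j : J, M.obj (φ.obj j).as)
  (a : ∀ ⦃j j' : J⦄ ⦃n : SimplexCategoryᵒᵖ⦄ (γ : (j ⟶[SSet.{w}] j').obj n)
    (α : (φ.obj j).as ⟶ (φ.obj j').as), baseHom φ γ = α →
      (M.push α (obj j) ⟶[SSet.{w}] obj j').obj n)

/-- The canonical choice `baseHom φ γ` can be traded for any equal morphism `α`; this absorbs the
equalities in the base when the axioms of a section are verified. -/
lemma mk'_action_eq {j j' : J} {n : SimplexCategoryᵒᵖ} (γ : (j ⟶[SSet.{w}] j').obj n)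
    (α : (φ.obj j).as ⟶ (φ.obj j').as) (h : baseHom φ γ = α) :
    Total.mk' (A := ⟨(φ.obj j).as, obj j⟩) (B := ⟨(φ.obj j').as, obj j'⟩) (baseHom φ γ)
      (a γ _ rfl) = Total.mk' α (a γ α h) := by
  subst h
  rfl

variable
  (ha : ∀ ⦃j j' : J⦄ ⦃n m : SimplexCategoryᵒᵖ⦄ (θ : n ⟶ m) (γ : (j ⟶[SSet.{w}] j').obj n)
    (α : (φ.obj j).as ⟶ (φ.obj j').as) (h : baseHom φ γ = α),
      (M.push α (obj j) ⟶[SSet.{w}] obj j').map θ (a γ α h) =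
        a ((j ⟶[SSet.{w}] j').map θ γ) α ((baseHom_map θ γ).trans h))
  (ha_id : ∀ (j : J) (n : SimplexCategoryᵒᵖ),
    a (sId j n) (𝟙 _) (baseHom_sId j n) = sHomOf (M.idHom _ (obj j)) n)
  (ha_comp : ∀ ⦃j j' j'' : J⦄ ⦃n : SimplexCategoryᵒᵖ⦄ (γ : (j ⟶[SSet.{w}] j').obj n)
    (δ : (j' ⟶[SSet.{w}] j'').obj n) (α : (φ.obj j).as ⟶ (φ.obj j').as)
    (β : (φ.obj j').as ⟶ (φ.obj j'').as) (hα : baseHom φ γ = α) (hβ : baseHom φ δ = β)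
    (h : baseHom φ (sComp γ δ) = α ≫ β), a (sComp γ δ) (α ≫ β) h =
      sComp (sHomOf (M.compHom α β (α ≫ β) rfl (obj j)) n)
        (sComp (M.pushMap β (a γ α hα)) (a δ β hβ)))

/-- Constructor for simplicial sections from the actions over the morphisms of `I`. -/
def ofAction : SimplicialSection φ M where
  obj := obj
  map j j' :=
    { app n := ↾fun γ ↦ Total.mk' (A := ⟨(φ.obj j).as, obj j⟩) (B := ⟨(φ.obj j').as, obj j'⟩)
        (baseHom φ γ) (a γ _ rfl)
      naturality n m θ := by
        ext γ
        refine (mk'_action_eq obj a _ _ (baseHom_map θ γ)).trans ?_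
        rw [← ha θ γ _ rfl]
        rfl }
  map_id j := by
    apply NatTrans.ext
    ext n ⟨⟩
    refine (mk'_action_eq obj a _ _ (baseHom_sId j n)).trans ?_
    rw [ha_id]
    rfl
  map_comp j j' j'' := by
    apply NatTrans.ext
    ext n ⟨γ, δ⟩
    refine (mk'_action_eq obj a _ _ (baseHom_sComp γ δ)).trans ?_
    rw [ha_comp γ δ _ _ rfl rfl]
    rfl
  map_proj j j' := rfl

lemma ofAction_actOver {j j' : J} {n : SimplexCategoryᵒᵖ} (γ : (j ⟶[SSet.{w}] j').obj n)
    (α : (φ.obj j).as ⟶ (φ.obj j').as) (h : baseHom φ γ = α) :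
    (ofAction obj a ha ha_id ha_comp).actOver γ α h = a γ α h := by
  subst h
  rfl

end Constructor

end SimplicialSection

end SimplicialSections

/-! ### Levelwise weighted colimits and limits of sections. -/

namespace SimplicialSections

open WeightedShape WeightedDiagram

variable {I : Type u₁} [Category.{w} I] {J : Type w} [EnrichedCategory SSet.{w} J]
  {φ : EnrichedFunctor SSet.{w} J (Disc I)} {M : SimplicialQuillenPresheaf.{w, u} I}

namespace SimplicialSection

/-- This replaces `γ` by an equal simplex although the proof argument of `actOver` depends on it. -/
lemma actOver_congr (s : SimplicialSection φ M) {j j' : J} {n : SimplexCategoryᵒᵖ}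
    {γ γ' : (j ⟶[SSet.{w}] j').obj n} (e : γ = γ') (α : (φ.obj j).as ⟶ (φ.obj j').as)
    (h : baseHom φ γ = α) : s.actOver γ α h = s.actOver γ' α (e ▸ h) := by
  subst e
  rfl

variable (φ M) in
/-- The evaluation at `j`, as a simplicial functor. -/
abbrev simplicialEv (j : J) :
    EnrichedFunctor SSet.{w} (SimplicialSection φ M) (M.obj (φ.obj j).as) where
  obj s := s.obj j
  map s t := Map.ev s t j
  map_id _ := rfl
  map_comp _ _ _ := rfl

lemma sMap_simplicialEv {s t : SimplicialSection φ M} (j : J) {n : SimplexCategoryᵒᵖ}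
    (T : (s ⟶[SSet.{w}] t).obj n) : sMap (simplicialEv φ M j) T = T.1 j := rfl

variable {S : WeightedShape.{w, v, v'}} {ρ : S.Restriction} {σ : S.Transition}
  {A : WeightedDiagram S (SimplicialSection φ M)} {P : ∀ j : J, M.obj (φ.obj j).as}

section Colimit

variable {c : ∀ j, (A.map (simplicialEv φ M j)).Cocone ρ (P j)} (hc : ∀ j, (c j).IsUniversal)

/-- The weighted cocone simplex defining the action on a levelwise weighted colimit. -/
def colimitActionSimplex (c : ∀ j, (A.map (simplicialEv φ M j)).Cocone ρ (P j))
    {j j' : J} {n : SimplexCategoryᵒᵖ} (γ : (j ⟶[SSet.{w}] j').obj n)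
    (α : (φ.obj j).as ⟶ (φ.obj j').as) (h : baseHom φ γ = α) :
    ((A.map (simplicialEv φ M j)).map (M.map α).left).CoconeSimplex ρ (P j') n where
  x a m θ k := sComp ((A.obj a).actOver ((j ⟶[SSet.{w}] j').map θ γ) α
    ((baseHom_map θ γ).trans h)) (((c j').u a).app m k)
  map_x a m m' θ θ' k := by
    rw [map_sComp, map_actOver, (c j').map_u]
    congr 1
    exact actOver_congr _ (map_comp_apply _ θ θ' γ).symm _ _
  arr_x {a b} e m θ k := by
    rw [← (c j').arr_u, ← sComp_assoc, ← sComp_assoc]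
    congr 1
    -- The arrows of the diagram are simplices of mapping spaces of sections, hence commute with the
    -- actions.
    exact ((A.arr e m).2.actOver_id _ α _).symm

include hc in
-- The only place in the construction of colimits where `α_!` has to be a left adjoint: it makes
-- `α_! P(j)` a weighted colimit, out of which the action can be defined.
lemma isUniversal_push {j : J} {i : I} (α : (φ.obj j).as ⟶ i) :
    ((c j).map (M.map α).left).IsUniversal :=
  (hc j).map_of_adjunction (M.map α).adj

/-- The action on a levelwise weighted colimit. -/
noncomputable def colimitAction ⦃j j' : J⦄ ⦃n : SimplexCategoryᵒᵖ⦄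
    (γ : (j ⟶[SSet.{w}] j').obj n) (α : (φ.obj j).as ⟶ (φ.obj j').as)
    (h : baseHom φ γ = α) : (M.push α (P j) ⟶[SSet.{w}] P j').obj n :=
  (isUniversal_push hc α).desc (colimitActionSimplex c γ α h)

lemma colimitAction_fac {j j' : J} {n m : SimplexCategoryᵒᵖ}
    (γ : (j ⟶[SSet.{w}] j').obj n) (α : (φ.obj j).as ⟶ (φ.obj j').as)
    (h : baseHom φ γ = α) (a : S.ι) (θ : n ⟶ m) (k : (S.wt a).obj m) :
    sComp (M.pushMap α (((c j).u a).app m k))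
      ((M.push α (P j) ⟶[SSet.{w}] P j').map θ (colimitAction hc γ α h)) =
    sComp ((A.obj a).actOver ((j ⟶[SSet.{w}] j').map θ γ) α
      ((baseHom_map θ γ).trans h)) (((c j').u a).app m k) :=
  (isUniversal_push hc α).fac (colimitActionSimplex c γ α h) a θ k

lemma colimitAction_fac_id {j j' : J} {n : SimplexCategoryᵒᵖ}
    (γ : (j ⟶[SSet.{w}] j').obj n) (α : (φ.obj j).as ⟶ (φ.obj j').as)
    (h : baseHom φ γ = α) (a : S.ι) (k : (S.wt a).obj n) :
    sComp (M.pushMap α (((c j).u a).app n k)) (colimitAction hc γ α h) =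
    sComp ((A.obj a).actOver γ α h) (((c j').u a).app n k) := by
  have := colimitAction_fac hc γ α h a (𝟙 n) k
  rw [map_id_apply] at this
  rw [this]
  congr 1
  exact actOver_congr _ (map_id_apply _ γ) _ _

include hc in
lemma push_hom_ext {j : J} {i : I} (α : (φ.obj j).as ⟶ i) {Z : M.obj i} {n : SimplexCategoryᵒᵖ}
    {f g : (M.push α (P j) ⟶[SSet.{w}] Z).obj n}
    (h : ∀ (a : S.ι) (m : SimplexCategoryᵒᵖ) (θ : n ⟶ m) (k : (S.wt a).obj m),
      sComp (M.pushMap α (((c j).u a).app m k)) ((M.push α (P j) ⟶[SSet.{w}] Z).map θ f) =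
        sComp (M.pushMap α (((c j).u a).app m k)) ((M.push α (P j) ⟶[SSet.{w}] Z).map θ g)) :
    f = g :=
  (isUniversal_push hc α).hom_ext h

lemma map_colimitAction ⦃j j' : J⦄ ⦃n m : SimplexCategoryᵒᵖ⦄ (θ : n ⟶ m)
    (γ : (j ⟶[SSet.{w}] j').obj n) (α : (φ.obj j).as ⟶ (φ.obj j').as) (h : baseHom φ γ = α) :
    (M.push α (P j) ⟶[SSet.{w}] P j').map θ (colimitAction hc γ α h) =
      colimitAction hc ((j ⟶[SSet.{w}] j').map θ γ) α ((baseHom_map θ γ).trans h) :=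
  push_hom_ext hc α (fun a m' θ' k ↦ by
    rw [← map_comp_apply, colimitAction_fac, colimitAction_fac]
    congr 1
    exact actOver_congr _ (map_comp_apply _ _ _ γ) _ _)

/-- A levelwise weighted colimit of simplicial sections. -/
noncomputable def colimitSection : SimplicialSection φ M :=
  ofAction P (colimitAction hc) (map_colimitAction hc)
    -- Unitality and associativity are tested on the images under `α_!` of the structure maps of the
    -- cocone, where they become the same identities for the sections `A.obj a`, up to naturality of
    -- `idHom` and `compHom`.
    (fun j n ↦ push_hom_ext hc _ (fun a m θ k ↦ by
      rw [map_colimitAction, map_sHomOf, M.idHom_nat, colimitAction_fac_id]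
      congr 1
      exact (actOver_congr _ (map_sId j θ) _ _).trans (actOver_sId _ j m)))
    (fun j j' j'' n γ δ α β hα hβ h ↦ push_hom_ext hc _ (fun a m θ k ↦ by
      rw [colimitAction_fac, (A.obj a).actOver_congr (map_sComp θ γ δ),
        (A.obj a).actOver_sComp _ _ α β _ ((baseHom_map θ γ).trans hα)
          ((baseHom_map θ δ).trans hβ) rfl, map_sComp, map_sHomOf, map_sComp, M.map_pushMap,
        map_colimitAction, map_colimitAction, ← sComp_assoc (M.pushMap (α ≫ β) _),
        M.compHom_nat, sComp_assoc (sHomOf _ _) (M.pushMap β (M.pushMap _ _)),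
        ← sComp_assoc (M.pushMap β (M.pushMap α _)), ← M.pushMap_sComp, colimitAction_fac_id,
        M.pushMap_sComp, sComp_assoc (M.pushMap β _) (M.pushMap β _), colimitAction_fac_id]
      simp only [sComp_assoc]))

lemma colimitSection_actOver {j j' : J} {n : SimplexCategoryᵒᵖ} (γ : (j ⟶[SSet.{w}] j').obj n)
    (α : (φ.obj j).as ⟶ (φ.obj j').as) (h : baseHom φ γ = α) :
    (colimitSection hc).actOver γ α h = colimitAction hc γ α h :=
  ofAction_actOver _ _ _ _ _ _ _ _

/-- The cocone of a levelwise weighted colimit of simplicial sections. -/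
noncomputable def colimitSectionCocone : A.Cocone ρ (colimitSection hc) where
  u a :=
    { app n := ↾fun k ↦ ⟨fun j ↦ ((c j).u a).app n k, isNatural_of_actOver
        (fun m θ j j' γ α h ↦ by
          rw [colimitSection_actOver]
          refine Eq.trans ?_ (((congrArg (fun x ↦ sComp (M.pushMap α x) (colimitAction hc γ α h))
            ((c j).map_u a θ k)).trans (colimitAction_fac_id hc γ α h a _)).symm)
          exact congrArg (sComp _) ((c j').map_u a θ k))⟩
      naturality n m θ := by
        ext k
        exact Subtype.ext (funext fun j ↦ ((c j).map_u a θ k).symm) }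
  arr_u {a b} e n k := Subtype.ext (funext fun j ↦ (c j).arr_u e n k)

/-- The simplices induced at each level form a natural family: naturality may be tested after
precomposition with the `α_!`-image of the cocone, where it is the naturality of the given simplices
`s.x`. Uniqueness is levelwise. -/
lemma isUniversal_colimitSectionCocone : (colimitSectionCocone hc).IsUniversal := by
  intro Z n s
  let t (j : J) : (A.map (simplicialEv φ M j)).CoconeSimplex ρ (Z.obj j) n :=
    { x a m θ k := (s.x a θ k).1 j
      map_x a m m' θ θ' k := congrFun (congrArg Subtype.val (s.map_x a θ θ' k)) j
      arr_x e m θ k := congrFun (congrArg Subtype.val (s.arr_x e θ k)) j }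
  have ht (j : J) (a : S.ι) {m : SimplexCategoryᵒᵖ} (θ : n ⟶ m) (k : (S.wt a).obj m) :
    sComp (((c j).u a).app m k) ((P j ⟶[SSet.{w}] Z.obj j).map θ ((hc j).desc (t j))) =
      (s.x a θ k).1 j := (hc j).fac (t j) a θ k
  refine ⟨⟨fun j ↦ (hc j).desc (t j), isNatural_of_actOver (fun m θ j j' γ α h ↦ ?_)⟩,
    fun a m θ k ↦ Subtype.ext (funext fun j ↦ ht j a θ k), fun f hf ↦ ?_⟩
  · rw [colimitSection_actOver]
    change sComp _ ((P j' ⟶[SSet.{w}] Z.obj j').map θ ((hc j').desc (t j'))) =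
      sComp (M.pushMap α ((P j ⟶[SSet.{w}] Z.obj j).map θ ((hc j).desc (t j)))) _
    refine push_hom_ext hc α (fun a m' θ' k ↦ ?_)
    rw [map_sComp, map_sComp, M.map_pushMap, map_colimitAction, map_actOver, ← map_comp_apply,
      ← map_comp_apply, ← sComp_assoc, colimitAction_fac_id, sComp_assoc, ht, ← sComp_assoc,
      ← M.pushMap_sComp, ht]
    exact (s.x a (θ ≫ θ') k).2.actOver_id _ α _
  · refine Subtype.ext (funext fun j ↦ (hc j).hom_ext (fun a m θ k ↦ ?_))
    exact (congrFun (congrArg Subtype.val (hf a m θ k)) j).trans (ht j a θ k).symm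

end Colimit

section Limit

variable {c : ∀ j, (A.map (simplicialEv φ M j)).Cone σ (P j)} (hc : ∀ j, (c j).IsUniversal)

/-- The weighted cone simplex defining the action on a levelwise weighted limit. -/
def limitActionSimplex (c : ∀ j, (A.map (simplicialEv φ M j)).Cone σ (P j))
    {j j' : J} {n : SimplexCategoryᵒᵖ} (γ : (j ⟶[SSet.{w}] j').obj n)
    (α : (φ.obj j).as ⟶ (φ.obj j').as) (h : baseHom φ γ = α) :
    (A.map (simplicialEv φ M j')).ConeSimplex σ (M.push α (P j)) n where
  x a m θ k := sComp (M.pushMap α (((c j).u a).app m k))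
    ((A.obj a).actOver ((j ⟶[SSet.{w}] j').map θ γ) α ((baseHom_map θ γ).trans h))
  map_x a m m' θ θ' k := by
    rw [map_sComp, map_actOver, M.map_pushMap, (c j).map_u]
    congr 1
    exact actOver_congr _ (map_comp_apply _ θ θ' γ).symm _ _
  x_arr {a b} e m θ k := by
    rw [← (c j).u_arr, M.pushMap_sComp, sComp_assoc, sComp_assoc]
    congr 1
    exact (A.arr e m).2.actOver_id _ α _

/-- The action on a levelwise weighted limit. -/
noncomputable def limitAction ⦃j j' : J⦄ ⦃n : SimplexCategoryᵒᵖ⦄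
    (γ : (j ⟶[SSet.{w}] j').obj n) (α : (φ.obj j).as ⟶ (φ.obj j').as)
    (h : baseHom φ γ = α) : (M.push α (P j) ⟶[SSet.{w}] P j').obj n :=
  (hc j').lift (limitActionSimplex c γ α h)

lemma limitAction_fac {j j' : J} {n m : SimplexCategoryᵒᵖ}
    (γ : (j ⟶[SSet.{w}] j').obj n) (α : (φ.obj j).as ⟶ (φ.obj j').as)
    (h : baseHom φ γ = α) (a : S.ι) (θ : n ⟶ m) (k : (S.wt a).obj m) :
    sComp ((M.push α (P j) ⟶[SSet.{w}] P j').map θ (limitAction hc γ α h))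
      (((c j').u a).app m k) =
    sComp (M.pushMap α (((c j).u a).app m k))
      ((A.obj a).actOver ((j ⟶[SSet.{w}] j').map θ γ) α ((baseHom_map θ γ).trans h)) :=
  (hc j').fac (limitActionSimplex c γ α h) a θ k

lemma limitAction_fac_id {j j' : J} {n : SimplexCategoryᵒᵖ}
    (γ : (j ⟶[SSet.{w}] j').obj n) (α : (φ.obj j).as ⟶ (φ.obj j').as)
    (h : baseHom φ γ = α) (a : S.ι) (k : (S.wt a).obj n) :
    sComp (limitAction hc γ α h) (((c j').u a).app n k) =
      sComp (M.pushMap α (((c j).u a).app n k)) ((A.obj a).actOver γ α h) := by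
  have := limitAction_fac hc γ α h a (𝟙 n) k
  rw [map_id_apply] at this
  rw [this]
  congr 1
  exact actOver_congr _ (map_id_apply _ γ) _ _

lemma map_limitAction ⦃j j' : J⦄ ⦃n m : SimplexCategoryᵒᵖ⦄ (θ : n ⟶ m)
    (γ : (j ⟶[SSet.{w}] j').obj n) (α : (φ.obj j).as ⟶ (φ.obj j').as) (h : baseHom φ γ = α) :
    (M.push α (P j) ⟶[SSet.{w}] P j').map θ (limitAction hc γ α h) =
      limitAction hc ((j ⟶[SSet.{w}] j').map θ γ) α ((baseHom_map θ γ).trans h) :=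
  (hc j').hom_ext (fun a m' θ' k ↦ by
    rw [← map_comp_apply, limitAction_fac, limitAction_fac]
    congr 1
    exact actOver_congr _ (map_comp_apply _ _ _ γ) _ _)

/-- A levelwise weighted limit of simplicial sections. -/
noncomputable def limitSection : SimplicialSection φ M :=
  ofAction P (limitAction hc) (map_limitAction hc)
    (fun j n ↦ (hc j).hom_ext (fun a m θ k ↦ by
      rw [map_limitAction, map_sHomOf, ← M.idHom_nat, limitAction_fac_id]
      congr 1
      exact (actOver_congr _ (map_sId j θ) _ _).trans (actOver_sId _ j m)))
    -- Here the identity is tested after projection from the limit `P j''` at the target, so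
    -- preservation properties of the pushforwards play no role.
    (fun j j' j'' n γ δ α β hα hβ h ↦ (hc j'').hom_ext (fun a m θ k ↦ by
      rw [limitAction_fac, (A.obj a).actOver_congr (map_sComp θ γ δ),
        (A.obj a).actOver_sComp _ _ α β _ ((baseHom_map θ γ).trans hα)
          ((baseHom_map θ δ).trans hβ) rfl, map_sComp, map_sHomOf, map_sComp, M.map_pushMap,
        map_limitAction, map_limitAction, sComp_assoc, sComp_assoc, limitAction_fac_id,
        ← sComp_assoc (M.pushMap β _), ← M.pushMap_sComp, limitAction_fac_id,
        M.pushMap_sComp, sComp_assoc, ← sComp_assoc, M.compHom_nat, sComp_assoc]))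

lemma limitSection_actOver {j j' : J} {n : SimplexCategoryᵒᵖ} (γ : (j ⟶[SSet.{w}] j').obj n)
    (α : (φ.obj j).as ⟶ (φ.obj j').as) (h : baseHom φ γ = α) :
    (limitSection hc).actOver γ α h = limitAction hc γ α h :=
  ofAction_actOver _ _ _ _ _ _ _ _

/-- The cone of a levelwise weighted limit of simplicial sections. -/
noncomputable def limitSectionCone : A.Cone σ (limitSection hc) where
  u a :=
    { app n := ↾fun k ↦ ⟨fun j ↦ ((c j).u a).app n k, isNatural_of_actOver
        (fun m θ j j' γ α h ↦ by
          rw [limitSection_actOver]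
          refine Eq.trans (congrArg (sComp _) ((c j').map_u a θ k)) ?_
          refine (limitAction_fac_id hc γ α h a _).trans ?_
          exact congrArg (fun x ↦ sComp (M.pushMap α x) ((A.obj a).actOver γ α h))
            ((c j).map_u a θ k).symm)⟩
      naturality n m θ := by
        ext k
        exact Subtype.ext (funext fun j ↦ ((c j).map_u a θ k).symm) }
  u_arr {a b} e n k := Subtype.ext (funext fun j ↦ (c j).u_arr e n k)

/-- Dual argument: naturality of the levelwise lifts is tested after projecting from `P j'`, and
reduces to the naturality of the simplices `s.x`. -/
lemma isUniversal_limitSectionCone : (limitSectionCone hc).IsUniversal := by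
  intro Z n s
  let t (j : J) : (A.map (simplicialEv φ M j)).ConeSimplex σ (Z.obj j) n :=
    { x a m θ k := (s.x a θ k).1 j
      map_x a m m' θ θ' k := congrFun (congrArg Subtype.val (s.map_x a θ θ' k)) j
      x_arr e m θ k := congrFun (congrArg Subtype.val (s.x_arr e θ k)) j }
  have ht (j : J) (a : S.ι) {m : SimplexCategoryᵒᵖ} (θ : n ⟶ m) (k : (S.wt a).obj m) :
    sComp ((Z.obj j ⟶[SSet.{w}] P j).map θ ((hc j).lift (t j))) (((c j).u a).app m k) =
      (s.x a θ k).1 j := (hc j).fac (t j) a θ k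
  refine ⟨⟨fun j ↦ (hc j).lift (t j), isNatural_of_actOver (fun m θ j j' γ α h ↦ ?_)⟩,
    fun a m θ k ↦ Subtype.ext (funext fun j ↦ ht j a θ k), fun f hf ↦ ?_⟩
  · rw [limitSection_actOver]
    change sComp _ ((Z.obj j' ⟶[SSet.{w}] P j').map θ ((hc j').lift (t j'))) =
      sComp (M.pushMap α ((Z.obj j ⟶[SSet.{w}] P j).map θ ((hc j).lift (t j)))) _
    refine (hc j').hom_ext (fun a m' θ' k ↦ ?_)
    rw [map_sComp, map_sComp, sComp_assoc, sComp_assoc, map_limitAction, limitAction_fac_id,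
      map_actOver, M.map_pushMap]
    refine Eq.trans (congrArg (sComp _) (Eq.trans (congrArg (sComp · _)
      (map_comp_apply _ θ θ' _).symm) (ht j' a (θ ≫ θ') k))) (Eq.trans ?_ (sComp_assoc _ _ _))
    refine Eq.trans ?_
      (congrArg (sComp · _) ((congrArg (M.pushMap α) ((congrArg (sComp · _)
      (map_comp_apply _ θ θ' _).symm).trans (ht j a (θ ≫ θ') k))).symm.trans
        (M.pushMap_sComp _ _ _)))
    exact (s.x a (θ ≫ θ') k).2.actOver_id _ α _
  · refine Subtype.ext (funext fun j ↦ (hc j).hom_ext (fun a m θ k ↦ ?_))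
    exact (congrFun (congrArg Subtype.val (hf a m θ k)) j).trans (ht j a θ k).symm

end Limit

end SimplicialSection

end SimplicialSections

/-! ### Ordinary limits and colimits, tensors and cotensors of sections. -/

namespace SimplicialSections

open WeightedShape WeightedDiagram

variable {I : Type u₁} [Category.{w} I] {J : Type w} [EnrichedCategory SSet.{w} J]
  {φ : EnrichedFunctor SSet.{w} J (Disc I)} {M : SimplicialQuillenPresheaf.{w, u} I}

namespace SimplicialSection

/-- Constructor for morphisms of simplicial sections. -/
def homOfIsNatural {s t : SimplicialSection φ M} (f : ∀ j, s.obj j ⟶ t.obj j)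
    (hf : ∀ n, IsNatural (s := s) (t := t) (fun j ↦ sHomOf (f j) n)) : s ⟶ t :=
  Hom.mk f (fun n j j' γ ↦ by
    have h := hf n (𝟙 n) γ
    rwa [map_id_apply, map_id_apply] at h)

section Colimits

variable {K : Type v} [Category.{v'} K] (F : K ⥤ SimplicialSection φ M)
  [∀ i, HasColimitsOfShape K (M.obj i)]

/-- Ordinary colimits in a fiber have the simplicial universal property because the fiber is
cotensored; this is what the construction of `colimitSection` requires. -/
lemma isUniversal_levelwiseColimit (j : J) :
    Cocone.IsUniversal (A := (ofFunctor F).map (simplicialEv φ M j))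
      (ofCocone (colimit.cocone (F ⋙ ev φ M j))) :=
  isUniversal_ofCocone (M.obj _).isSimplicialModelCategory.cotensored (colimit.isColimit _)

/-- The levelwise colimit cocone of a functor to the category of simplicial sections. -/
noncomputable def levelwiseColimitCocone : Limits.Cocone F where
  pt := colimitSection (isUniversal_levelwiseColimit F)
  ι :=
    { app k := homOfIsNatural (fun j ↦ colimit.ι (F ⋙ ev φ M j) k) (fun n ↦
        (((colimitSectionCocone (isUniversal_levelwiseColimit F)).u k).app n PUnit.unit).2)
      naturality k k' e := Hom.ext (funext fun j ↦ by
        exact (colimit.w (F ⋙ ev φ M j) e).trans (Category.comp_id _).symm) }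

lemma nonempty_isColimit_levelwiseColimitCocone :
    Nonempty (IsColimit (levelwiseColimitCocone F)) :=
  nonempty_isColimit_of_isUniversal
    (isUniversal_colimitSectionCocone (isUniversal_levelwiseColimit F))

instance : HasColimitsOfShape K (SimplicialSection φ M) where
  has_colimit F := ⟨⟨⟨_, (nonempty_isColimit_levelwiseColimitCocone F).some⟩⟩⟩

instance (j : J) : PreservesColimitsOfShape K (ev φ M j) where
  preservesColimit {F} := preservesColimit_of_preserves_colimit_cocone
    (nonempty_isColimit_levelwiseColimitCocone F).some
    (IsColimit.ofIsoColimit (colimit.isColimit (F ⋙ ev φ M j))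
      (Limits.Cocone.ext (Iso.refl _) (fun _ ↦ Category.comp_id _)))

end Colimits

section Limits

variable {K : Type v} [Category.{v'} K] (F : K ⥤ SimplicialSection φ M)
  [∀ i, HasLimitsOfShape K (M.obj i)]

/-- For limits it is the tensors of the fiber that give the simplicial universal property. -/
lemma isUniversal_levelwiseLimit (j : J) :
    Cone.IsUniversal (A := (ofFunctor F).map (simplicialEv φ M j))
      (ofCone (limit.cone (F ⋙ ev φ M j))) :=
  isUniversal_ofCone (M.obj _).isSimplicialModelCategory.tensored (limit.isLimit _)

/-- The levelwise limit cone of a functor to the category of simplicial sections. -/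
noncomputable def levelwiseLimitCone : Limits.Cone F where
  pt := limitSection (isUniversal_levelwiseLimit F)
  π :=
    { app k := homOfIsNatural (fun j ↦ limit.π (F ⋙ ev φ M j) k) (fun n ↦
        (((limitSectionCone (isUniversal_levelwiseLimit F)).u k).app n PUnit.unit).2)
      naturality k k' e := Hom.ext (funext fun j ↦ by
        exact (Category.id_comp _).trans (limit.w (F ⋙ ev φ M j) e).symm) }

lemma nonempty_isLimit_levelwiseLimitCone :
    Nonempty (IsLimit (levelwiseLimitCone F)) :=
  nonempty_isLimit_of_isUniversal
    (isUniversal_limitSectionCone (isUniversal_levelwiseLimit F))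

instance : HasLimitsOfShape K (SimplicialSection φ M) where
  has_limit F := ⟨⟨⟨_, (nonempty_isLimit_levelwiseLimitCone F).some⟩⟩⟩

instance (j : J) : PreservesLimitsOfShape K (ev φ M j) where
  preservesLimit {F} := preservesLimit_of_preserves_limit_cone
    (nonempty_isLimit_levelwiseLimitCone F).some
    (IsLimit.ofIsoLimit (limit.isLimit (F ⋙ ev φ M j))
      (Limits.Cone.ext (Iso.refl _) (fun _ ↦ (Category.id_comp _).symm)))

end Limits

instance [∀ i, HasColimitsOfSize.{v, v'} (M.obj i)] :
    HasColimitsOfSize.{v, v'} (SimplicialSection φ M) where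

instance [∀ i, HasColimitsOfSize.{v, v'} (M.obj i)] (j : J) :
    PreservesColimitsOfSize.{v, v'} (ev φ M j) where

instance : HasFiniteLimits (SimplicialSection φ M) where
  out _ _ _ := inferInstance

/-- The category of simplicial sections is tensored. -/
lemma nonempty_simplicialTensor (K : SSet.{w}) (s : SimplicialSection φ M) :
    Nonempty (SimplicialTensor K s) := by
  let T (j : J) := ((M.obj _).isSimplicialModelCategory.tensored K (s.obj j)).some
  -- The evaluation of a `discrete` diagram is not literally a `discrete` diagram, although neither
  -- has arrows; hence the repackaging of cocone simplices.
  have hT (j : J) : Cocone.IsUniversal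
      (A := (WeightedDiagram.discrete (fun _ : PUnit.{1} ↦ K) (fun _ ↦ s)).map
        (simplicialEv φ M j)) (ρ := discreteRestriction _)
      { u _ := (T j).unit, arr_u e := PEmpty.elim e } := by
    intro Z n x
    exact (T j).isUniversal Z n ⟨x.x, x.map_x, fun e ↦ PEmpty.elim e⟩
  exact ⟨SimplicialTensor.ofIsUniversal ((colimitSectionCocone hT).u PUnit.unit)
    (isUniversal_colimitSectionCocone hT)⟩

/-- The category of simplicial sections has levelwise cotensors. -/
lemma exists_levelwise_cotensor (K : SSet.{w}) (s : SimplicialSection φ M) :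
    ∃ T : SimplicialCotensor K s, ∀ j, (discreteCone (X := fun _ : PUnit.{1} ↦ s.obj j)
      (P := T.obj.obj j) (fun _ ↦ T.counit ≫ Map.ev _ _ j)).IsUniversal := by
  let T (j : J) := ((M.obj _).isSimplicialModelCategory.cotensored K (s.obj j)).some
  have hT (j : J) : Cone.IsUniversal
      (A := (WeightedDiagram.discrete (fun _ : PUnit.{1} ↦ K) (fun _ ↦ s)).map
        (simplicialEv φ M j)) (σ := discreteTransition _)
      { u _ := (T j).counit, u_arr e := PEmpty.elim e } := by
    intro Z n x
    exact (T j).isUniversal Z n ⟨x.x, x.map_x, fun e ↦ PEmpty.elim e⟩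
  exact ⟨SimplicialCotensor.ofIsUniversal ((limitSectionCone hT).u PUnit.unit)
    (isUniversal_limitSectionCone hT), fun j ↦ (T j).isUniversal⟩

end SimplicialSection

end SimplicialSections

/-! ### Free sections: construction, universal property and the coproduct formula. -/

namespace SimplicialSections

open WeightedShape WeightedDiagram

variable {I : Type u₁} [Category.{w} I] {J : Type w} [EnrichedCategory SSet.{w} J]
  {φ : EnrichedFunctor SSet.{w} J (Disc I)} {M : SimplicialQuillenPresheaf.{w, u} I}

namespace SimplicialQuillenPresheaf

variable (M)

/-- The isomorphism `β_! α_! X ⟶ γ_! X` when `α ≫ β = γ`. -/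
def compInv {i j k : I} (α : i ⟶ j) (β : j ⟶ k) (γ : i ⟶ k) (h : α ≫ β = γ) (X : M.obj i) :
    M.push β (M.push α X) ⟶ M.push γ X := ((M.mapComp α β γ h).app X).inv

/-- The isomorphism `X ⟶ (𝟙 i)_! X`. -/
def idInv (i : I) (X : M.obj i) : X ⟶ M.push (𝟙 i) X := ((M.mapId i).app X).inv

lemma compHom_compInv {i j k : I} (α : i ⟶ j) (β : j ⟶ k) (γ : i ⟶ k) (h : α ≫ β = γ)
    (X : M.obj i) (n : SimplexCategoryᵒᵖ) :
    sComp (sHomOf (M.compHom α β γ h X) n) (sHomOf (M.compInv α β γ h X) n) =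
      sId (M.push γ X) n :=
  (sHomOf_comp _ _ n).symm.trans ((congrArg (sHomOf · n)
    ((M.mapComp α β γ h).app X).hom_inv_id).trans (sHomOf_id _ n))

lemma compInv_compHom {i j k : I} (α : i ⟶ j) (β : j ⟶ k) (γ : i ⟶ k) (h : α ≫ β = γ)
    (X : M.obj i) (n : SimplexCategoryᵒᵖ) :
    sComp (sHomOf (M.compInv α β γ h X) n) (sHomOf (M.compHom α β γ h X) n) =
      sId (M.push β (M.push α X)) n :=
  (sHomOf_comp _ _ n).symm.trans ((congrArg (sHomOf · n)
    ((M.mapComp α β γ h).app X).inv_hom_id).trans (sHomOf_id _ n))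

lemma idHom_idInv (i : I) (X : M.obj i) (n : SimplexCategoryᵒᵖ) :
    sComp (sHomOf (M.idHom i X) n) (sHomOf (M.idInv i X) n) = sId (M.push (𝟙 i) X) n :=
  (sHomOf_comp _ _ n).symm.trans ((congrArg (sHomOf · n)
    ((M.mapId i).app X).hom_inv_id).trans (sHomOf_id _ n))

lemma idInv_idHom (i : I) (X : M.obj i) (n : SimplexCategoryᵒᵖ) :
    sComp (sHomOf (M.idInv i X) n) (sHomOf (M.idHom i X) n) = sId X n :=
  (sHomOf_comp _ _ n).symm.trans ((congrArg (sHomOf · n)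
    ((M.mapId i).app X).inv_hom_id).trans (sHomOf_id _ n))

/-- By the unit coherence, `compHom` followed by `α_!` of `idHom` is the identity. As `α_!` of
`idInv` is inverse to `α_!` of `idHom`, it has to be `compHom`. -/
lemma pushMap_idInv {i j : I} (α : i ⟶ j) (X : M.obj i) (n : SimplexCategoryᵒᵖ) :
    M.pushMap α (sHomOf (M.idInv i X) n) =
      sHomOf (M.compHom (𝟙 i) α α (Category.id_comp α) X) n := by
  rw [← sComp_sId (sHomOf (M.compHom _ _ _ _ X) n), ← M.pushMap_sId, ← M.idHom_idInv,
    M.pushMap_sComp, ← sComp_assoc, M.compHom_idHom_left, sId_sComp]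

end SimplicialQuillenPresheaf

namespace SimplicialSection

section Free

variable {j : J} {X : M.obj (φ.obj j).as} {P : ∀ j' : J, M.obj (φ.obj j').as}
  (c : ∀ (k : J) (α : (φ.obj j).as ⟶ (φ.obj k).as),
    ((mapOver φ α : (j ⟶[SSet.{w}] k).Subcomplex) : SSet.{w}) ⟶ (M.push α X ⟶[SSet.{w}] P k))

/-- The simplices of `Map(α_! X, P(j'))` given by simplices of `Map(j, j')` over `α`. -/
def genSimplex {j' : J} {n : SimplexCategoryᵒᵖ} (γ : (j ⟶[SSet.{w}] j').obj n)
    (α : (φ.obj j).as ⟶ (φ.obj j').as) (h : baseHom φ γ = α) :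
    (M.push α X ⟶[SSet.{w}] P j').obj n :=
  (c j' α).app n ⟨γ, h⟩

lemma genSimplex_congr {j' : J} {n : SimplexCategoryᵒᵖ} {γ γ' : (j ⟶[SSet.{w}] j').obj n}
    (e : γ = γ') (α : (φ.obj j).as ⟶ (φ.obj j').as) (h : baseHom φ γ = α) :
    genSimplex c γ α h = genSimplex c γ' α (e ▸ h) := by
  subst e
  rfl

lemma map_genSimplex {j' : J} {n m : SimplexCategoryᵒᵖ} (θ : n ⟶ m)
    (γ : (j ⟶[SSet.{w}] j').obj n) (α : (φ.obj j).as ⟶ (φ.obj j').as)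
    (h : baseHom φ γ = α) : (M.push α X ⟶[SSet.{w}] P j').map θ (genSimplex c γ α h) =
      genSimplex c ((j ⟶[SSet.{w}] j').map θ γ) α ((baseHom_map θ γ).trans h) :=
  (NatTrans.naturality_apply (c j' α) θ (⟨γ, h⟩ : ((mapOver φ α) : SSet.{w}).obj n)).symm

/-- The weighted cocone simplex defining the action on a free section. -/
def freeActionSimplex {j' j'' : J} {n : SimplexCategoryᵒᵖ} (δ : (j' ⟶[SSet.{w}] j'').obj n)
    (β : (φ.obj j').as ⟶ (φ.obj j'').as) (h : baseHom φ δ = β) :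
    ((WeightedDiagram.discrete
      (fun α ↦ ((mapOver φ α : (j ⟶[SSet.{w}] j').Subcomplex) : SSet.{w}))
      (fun α ↦ M.push α X)).map (M.map β).left).CoconeSimplex
        (discreteRestriction _) (P j'') n where
  -- On the copy of `β_! α_! X` indexed by `γ`, the simplex `δ` acts through `β_! α_! X ≅ (α ≫ β)_!
  -- X` and the copy indexed by `γδ`.
  x α m θ γ := sComp (sHomOf (M.compInv α β (α ≫ β) rfl X) m)
    (genSimplex c (sComp γ.1 ((j' ⟶[SSet.{w}] j'').map θ δ)) (α ≫ β) (by
      have h' : baseHom φ γ.1 = α := γ.2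
      rw [baseHom_sComp, baseHom_map, h, h']))
  map_x α m m' θ θ' γ := by
    rw [map_sComp, map_sHomOf, map_genSimplex]
    congr 1
    refine genSimplex_congr c ?_ _ _
    rw [map_sComp, ← map_comp_apply]
    rfl
  arr_x e := PEmpty.elim e

variable {c} (hc : ∀ j', (discreteCocone (c j')).IsUniversal)

/-- The action on a free section. -/
noncomputable def freeAction ⦃j' j'' : J⦄ ⦃n : SimplexCategoryᵒᵖ⦄
    (δ : (j' ⟶[SSet.{w}] j'').obj n) (β : (φ.obj j').as ⟶ (φ.obj j'').as)
    (h : baseHom φ δ = β) : (M.push β (P j') ⟶[SSet.{w}] P j'').obj n :=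
  ((hc j').map_of_adjunction (M.map β).adj).desc (freeActionSimplex c δ β h)

include hc in
-- Maps out of `β_! P(j')` are tested on `β_!` of the generators. Precomposing with the invertible
-- `compHom` loses nothing and puts both sides in the form to which `freeAction_fac_id` applies; the
-- name `αβ` of the composite may be chosen in each case.
lemma free_push_hom_ext {j' : J} {i : I} (β : (φ.obj j').as ⟶ i) {Z : M.obj i}
    {n : SimplexCategoryᵒᵖ} {f g : (M.push β (P j') ⟶[SSet.{w}] Z).obj n}
    (h : ∀ (α : (φ.obj j).as ⟶ (φ.obj j').as) (m : SimplexCategoryᵒᵖ) (θ : n ⟶ m)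
      (γ : (j ⟶[SSet.{w}] j').obj m) (hγ : baseHom φ γ = α),
      ∃ (αβ : (φ.obj j).as ⟶ i) (hαβ : α ≫ β = αβ),
      sComp (sHomOf (M.compHom α β αβ hαβ X) m) (sComp (M.pushMap β (genSimplex c γ α hγ))
        ((M.push β (P j') ⟶[SSet.{w}] Z).map θ f)) =
      sComp (sHomOf (M.compHom α β αβ hαβ X) m) (sComp (M.pushMap β (genSimplex c γ α hγ))
        ((M.push β (P j') ⟶[SSet.{w}] Z).map θ g))) : f = g := by
  refine ((hc j').map_of_adjunction (M.map β).adj).hom_ext (fun α m θ γ ↦ ?_)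
  obtain ⟨αβ, hαβ, h'⟩ := h α m θ γ.1 γ.2
  replace h' := congrArg (sComp (sHomOf (M.compInv α β αβ hαβ X) m)) h'
  rw [← sComp_assoc, M.compInv_compHom, sId_sComp, ← sComp_assoc, M.compInv_compHom,
    sId_sComp] at h'
  exact h'

/-- The defining rule of the free section: `δ` sends the generator `γ` to the generator `γδ`, up to
the coherence isomorphism. -/
lemma freeAction_fac_id {j' j'' : J} {n : SimplexCategoryᵒᵖ}
    (γ : (j ⟶[SSet.{w}] j').obj n) (δ : (j' ⟶[SSet.{w}] j'').obj n)
    (α : (φ.obj j).as ⟶ (φ.obj j').as) (β : (φ.obj j').as ⟶ (φ.obj j'').as)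
    (αβ : (φ.obj j).as ⟶ (φ.obj j'').as) (hα : baseHom φ γ = α) (hβ : baseHom φ δ = β)
    (h : α ≫ β = αβ) (h' : baseHom φ (sComp γ δ) = αβ) :
    sComp (sHomOf (M.compHom α β αβ h X) n)
      (sComp (M.pushMap β (genSimplex c γ α hα)) (freeAction hc δ β hβ)) =
    genSimplex c (sComp γ δ) αβ h' := by
  subst h
  have := ((hc j').map_of_adjunction (M.map β).adj).fac (freeActionSimplex c δ β hβ) α (𝟙 n)
    ⟨γ, hα⟩
  rw [map_id_apply] at this
  refine (congrArg (sComp _) this).trans ?_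
  dsimp only [freeActionSimplex]
  rw [← sComp_assoc, M.compHom_compInv, sId_sComp]
  refine genSimplex_congr c ?_ _ _
  rw [map_id_apply]

lemma map_freeAction ⦃j' j'' : J⦄ ⦃n m : SimplexCategoryᵒᵖ⦄ (θ : n ⟶ m)
    (δ : (j' ⟶[SSet.{w}] j'').obj n) (β : (φ.obj j').as ⟶ (φ.obj j'').as)
    (h : baseHom φ δ = β) :
    (M.push β (P j') ⟶[SSet.{w}] P j'').map θ (freeAction hc δ β h) =
      freeAction hc ((j' ⟶[SSet.{w}] j'').map θ δ) β ((baseHom_map θ δ).trans h) := by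
  refine ((hc j').map_of_adjunction (M.map β).adj).hom_ext (fun α m' θ' γ ↦ ?_)
  rw [← map_comp_apply]
  refine (((hc j').map_of_adjunction (M.map β).adj).fac (freeActionSimplex c δ β h) α
    (θ ≫ θ') γ).trans (Eq.trans ?_
    (((hc j').map_of_adjunction (M.map β).adj).fac (freeActionSimplex c _ β _) α θ' γ).symm)
  dsimp only [freeActionSimplex]
  congr 1
  refine genSimplex_congr c ?_ _ _
  rw [map_comp_apply]

/-- The free section. -/
noncomputable def freeSection : SimplicialSection φ M :=
  ofAction P (freeAction hc) (map_freeAction hc)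
    (fun j' n ↦ free_push_hom_ext hc _ (fun α m θ γ hγ ↦ by
      refine ⟨α, Category.comp_id α, ?_⟩
      rw [map_freeAction, map_sHomOf, M.idHom_nat, freeAction_fac_id hc γ _ α _ α hγ _ _
        (by rw [map_sId, sComp_sId, hγ]), ← sComp_assoc, M.compHom_idHom_right, sId_sComp]
      exact genSimplex_congr c (by rw [map_sId, sComp_sId]) _ _))
    -- On a generator `γ`, the associativity coherence `compHom_assoc` reduces the claim to `γ(δε) =
    -- (γδ)ε` in `J`.
    (fun j' j'' l n δ ε β β' hβ hβ' h ↦ free_push_hom_ext hc _ (fun α m θ γ hγ ↦ by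
      refine ⟨α ≫ β ≫ β', rfl, ?_⟩
      have hγδ : baseHom φ (sComp γ ((j' ⟶[SSet.{w}] j'').map θ δ)) = α ≫ β := by
        rw [baseHom_sComp, baseHom_map, hγ, hβ]
      rw [map_freeAction, freeAction_fac_id hc γ _ α _ _ hγ _ rfl
          (by rw [baseHom_sComp, baseHom_map, hγ, h]),
        map_sComp θ (sHomOf _ _), map_sHomOf, map_sComp θ (M.pushMap _ _), M.map_pushMap, map_freeAction,
        map_freeAction,
        ← sComp_assoc (M.pushMap (β ≫ β') _), M.compHom_nat, sComp_assoc, ← sComp_assoc,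
        ← M.compHom_assoc α β β' (α ≫ β) (β ≫ β') _ rfl rfl (Category.assoc _ _ _) rfl,
        sComp_assoc, ← sComp_assoc (M.pushMap β' _), ← M.pushMap_sComp,
        ← sComp_assoc (M.pushMap β' _), ← M.pushMap_sComp, sComp_assoc,
        freeAction_fac_id hc γ _ α β _ hγ _ rfl hγδ,
        freeAction_fac_id hc _ _ (α ≫ β) β' _ hγδ _ _
          (by rw [baseHom_sComp, hγδ, baseHom_map, hβ', Category.assoc])]
      exact genSimplex_congr c (by rw [map_sComp, sComp_assoc]) _ _))

lemma freeSection_actOver {j' j'' : J} {n : SimplexCategoryᵒᵖ}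
    (γ : (j' ⟶[SSet.{w}] j'').obj n) (α : (φ.obj j').as ⟶ (φ.obj j'').as)
    (h : baseHom φ γ = α) : (freeSection hc).actOver γ α h = freeAction hc γ α h :=
  ofAction_actOver _ _ _ _ _ _ _ _

/-- The unit is the generator given by the identity of `j`, precomposed with `X ≅ (𝟙)_! X`; it is a
morphism since identity simplices are stable under simplicial operators. -/
lemma exists_freeUnit (c : ∀ (j' : J) (α : (φ.obj j).as ⟶ (φ.obj j').as),
    ((mapOver φ α : (j ⟶[SSet.{w}] j').Subcomplex) : SSet.{w}) ⟶
      (M.push α X ⟶[SSet.{w}] P j')) :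
    ∃ η : X ⟶ P j, ∀ n, sHomOf η n = sComp (sHomOf (M.idInv _ X) n)
      (genSimplex c (sId j n) (𝟙 _) (baseHom_sId j n)) :=
  exists_sHomOf_eq _ (fun n m θ ↦ by
    rw [map_sComp, map_sHomOf, map_genSimplex]
    congr 1
    exact genSimplex_congr c (map_sId j θ) _ _)

/-- The unit of a free section. -/
noncomputable def freeUnit : X ⟶ (freeSection hc).obj j := (exists_freeUnit c).choose

lemma sHomOf_freeUnit (n : SimplexCategoryᵒᵖ) :
    sHomOf (freeUnit hc) n = sComp (sHomOf (M.idInv _ X) n)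
      (genSimplex c (sId j n) (𝟙 _) (baseHom_sId j n)) :=
  (exists_freeUnit c).choose_spec n

/-- Acting by `γ` on the unit gives back the generator `γ`, because `𝟙 γ = γ`. Hence the unit
generates the free section. -/
lemma pushMap_freeUnit {j' : J} {n : SimplexCategoryᵒᵖ} (γ : (j ⟶[SSet.{w}] j').obj n)
    (α : (φ.obj j).as ⟶ (φ.obj j').as) (h : baseHom φ γ = α) :
    sComp (M.pushMap α (sHomOf (freeUnit hc) n)) ((freeSection hc).actOver γ α h) =
      genSimplex c γ α h := by
  rw [sHomOf_freeUnit, freeSection_actOver]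
  refine (congrArg (sComp · _) (M.pushMap_sComp _ _ _)).trans ((sComp_assoc _ _ _).trans ?_)
  rw [M.pushMap_idInv]
  refine (freeAction_fac_id hc (sId j n) γ (𝟙 _) α α _ _ _
    (by rw [sId_sComp, h])).trans (genSimplex_congr c (sId_sComp γ) _ _)

/-- The Yoneda argument: by naturality, the value of `f` on the generator `γ` is obtained by
applying the action of `γ` on `t` to the restriction of `f` along the unit. -/
lemma genSimplex_comp_app {t : SimplicialSection φ M} (f : freeSection hc ⟶ t) {j' : J}
    {n : SimplexCategoryᵒᵖ} (γ : (j ⟶[SSet.{w}] j').obj n)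
    (α : (φ.obj j).as ⟶ (φ.obj j').as) (h : baseHom φ γ = α) :
    sComp (genSimplex c γ α h) (sHomOf (Hom.app f j') n) =
      sComp (M.pushMap α (sHomOf (freeUnit hc ≫ Hom.app f j) n)) (t.actOver γ α h) := by
  rw [sHomOf_comp, M.pushMap_sComp, sComp_assoc, ← Hom.actOver, ← sComp_assoc,
    pushMap_freeUnit]
  rfl

/-- The universal property of the free section. -/
lemma bijective_freeUnit_comp (t : SimplicialSection φ M) :
    Function.Bijective (fun f : freeSection hc ⟶ t ↦ freeUnit hc ≫ Hom.app f j) := by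
  refine ⟨fun f g h ↦ Hom.ext (funext fun j' ↦ (hc j').ordinary_hom_ext (fun α n γ ↦ ?_)),
    fun g ↦ ?_⟩
  · refine (genSimplex_comp_app hc f γ.1 α γ.2).trans
      (Eq.trans ?_ (genSimplex_comp_app hc g γ.1 α γ.2).symm)
    dsimp only at h
    rw [h]
  -- The formula forced by `genSimplex_comp_app` is taken as the definition of the extension of `g`.
  · choose T hT using fun j' ↦ (hc j').exists_hom (discreteCocone (P := t.obj j') (fun α ↦
      { app n := ↾fun γ ↦ sComp (M.pushMap α (sHomOf g n)) (t.actOver γ.1 α γ.2)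
        naturality n m θ := by
          ext γ
          refine Eq.trans ?_ (map_sComp _ _ _).symm
          rw [M.map_pushMap, map_sHomOf]
          exact (congrArg (sComp _) (t.map_actOver θ γ.1 α γ.2)).symm }))
    replace hT {j' : J} {n : SimplexCategoryᵒᵖ} (γ : (j ⟶[SSet.{w}] j').obj n)
        (α : (φ.obj j).as ⟶ (φ.obj j').as) (h : baseHom φ γ = α) :
        sComp (genSimplex c γ α h) (sHomOf (T j') n) =
          sComp (M.pushMap α (sHomOf g n)) (t.actOver γ α h) := hT j' α n ⟨γ, h⟩
    -- Naturality with respect to `δ` is checked on a generator `γ`: both composites become the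
    -- action of `γδ` on `t` applied to `g`.
    have nat {j' j'' : J} {n : SimplexCategoryᵒᵖ} (δ : (j' ⟶[SSet.{w}] j'').obj n)
        (β : (φ.obj j').as ⟶ (φ.obj j'').as) (h : baseHom φ δ = β) :
        sComp (freeAction hc δ β h) (sHomOf (T j'') n) =
          sComp (M.pushMap β (sHomOf (T j') n)) (t.actOver δ β h) := by
      refine free_push_hom_ext hc _ (fun α m θ γ hγ ↦ ⟨_, rfl, ?_⟩)
      have hγδ : baseHom φ (sComp γ ((j' ⟶[SSet.{w}] j'').map θ δ)) = α ≫ β := by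
        rw [baseHom_sComp, baseHom_map, hγ, h]
      rw [map_sComp, map_sComp, map_sHomOf, M.map_pushMap, map_sHomOf, map_freeAction,
        map_actOver, ← sComp_assoc (M.pushMap β _), ← sComp_assoc,
        freeAction_fac_id hc γ _ α β _ hγ _ rfl hγδ, hT,
        t.actOver_sComp _ _ α β _ hγ ((baseHom_map θ δ).trans h) rfl,
        ← sComp_assoc (M.pushMap (α ≫ β) _), M.compHom_nat, ← sComp_assoc (M.pushMap β _),
        ← M.pushMap_sComp, hT, M.pushMap_sComp]
      simp only [sComp_assoc]
    refine ⟨Hom.mk T (fun n j' j'' γ ↦ (post_eq_pre_iff γ _ rfl _ _).2 ?_), ?_⟩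
    · rw [freeSection_actOver]
      exact nat γ _ rfl
    -- On the generator given by the identity, `t` acts by `idHom`, which cancels the `idInv` in the
    -- unit.
    · refine sHomOf_ext (fun n ↦ ?_)
      refine (sHomOf_comp _ _ n).trans ?_
      rw [sHomOf_freeUnit]
      refine (sComp_assoc _ _ _).trans ?_
      refine (congrArg (sComp _) (hT (sId j n) _ (baseHom_sId j n))).trans ?_
      rw [actOver_sId, M.idHom_nat, ← sComp_assoc, M.idInv_idHom, sId_sComp]

/-- For arbitrary choices of tensors, the weighted universal property of the value at `j'` splits
into maps out of each tensor and the universal property of their coproduct; the compatibility with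
the action is `pushMap_freeUnit`. -/
lemma isFreeSection_freeUnit : IsFreeSection (freeUnit hc) := by
  intro j' T
  choose f hf using fun α ↦ (T α).isUniversal.exists_hom
    (discreteCocone (X := fun _ : PUnit.{1} ↦ M.push α X) (fun _ ↦ c j' α))
  replace hf (α) (n) (γ : ((mapOver φ α : (j ⟶[SSet.{w}] j').Subcomplex) : SSet.{w}).obj n) :
      sComp ((T α).unit.app n γ) (sHomOf (f α) n) = (c j' α).app n γ := hf α PUnit.unit n γ
  refine ⟨f, fun α n γ ↦ ?_, ?_⟩
  · rw [← (freeSection hc).mk'_actOver γ.1 α γ.2]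
    refine congrArg (Total.mk' (A := ⟨(φ.obj j).as, X⟩)
      (B := ⟨(φ.obj j').as, (freeSection hc).obj j'⟩) α) ?_
    exact (hf α n γ).trans (pushMap_freeUnit hc γ.1 α γ.2).symm
  · choose g hg using fun s : Cofan (fun α ↦ (T α).obj) ↦ (hc j').exists_hom
      (discreteCocone (P := s.pt)
        (fun α ↦ (T α).unit ≫ eHomWhiskerLeft SSet.{w} (M.push α X) (s.inj α)))
    replace hg (s α n) (γ : ((mapOver φ α : (j ⟶[SSet.{w}] j').Subcomplex) : SSet.{w}).obj n) :
        sComp ((c j' α).app n γ) (sHomOf (g s) n) =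
          sComp ((T α).unit.app n γ) (sHomOf (s.inj α) n) := hg s α n γ
    refine ⟨Cofan.IsColimit.mk _ g (fun s α ↦ (T α).isUniversal.ordinary_hom_ext (fun _ n γ ↦ ?_))
      (fun s m hm ↦ (hc j').ordinary_hom_ext (fun α n γ ↦ ?_))⟩
    · refine Eq.trans ?_ (hg s α n γ)
      rw [← hf]
      exact (congrArg (sComp _) (sHomOf_comp _ _ n)).trans (sComp_assoc _ _ _).symm
    · refine Eq.trans ?_ (hg s α n γ).symm
      rw [← hm α]
      refine (congrArg (sComp · _) (hf α n γ).symm).trans ((sComp_assoc _ _ _).trans ?_)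
      exact congrArg (sComp _) (sHomOf_comp _ _ n).symm

end Free

end SimplicialSection

end SimplicialSections

/-! ### Axiom (SM7) as a lifting property, and its transposition to cotensors. -/

namespace SimplicialSections

open WeightedShape WeightedDiagram

section SimplicialLifting

variable {C : Type u} [Category.{w} C] [SimplicialCategory C]

/-- The lifting property of a map `k : K ⟶ L` of simplicial sets with respect to the map
`Map(B, X) ⟶ Map(A, X) ×_{Map(A, Y)} Map(B, Y)` induced by `i : A ⟶ B` and `p : X ⟶ Y`. -/
def HasSimplicialLifting {K L : SSet.{w}} (k : K ⟶ L) {A B X Y : C} (i : A ⟶ B) (p : X ⟶ Y) :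
    Prop :=
  ∀ (a : L ⟶ (A ⟶[SSet.{w}] X)) (b : K ⟶ (B ⟶[SSet.{w}] X)) (d : L ⟶ (B ⟶[SSet.{w}] Y)),
    k ≫ a = b ≫ eHomWhiskerRight SSet.{w} i X →
    a ≫ eHomWhiskerLeft SSet.{w} A p = d ≫ eHomWhiskerRight SSet.{w} i Y →
    k ≫ d = b ≫ eHomWhiskerLeft SSet.{w} B p →
    ∃ l : L ⟶ (B ⟶[SSet.{w}] X), k ≫ l = b ∧ l ≫ eHomWhiskerRight SSet.{w} i X = a ∧
      l ≫ eHomWhiskerLeft SSet.{w} B p = d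

/-- Unfolding maps into the pullback as compatible pairs removes the chosen pullback from the
lifting problem, which can then be compared with its transpose. -/
lemma hasLiftingProperty_iff_of_isPullback {D : Type v} [Category.{v'} D] {K L P Q R S T : D}
    (k : K ⟶ L) {π : P ⟶ Q} {fst : Q ⟶ R} {snd : Q ⟶ S} {f : R ⟶ T} {g : S ⟶ T}
    (h : IsPullback fst snd f g) {r : P ⟶ R} {s : P ⟶ S} (hr : π ≫ fst = r) (hs : π ≫ snd = s) :
    HasLiftingProperty k π ↔ ∀ (a : L ⟶ R) (b : K ⟶ P) (d : L ⟶ S), k ≫ a = b ≫ r →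
      a ≫ f = d ≫ g → k ≫ d = b ≫ s → ∃ l : L ⟶ P, k ≫ l = b ∧ l ≫ r = a ∧ l ≫ s = d := by
  subst hr hs
  refine ⟨fun _ a b d h₁ h₂ h₃ ↦ ?_, fun H ↦ ⟨fun {b e} sq ↦ ?_⟩⟩
  · have sq : CommSq b k π (h.lift a d h₂) := ⟨by
      apply h.hom_ext
      · rw [Category.assoc, Category.assoc, IsPullback.lift_fst, h₁]
      · rw [Category.assoc, Category.assoc, IsPullback.lift_snd, h₃]⟩
    refine ⟨sq.lift, sq.fac_left, ?_, ?_⟩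
    · rw [sq.fac_right_assoc, IsPullback.lift_fst]
    · rw [sq.fac_right_assoc, IsPullback.lift_snd]
  · obtain ⟨l, h₁, h₂, h₃⟩ := H (e ≫ fst) b (e ≫ snd) (by rw [reassoc_of% sq.w])
      (by rw [Category.assoc, Category.assoc, h.w]) (by rw [reassoc_of% sq.w])
    refine ⟨⟨⟨l, h₁, h.hom_ext ?_ ?_⟩⟩⟩
    · rw [Category.assoc, h₂]
    · rw [Category.assoc, h₃]

lemma hasLiftingProperty_pullbackObjObj_iff {K L : SSet.{w}} (k : K ⟶ L) {A B X Y : C}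
    (i : A ⟶ B) (p : X ⟶ Y) (sq : (SimplicialCategory.sHomFunctor C).PullbackObjObj i p) :
    HasLiftingProperty k sq.π ↔ HasSimplicialLifting k i p :=
  hasLiftingProperty_iff_of_isPullback k sq.isPullback sq.π_fst sq.π_snd

/-- The property that a map `L ⟶ Map(P, X)` exhibits `P` as the cotensor `X ^ L`. -/
abbrev IsCotensor {L : SSet.{w}} {P X : C} (u : L ⟶ (P ⟶[SSet.{w}] X)) : Prop :=
  (discreteCone (X := fun _ : PUnit.{1} ↦ X) (fun _ ↦ u)).IsUniversal

lemma IsCotensor.exists_hom {L : SSet.{w}} {P X : C} {u : L ⟶ (P ⟶[SSet.{w}] X)}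
    (hu : IsCotensor u) {A : C} (g : L ⟶ (A ⟶[SSet.{w}] X)) :
    ∃ f : A ⟶ P, u ≫ eHomWhiskerRight SSet.{w} f X = g := by
  obtain ⟨f, hf⟩ := Cone.IsUniversal.exists_hom hu (discreteCone fun _ ↦ g)
  refine ⟨f, ?_⟩
  apply NatTrans.ext
  ext n l
  exact hf PUnit.unit n l

lemma IsCotensor.hom_ext {L : SSet.{w}} {P X : C} {u : L ⟶ (P ⟶[SSet.{w}] X)}
    (hu : IsCotensor u) {A : C} {f g : A ⟶ P}
    (h : u ≫ eHomWhiskerRight SSet.{w} f X = u ≫ eHomWhiskerRight SSet.{w} g X) : f = g :=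
  Cone.IsUniversal.ordinary_hom_ext hu (fun _ n l ↦
    ConcreteCategory.congr_hom (NatTrans.congr_app h n) l)

/-- The data of the pullback-cotensor `X ^ L ⟶ X ^ K ×_{Y ^ K} Y ^ L` of `k : K ⟶ L` and
`p : X ⟶ Y`. -/
structure PullbackCotensor {K L : SSet.{w}} (k : K ⟶ L) {X Y : C} (p : X ⟶ Y) where
  /-- the cotensor `X ^ L` -/
  XL : C
  /-- the cotensor `X ^ K` -/
  XK : C
  /-- the cotensor `Y ^ L` -/
  YL : C
  /-- the cotensor `Y ^ K` -/
  YK : C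
  /-- the pullback -/
  pt : C
  /-- the universal map of `X ^ L` -/
  uXL : L ⟶ (XL ⟶[SSet.{w}] X)
  /-- the universal map of `X ^ K` -/
  uXK : K ⟶ (XK ⟶[SSet.{w}] X)
  /-- the universal map of `Y ^ L` -/
  uYL : L ⟶ (YL ⟶[SSet.{w}] Y)
  /-- the universal map of `Y ^ K` -/
  uYK : K ⟶ (YK ⟶[SSet.{w}] Y)
  hXL : IsCotensor uXL
  hXK : IsCotensor uXK
  hYL : IsCotensor uYL
  hYK : IsCotensor uYK
  /-- the map `X ^ L ⟶ X ^ K` -/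
  resX : XL ⟶ XK
  /-- the map `Y ^ L ⟶ Y ^ K` -/
  resY : YL ⟶ YK
  /-- the map `X ^ K ⟶ Y ^ K` -/
  pK : XK ⟶ YK
  /-- the map `X ^ L ⟶ Y ^ L` -/
  pL : XL ⟶ YL
  resX_eq : uXK ≫ eHomWhiskerRight SSet.{w} resX X = k ≫ uXL
  resY_eq : uYK ≫ eHomWhiskerRight SSet.{w} resY Y = k ≫ uYL
  pK_eq : uYK ≫ eHomWhiskerRight SSet.{w} pK Y = uXK ≫ eHomWhiskerLeft SSet.{w} XK p
  pL_eq : uYL ≫ eHomWhiskerRight SSet.{w} pL Y = uXL ≫ eHomWhiskerLeft SSet.{w} XL p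
  /-- the first projection -/
  fst : pt ⟶ XK
  /-- the second projection -/
  snd : pt ⟶ YL
  isPullback : IsPullback fst snd pK resY
  /-- the map to the pullback -/
  π : XL ⟶ pt
  π_fst : π ≫ fst = resX
  π_snd : π ≫ snd = pL

namespace PullbackCotensor

variable {K L : SSet.{w}} {k : K ⟶ L} {X Y : C} {p : X ⟶ Y} (Q : PullbackCotensor k p)

lemma uXK_comp_resX {A : C} (f : A ⟶ Q.XL) :
    Q.uXK ≫ eHomWhiskerRight SSet.{w} (f ≫ Q.resX) X =
      k ≫ Q.uXL ≫ eHomWhiskerRight SSet.{w} f X := by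
  rw [eHomWhiskerRight_comp, reassoc_of% Q.resX_eq]

lemma uYK_comp_resY {A : C} (f : A ⟶ Q.YL) :
    Q.uYK ≫ eHomWhiskerRight SSet.{w} (f ≫ Q.resY) Y =
      k ≫ Q.uYL ≫ eHomWhiskerRight SSet.{w} f Y := by
  rw [eHomWhiskerRight_comp, reassoc_of% Q.resY_eq]

lemma uYK_comp_pK {A : C} (f : A ⟶ Q.XK) :
    Q.uYK ≫ eHomWhiskerRight SSet.{w} (f ≫ Q.pK) Y =
      (Q.uXK ≫ eHomWhiskerRight SSet.{w} f X) ≫ eHomWhiskerLeft SSet.{w} A p := by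
  rw [eHomWhiskerRight_comp, reassoc_of% Q.pK_eq, eHom_whisker_exchange, Category.assoc]

lemma uYL_comp_pL {A : C} (f : A ⟶ Q.XL) :
    Q.uYL ≫ eHomWhiskerRight SSet.{w} (f ≫ Q.pL) Y =
      (Q.uXL ≫ eHomWhiskerRight SSet.{w} f X) ≫ eHomWhiskerLeft SSet.{w} A p := by
  rw [eHomWhiskerRight_comp, reassoc_of% Q.pL_eq, eHom_whisker_exchange, Category.assoc]

/-- Maps `A ⟶ X ^ L` correspond to maps `L ⟶ Map(A, X)`. Under this correspondence, lifting `i`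
against the pullback-cotensor map is the same problem as lifting `k` against the map of mapping
spaces. -/
lemma hasLiftingProperty_iff {A B : C} (i : A ⟶ B) :
    HasLiftingProperty i Q.π ↔ HasSimplicialLifting k i p := by
  refine ⟨fun _ a b d h₃ h₄ h₅ ↦ ?_, fun h ↦ ⟨fun {f g} hsq ↦ ?_⟩⟩
  · obtain ⟨a, rfl⟩ := Q.hXL.exists_hom a
    obtain ⟨b, rfl⟩ := Q.hXK.exists_hom b
    obtain ⟨d, rfl⟩ := Q.hYL.exists_hom d
    have hsq : CommSq a i Q.π (Q.isPullback.lift b d (Q.hYK.hom_ext (by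
        rw [Q.uYK_comp_pK, Q.uYK_comp_resY, h₅]))) := ⟨by
      apply Q.isPullback.hom_ext
      · rw [Category.assoc, Q.π_fst, Category.assoc, IsPullback.lift_fst]
        exact Q.hXK.hom_ext (by
          rw [Q.uXK_comp_resX, h₃, eHomWhiskerRight_comp, Category.assoc])
      · rw [Category.assoc, Q.π_snd, Category.assoc, IsPullback.lift_snd]
        exact Q.hYL.hom_ext (by
          rw [Q.uYL_comp_pL, h₄, eHomWhiskerRight_comp, Category.assoc])⟩
    have h₁ : hsq.lift ≫ Q.resX = b := by
      rw [← Q.π_fst, hsq.fac_right_assoc, IsPullback.lift_fst]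
    have h₂ : hsq.lift ≫ Q.pL = d := by
      rw [← Q.π_snd, hsq.fac_right_assoc, IsPullback.lift_snd]
    refine ⟨Q.uXL ≫ eHomWhiskerRight SSet.{w} hsq.lift X, ?_, ?_, ?_⟩
    · rw [← Q.uXK_comp_resX, h₁]
    · rw [Category.assoc, ← eHomWhiskerRight_comp, hsq.fac_left]
    · rw [← Q.uYL_comp_pL, h₂]
  · obtain ⟨l, h₁, h₂, h₃⟩ := h (Q.uXL ≫ eHomWhiskerRight SSet.{w} f X)
      (Q.uXK ≫ eHomWhiskerRight SSet.{w} (g ≫ Q.fst) X)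
      (Q.uYL ≫ eHomWhiskerRight SSet.{w} (g ≫ Q.snd) Y)
      (by rw [← Q.uXK_comp_resX, Category.assoc, ← eHomWhiskerRight_comp, ← Q.π_fst,
        ← Category.assoc, hsq.w, Category.assoc])
      (by rw [← Q.uYL_comp_pL, Category.assoc, ← eHomWhiskerRight_comp, ← Q.π_snd,
        ← Category.assoc, hsq.w, Category.assoc])
      (by rw [← Q.uYK_comp_resY, ← Q.uYK_comp_pK, Category.assoc, Category.assoc,
        Q.isPullback.w])
    obtain ⟨l, rfl⟩ := Q.hXL.exists_hom l
    refine ⟨⟨⟨l, Q.hXL.hom_ext ?_, Q.isPullback.hom_ext ?_ ?_⟩⟩⟩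
    · rw [eHomWhiskerRight_comp, ← Category.assoc, h₂]
    · rw [Category.assoc, Q.π_fst]
      exact Q.hXK.hom_ext (by rw [Q.uXK_comp_resX, h₁])
    · rw [Category.assoc, Q.π_snd]
      exact Q.hYL.hom_ext (by rw [Q.uYL_comp_pL, h₃])

end PullbackCotensor

end SimplicialLifting

section SimplicialModelCategory

variable {C : Type u} [Category.{w} C] [SimplicialCategory C] [ModelCategory C]
  (hC : IsSimplicialModelCategory C)

include hC

lemma IsSimplicialModelCategory.hasSimplicialLifting_of_horn {K L : SSet.{w}} {k : K ⟶ L}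
    (hk : SSet.modelCategoryQuillen.J k) {A B X Y : C} (i : A ⟶ B) (p : X ⟶ Y)
    (hi : cofibrations C i) (hp : fibrations C p) : HasSimplicialLifting k i p := by
  rw [← hasLiftingProperty_pullbackObjObj_iff k i p (Functor.PullbackObjObj.ofHasPullback _ i p)]
  exact hC.kanFibration i p ⟨hi⟩ ⟨hp⟩ _ _ hk

/-- (SM7) gives lifts against boundary inclusions; these generate all monomorphisms, so the lifting
extends to every mono `k`. -/
lemma IsSimplicialModelCategory.hasSimplicialLifting_of_mono {K L : SSet.{w}} (k : K ⟶ L)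
    [Mono k] {A B X Y : C} (i : A ⟶ B) (p : X ⟶ Y)
    (hi : cofibrations C i) (hp : fibrations C p)
    (h : weakEquivalences C i ∨ weakEquivalences C p) : HasSimplicialLifting k i p := by
  rw [← hasLiftingProperty_pullbackObjObj_iff k i p (Functor.PullbackObjObj.ofHasPullback _ i p)]
  have := hC.trivialKanFibration i p ⟨hi⟩ ⟨hp⟩ (h.imp (fun h ↦ ⟨h⟩) (fun h ↦ ⟨h⟩))
    (Functor.PullbackObjObj.ofHasPullback _ i p)
  rw [← SSet.rlp_monomorphisms] at this
  exact this _ (.infer_property k)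

/-- Trivial fibrations are detected by lifting against cofibrations `i`; after transposition, this
is the Kan fibration part of (SM7). -/
lemma IsSimplicialModelCategory.trivialFibration_pullbackCotensor_of_horn {K L : SSet.{w}}
    {k : K ⟶ L} (hk : SSet.modelCategoryQuillen.J k) {X Y : C} {p : X ⟶ Y}
    (Q : PullbackCotensor k p) (hp : fibrations C p) : trivialFibrations C Q.π := by
  rw [← MorphismProperty.rlp_eq_of_wfs (cofibrations C) (trivialFibrations C)]
  intro A B i hi
  rw [Q.hasLiftingProperty_iff]
  exact hC.hasSimplicialLifting_of_horn hk i p hi hp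

lemma IsSimplicialModelCategory.fibration_pullbackCotensor {K L : SSet.{w}}
    {k : K ⟶ L} [Mono k] {X Y : C} {p : X ⟶ Y}
    (Q : PullbackCotensor k p) (hp : fibrations C p) : fibrations C Q.π := by
  rw [← MorphismProperty.rlp_eq_of_wfs (trivialCofibrations C) (fibrations C)]
  intro A B i hi
  rw [Q.hasLiftingProperty_iff]
  exact hC.hasSimplicialLifting_of_mono k i p hi.1 hp (Or.inl hi.2)

lemma IsSimplicialModelCategory.trivialFibration_pullbackCotensor {K L : SSet.{w}}
    {k : K ⟶ L} [Mono k] {X Y : C} {p : X ⟶ Y}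
    (Q : PullbackCotensor k p) (hp : trivialFibrations C p) : trivialFibrations C Q.π := by
  rw [← MorphismProperty.rlp_eq_of_wfs (cofibrations C) (trivialFibrations C)]
  intro A B i hi
  rw [Q.hasLiftingProperty_iff]
  exact hC.hasSimplicialLifting_of_mono k i p hi hp.1 (Or.inr hp.2)

end SimplicialModelCategory

variable {I : Type u₁} [Category.{w} I] {J : Type w} [EnrichedCategory SSet.{w} J]
  {φ : EnrichedFunctor SSet.{w} J (Disc I)} {M : SimplicialQuillenPresheaf.{w, u} I}

namespace SimplicialSection

/-- Cotensors and pullbacks of sections are levelwise, so the evaluation of a pullback-cotensor is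
again one. The comparison is an equality of arrows because the endpoints of `Q'.π` are hidden by the
existential quantifier. -/
lemma exists_pullbackCotensor {K L : SSet.{w}} (k : K ⟶ L) {X Y : SimplicialSection φ M}
    (p : X ⟶ Y) : ∃ Q : PullbackCotensor k p, ∀ j,
      ∃ Q' : PullbackCotensor k (Hom.app p j), Arrow.mk Q'.π = Arrow.mk (Hom.app Q.π j) := by
  obtain ⟨TXL, hXL⟩ := exists_levelwise_cotensor L X
  obtain ⟨TXK, hXK⟩ := exists_levelwise_cotensor K X
  obtain ⟨TYL, hYL⟩ := exists_levelwise_cotensor L Y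
  obtain ⟨TYK, hYK⟩ := exists_levelwise_cotensor K Y
  obtain ⟨resX, resX_eq⟩ := IsCotensor.exists_hom TXK.isUniversal (k ≫ TXL.counit)
  obtain ⟨resY, resY_eq⟩ := IsCotensor.exists_hom TYK.isUniversal (k ≫ TYL.counit)
  obtain ⟨pK, pK_eq⟩ := IsCotensor.exists_hom TYK.isUniversal
    (TXK.counit ≫ eHomWhiskerLeft SSet.{w} _ p)
  obtain ⟨pL, pL_eq⟩ := IsCotensor.exists_hom TYL.isUniversal
    (TXL.counit ≫ eHomWhiskerLeft SSet.{w} _ p)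
  have hw : resX ≫ pK = pL ≫ resY := IsCotensor.hom_ext TYK.isUniversal (by
    rw [eHomWhiskerRight_comp, reassoc_of% pK_eq, eHom_whisker_exchange, reassoc_of% resX_eq,
      eHomWhiskerRight_comp, reassoc_of% resY_eq, pL_eq])
  let Q : PullbackCotensor k p :=
    { XL := TXL.obj
      XK := TXK.obj
      YL := TYL.obj
      YK := TYK.obj
      pt := pullback pK resY
      fst := pullback.fst pK resY
      snd := pullback.snd pK resY
      uXL := TXL.counit
      uXK := TXK.counit
      uYL := TYL.counit
      uYK := TYK.counit
      hXL := TXL.isUniversal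
      hXK := TXK.isUniversal
      hYL := TYL.isUniversal
      hYK := TYK.isUniversal
      resX := resX
      resY := resY
      pK := pK
      pL := pL
      resX_eq := resX_eq
      resY_eq := resY_eq
      pK_eq := pK_eq
      pL_eq := pL_eq
      isPullback := IsPullback.of_hasPullback pK resY
      π := pullback.lift resX pL hw
      π_fst := pullback.lift_fst _ _ _
      π_snd := pullback.lift_snd _ _ _ }
  refine ⟨Q, fun j ↦ ⟨
    { XL := TXL.obj.obj j
      XK := TXK.obj.obj j
      YL := TYL.obj.obj j
      YK := TYK.obj.obj j
      pt := Q.pt.obj j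
      fst := Hom.app Q.fst j
      snd := Hom.app Q.snd j
      uXL := TXL.counit ≫ Map.ev _ _ j
      uXK := TXK.counit ≫ Map.ev _ _ j
      uYL := TYL.counit ≫ Map.ev _ _ j
      uYK := TYK.counit ≫ Map.ev _ _ j
      hXL := hXL j
      hXK := hXK j
      hYL := hYL j
      hYK := hYK j
      resX := Hom.app resX j
      resY := Hom.app resY j
      pK := Hom.app pK j
      pL := Hom.app pL j
      -- Composition of simplices of sections is levelwise by definition, so each relation simply
      -- restricts along `Map.ev`.
      resX_eq := congrArg (· ≫ Map.ev _ _ j) resX_eq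
      resY_eq := congrArg (· ≫ Map.ev _ _ j) resY_eq
      pK_eq := congrArg (· ≫ Map.ev _ _ j) pK_eq
      pL_eq := congrArg (· ≫ Map.ev _ _ j) pL_eq
      isPullback := Q.isPullback.map (ev φ M j)
      π := Hom.app Q.π j
      π_fst := congrArg (Hom.app · j) Q.π_fst
      π_snd := congrArg (Hom.app · j) Q.π_snd }, rfl⟩⟩

end SimplicialSection

end SimplicialSections

/-! ### Local presentability and transfer along a family of adjunctions. -/

namespace SimplicialSections

section Presentable

lemma exists_regular_cardinal_forall_le {ι : Type v} [Small.{w} ι] (κ : ι → Cardinal.{w}) :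
    ∃ κ' : Cardinal.{w}, κ'.IsRegular ∧ ∀ i, κ i ≤ κ' := by
  obtain ⟨κ', h, h'⟩ := HasCardinalLT.exists_regular_cardinal_forall.{w}
    (fun i ↦ (κ i).ord.ToType)
  refine ⟨κ', h, fun i ↦ le_of_lt ?_⟩
  simpa [hasCardinalLT_iff_cardinal_mk_lt] using h' i

variable {C : Type u} [Category.{w} C]

lemma hasColimitsOfSize_of_isLocallyPresentable [IsLocallyPresentable.{w} C] :
    HasColimitsOfSize.{w, w} C := by
  obtain ⟨κ, _, _⟩ := IsLocallyPresentable.exists_cardinal.{w} C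
  infer_instance

/-- In a locally presentable category, any small set of morphisms permits the small object
argument. -/
lemma hasSmallObjectArgument_of_isLocallyPresentable [IsLocallyPresentable.{w} C]
    (S : MorphismProperty C) [MorphismProperty.IsSmall.{w} S] :
    MorphismProperty.HasSmallObjectArgument.{w} S := by
  have := hasColimitsOfSize_of_isLocallyPresentable (C := C)
  -- The sources of the maps in the small set `S` are presentable; one regular cardinal bounds all
  -- their ranks and serves for the small object argument.
  choose κ hκ hκ' using fun a : S.toSet ↦
    (inferInstance : IsPresentable.{w} a.1.left).exists_cardinal
  obtain ⟨κ₀, hκ₀, hle⟩ := exists_regular_cardinal_forall_le κ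
  have : Fact κ₀.IsRegular := ⟨hκ₀⟩
  have : Nonempty κ₀.ord.ToType := by simpa using hκ₀.ne_zero
  have := WellFoundedLT.toOrderBot κ₀.ord.ToType
  exact ⟨κ₀, inferInstance, inferInstance,
    { preservesColimit {A B X Y} i hi f hf := by
        have : IsCardinalPresentable A (κ ⟨Arrow.mk i, hi⟩) := hκ' ⟨Arrow.mk i, hi⟩
        have : IsCardinalPresentable A κ₀ := isCardinalPresentable_of_le A (hle ⟨Arrow.mk i, hi⟩)
        have := (coyoneda.obj (op A)).preservesColimitsOfShape_of_isCardinalAccessible κ₀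
          κ₀.ord.ToType
        infer_instance }⟩

end Presentable

section Family

variable {C : Type u} [Category.{w} C] {J : Type w} {D : J → Type v} [∀ j, Category.{w} (D j)]
  {F : ∀ j, D j ⥤ C} {G : ∀ j, C ⥤ D j} (adj : ∀ j, F j ⊣ G j)

include adj

/-- A cocomplete category with a small, jointly conservative and jointly faithful family of
cocontinuous right adjoints to locally presentable categories is locally presentable. -/
lemma isLocallyPresentable_of_adjunctions [HasColimitsOfSize.{w, w} C]
    [∀ j, PreservesColimitsOfSize.{w, w} (G j)] [∀ j, IsLocallyPresentable.{w} (D j)]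
    (hfaithful : ∀ {X Y : C} (f g : X ⟶ Y), (∀ j, (G j).map f = (G j).map g) → f = g)
    (hiso : ∀ {X Y : C} (f : X ⟶ Y), (∀ j, IsIso ((G j).map f)) → IsIso f) :
    IsLocallyPresentable.{w} C := by
  choose κ hκ hκ' using fun j ↦ IsLocallyPresentable.exists_cardinal.{w} (D j)
  obtain ⟨κ₀, hκ₀, hle⟩ := exists_regular_cardinal_forall_le κ
  have : Fact κ₀.IsRegular := ⟨hκ₀⟩
  have (j : J) : IsCardinalLocallyPresentable (D j) κ₀ := .of_le (D j) (hle j)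
  have (j : J) : HasColimitsOfSize.{w, w} (D j) := inferInstance
  choose P hP₁ hP₂ hP₃ using fun j ↦
    (IsCardinalLocallyPresentable.iff_exists_isStrongGenerator (D j) κ₀).1 inferInstance
  refine ⟨κ₀, inferInstance, (IsCardinalLocallyPresentable.iff_exists_isStrongGenerator C κ₀).2
    ⟨⨆ j, (P j).strictMap (F j), inferInstance, ?_, ?_⟩⟩
  -- The candidate generators are the images under `F j` of strong generators of `D j`.
  -- Transposition turns testing on them into testing `(G j).map f` on the generators of `D j`, and
  -- the joint assumptions on the `G j` conclude.
  · have key {j : J} {Z : D j} (hZ : P j Z) : (⨆ j, (P j).strictMap (F j)) ((F j).obj Z) := by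
      exact le_iSup (fun j ↦ (P j).strictMap (F j)) j _ ⟨Z, hZ⟩
    rw [ObjectProperty.isStrongGenerator_iff]
    refine ⟨fun X Y f g h ↦ hfaithful f g (fun j ↦ (hP₂ j).1 _ _ (fun Z hZ x ↦ ?_)),
      fun X Y f _ h ↦ hiso f (fun j ↦ ?_)⟩
    · apply ((adj j).homEquiv _ _).symm.injective
      rw [(adj j).homEquiv_naturality_right_symm, (adj j).homEquiv_naturality_right_symm]
      exact h _ (key hZ) _
    · have : Mono ((G j).map f) := by
        have := (adj j).isRightAdjoint
        infer_instance
      refine (ObjectProperty.isStrongGenerator_iff.1 (hP₂ j)).2 _ (fun Z hZ x ↦ ?_)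
      obtain ⟨y, hy⟩ := h _ (key hZ) (((adj j).homEquiv _ _).symm x)
      refine ⟨(adj j).homEquiv _ _ y, ?_⟩
      apply ((adj j).homEquiv _ _).symm.injective
      dsimp only at hy ⊢
      rw [(adj j).homEquiv_naturality_right_symm, Equiv.symm_apply_apply, hy]
  · simp only [iSup_le_iff]
    rintro j _ ⟨Z, hZ⟩
    rw [isCardinalPresentable_iff]
    have := hP₃ j _ hZ
    rw [isCardinalPresentable_iff] at this
    -- A left adjoint whose right adjoint preserves the relevant filtered colimits preserves
    -- presentable objects.
    exact (adj j).isCardinalPresentable_leftAdjoint_obj κ₀ Z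

lemma rlp_iSup_strictMap_iff (S : ∀ j, MorphismProperty (D j)) {X Y : C} (p : X ⟶ Y) :
    (⨆ j, (S j).strictMap (F j)).rlp p ↔ ∀ j, (S j).rlp ((G j).map p) := by
  refine ⟨fun h j A B i hi ↦ ?_, fun h A B i hi ↦ ?_⟩
  · rw [← (adj j).hasLiftingProperty_iff]
    refine h _ ?_
    simp only [MorphismProperty.iSup_iff]
    exact ⟨j, ⟨hi⟩⟩
  · simp only [MorphismProperty.iSup_iff] at hi
    obtain ⟨j, ⟨hi⟩⟩ := hi
    rw [(adj j).hasLiftingProperty_iff]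
    exact h j _ hi

end Family

section Lifting

variable {C : Type u} [Category.{w} C] {D : Type v} [Category.{w} D]

lemma isSmall_strictMap (S : MorphismProperty D) [MorphismProperty.IsSmall.{w} S] (F : D ⥤ C) :
    MorphismProperty.IsSmall.{w} (S.strictMap F) := by
  obtain ⟨ι, A, B, f, rfl⟩ := (MorphismProperty.isSmall_iff_eq_ofHoms.{w} S).1 inferInstance
  rw [MorphismProperty.isSmall_iff_eq_ofHoms]
  refine ⟨ι, _, _, fun i ↦ F.map (f i), le_antisymm ?_ ?_⟩
  · rintro _ _ _ ⟨⟨i⟩⟩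
    exact ⟨i⟩
  · rintro _ _ _ ⟨i⟩
    exact ⟨⟨i⟩⟩

/-- By the small object argument the saturated class consists of retracts of transfinite
compositions of pushouts of coproducts of maps in `S`. A cocontinuous `G` preserves all these
operations, and `P.llp` is closed under them, so it suffices to check the maps in `S`. -/
lemma llp_rlp_le_inverseImage_llp (S : MorphismProperty C)
    [MorphismProperty.HasSmallObjectArgument.{w} S] (G : C ⥤ D)
    [PreservesColimitsOfSize.{w, w} G] (P : MorphismProperty D)
    (h : S ≤ P.llp.inverseImage G) : S.rlp.llp ≤ P.llp.inverseImage G := by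
  have h₁ : (P.llp.inverseImage G).IsStableUnderCobaseChange :=
    ⟨fun sq hf ↦ MorphismProperty.of_isPushout (P := P.llp) (sq.map G) hf⟩
  have h₂ : MorphismProperty.IsStableUnderCoproducts.{w} (P.llp.inverseImage G) :=
    ⟨fun K ↦ ⟨fun X₁ X₂ c₁ c₂ hc₁ hc₂ f hf φ hφ ↦
      MorphismProperty.colimitsOfShape_le (W := P.llp) _ (MorphismProperty.colimitsOfShape.mk'
        (X₁ ⋙ G) (X₂ ⋙ G) (G.mapCocone c₁) (G.mapCocone c₂) (isColimitOfPreserves G hc₁)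
        (isColimitOfPreserves G hc₂) (Functor.whiskerRight f G) hf (G.map φ)
        (fun k ↦ by
          have := congrArg G.map (hφ k)
          rwa [G.map_comp, G.map_comp] at this))⟩⟩
  have h₃ : MorphismProperty.IsStableUnderTransfiniteComposition.{w} (P.llp.inverseImage G) :=
    ⟨fun K _ _ _ _ ↦ ⟨fun _ _ f hf ↦
      have : PreservesWellOrderContinuousOfShape K G := ⟨fun _ _ ↦ inferInstance⟩
      MorphismProperty.transfiniteCompositionsOfShape_le P.llp K _
      (MorphismProperty.transfiniteCompositionsOfShape_map_of_preserves K G f hf)⟩⟩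
  rw [MorphismProperty.llp_rlp_of_hasSmallObjectArgument.{w}]
  refine (MorphismProperty.retracts_monotone ?_).trans (MorphismProperty.retracts_le _)
  rw [MorphismProperty.transfiniteCompositions_le_iff, MorphismProperty.pushouts_le_iff,
    MorphismProperty.coproducts_le_iff]
  exact h

end Lifting

section Transfer

variable {C : Type u} [Category.{w} C] {J : Type w} {D : J → Type v} [∀ j, Category.{w} (D j)]
  {F : ∀ j, D j ⥤ C} {G : ∀ j, C ⥤ D j} (adj : ∀ j, F j ⊣ G j) [∀ j, ModelCategory (D j)]

include adj

/-- Transfer of combinatorial model structures along a small family of cocontinuous right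
adjoints. -/
theorem exists_modelCategory_of_adjunctions [IsLocallyPresentable.{w} C] [HasFiniteLimits C]
    [∀ j, PreservesColimitsOfSize.{w, w} (G j)] (hD : ∀ j, IsCombinatorial (D j))
    (hF : ∀ (j j' : J) {X Y : D j} (f : X ⟶ Y), trivialCofibrations (D j) f →
      trivialCofibrations (D j') ((G j').map ((F j).map f))) :
    ∃ _ : ModelCategory C,
      weakEquivalences C = (fun _ _ f ↦ ∀ j, weakEquivalences (D j) ((G j).map f)) ∧
      fibrations C = (fun _ _ f ↦ ∀ j, fibrations (D j) ((G j).map f)) ∧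
      cofibrations C = (fibrations C ⊓ weakEquivalences C).llp := by
  have := hasColimitsOfSize_of_isLocallyPresentable (C := C)
  choose S hS hS' using fun j ↦ (hD j).exists_generating_cofibrations
  choose T hT hT' using fun j ↦ (hD j).exists_generating_trivialCofibrations
  let W : MorphismProperty C := fun _ _ f ↦ ∀ j, weakEquivalences (D j) ((G j).map f)
  let fib : MorphismProperty C := fun _ _ f ↦ ∀ j, fibrations (D j) ((G j).map f)
  let S' : MorphismProperty C := ⨆ j, (S j).strictMap (F j)
  let T' : MorphismProperty C := ⨆ j, (T j).strictMap (F j)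
  have (j : J) : MorphismProperty.IsSmall.{w} ((S j).strictMap (F j)) := isSmall_strictMap _ _
  have (j : J) : MorphismProperty.IsSmall.{w} ((T j).strictMap (F j)) := isSmall_strictMap _ _
  have : MorphismProperty.HasSmallObjectArgument.{w} S' :=
    hasSmallObjectArgument_of_isLocallyPresentable S'
  have : MorphismProperty.HasSmallObjectArgument.{w} T' :=
    hasSmallObjectArgument_of_isLocallyPresentable T'
  have hS'' : S'.rlp = fib ⊓ W := by
    ext X Y p
    rw [rlp_iSup_strictMap_iff adj]
    simp only [← hS']
    exact forall_and
  have hT'' : T'.rlp = fib := by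
    ext X Y p
    rw [rlp_iSup_strictMap_iff adj]
    simp only [← hT']
    rfl
  have hW : W.HasTwoOutOfThreeProperty :=
    { comp_mem f g hf hg j := by
        rw [Functor.map_comp]
        exact MorphismProperty.comp_mem _ _ _ (hf j) (hg j)
      of_postcomp f g hg hfg j := by
        have := hfg j
        rw [Functor.map_comp] at this
        exact MorphismProperty.of_postcomp _ _ _ (hg j) this
      of_precomp f g hf hfg j := by
        have := hfg j
        rw [Functor.map_comp] at this
        exact MorphismProperty.of_precomp _ _ _ (hf j) this }
  -- Acyclicity: the assumption `hF` gives it on generators, and cocontinuity of each `G j'`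
  -- propagates it to the saturated class.
  have hTW : T'.rlp.llp ≤ W := by
    intro X Y f hf j'
    have h : T' ≤ (fibrations (D j')).llp.inverseImage (G j') := by
      simp only [T', iSup_le_iff, MorphismProperty.strictMap_le_iff_le_inverseImage]
      intro j A B i hi
      change (fibrations (D j')).llp ((G j').map ((F j).map i))
      rw [fibrations_llp]
      refine hF j j' i ?_
      rw [← fibrations_llp, hT' j]
      exact MorphismProperty.le_llp_rlp _ _ hi
    have := llp_rlp_le_inverseImage_llp T' (G j') (fibrations (D j')) h f hf
    change (fibrations (D j')).llp ((G j').map f) at this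
    rw [fibrations_llp] at this
    exact this.2
  have hTS : T'.rlp.llp ≤ S'.rlp.llp :=
    MorphismProperty.antitone_llp (by rw [hS'', hT'']; exact inf_le_left)
  -- Retract argument: factor an acyclic cofibration through `T'.rlp.llp` and `T'.rlp`. By
  -- two-out-of-three the second factor lies in `S'.rlp`, so it has the lifting that exhibits `f` as
  -- a retract of the first factor.
  have hcof : S'.rlp.llp ⊓ W = T'.rlp.llp := by
    refine le_antisymm (fun X Y f hf ↦ ?_) (le_inf hTS hTW)
    let h := MorphismProperty.factorizationData T'.rlp.llp T'.rlp f
    have hp : S'.rlp h.p := by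
      rw [hS'']
      refine ⟨hT'' ▸ h.hp, hW.of_precomp h.i h.p (hTW _ h.hi) ?_⟩
      rw [h.fac]
      exact hf.2
    have := hf.1 _ hp
    exact MorphismProperty.of_retract (RetractArrow.ofLeftLiftingProperty h.fac) h.hi
  let _ : CategoryWithWeakEquivalences C := ⟨W⟩
  let _ : CategoryWithFibrations C := ⟨fib⟩
  let _ : CategoryWithCofibrations C := ⟨S'.rlp.llp⟩
  have h₁ : MorphismProperty.IsWeakFactorizationSystem S'.rlp.llp S'.rlp :=
    { rlp := MorphismProperty.rlp_llp_rlp _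
      llp := rfl }
  have h₂ : MorphismProperty.IsWeakFactorizationSystem T'.rlp.llp T'.rlp :=
    { rlp := MorphismProperty.rlp_llp_rlp _
      llp := rfl }
  have h₃ : MorphismProperty.IsWeakFactorizationSystem (cofibrations C) (trivialFibrations C) := by
    rw [hS''] at h₁
    have e : cofibrations C = (fib ⊓ W).llp := congrArg MorphismProperty.llp hS''
    rw [e]
    exact h₁
  have h₄ : MorphismProperty.IsWeakFactorizationSystem (trivialCofibrations C) (fibrations C) := by
    rw [← hcof, hT''] at h₂
    exact h₂
  have h₅ : (weakEquivalences C).HasTwoOutOfThreeProperty := hW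
  exact ⟨ModelCategory.mk' C, rfl, rfl, congrArg MorphismProperty.llp hS''⟩

end Transfer

end SimplicialSections

/-! ### Acyclicity of free sections, the evaluation adjunctions and (SM7) for sections. -/

namespace SimplicialSections

open WeightedShape WeightedDiagram

/-- This is (SM7) for the inclusion of the empty simplicial set in `L`. It expresses that `L ⊗ i`
lifts against `p` without forming the tensor. -/
lemma exists_comp_eHomWhiskerRight_eq {C : Type u} [Category.{w} C] [SimplicialCategory C]
    [ModelCategory C] (hC : IsSimplicialModelCategory C) {A B X Y : C} (i : A ⟶ B) (p : X ⟶ Y)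
    (hi : trivialCofibrations C i) (hp : fibrations C p) {L : SSet.{w}}
    (a : L ⟶ (A ⟶[SSet.{w}] X)) (d : L ⟶ (B ⟶[SSet.{w}] Y))
    (h : a ≫ eHomWhiskerLeft SSet.{w} A p = d ≫ eHomWhiskerRight SSet.{w} i Y) :
    ∃ l : L ⟶ (B ⟶[SSet.{w}] X), l ≫ eHomWhiskerRight SSet.{w} i X = a ∧
      l ≫ eHomWhiskerLeft SSet.{w} B p = d := by
  let b : ((⊥ : L.Subcomplex) : SSet.{w}) ⟶ (B ⟶[SSet.{w}] X) :=
    { app n := ↾fun x ↦ x.2.elim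
      naturality n m θ := by
        ext x
        exact x.2.elim }
  obtain ⟨l, -, h₁, h₂⟩ := hC.hasSimplicialLifting_of_mono (⊥ : L.Subcomplex).ι i p hi.1 hp
    (Or.inl hi.2) a b d (by
      apply NatTrans.ext
      ext n x
      exact x.2.elim) h (by
      apply NatTrans.ext
      ext n x
      exact x.2.elim)
  exact ⟨l, h₁, h₂⟩

variable {I : Type u₁} [Category.{w} I] {J : Type w} [EnrichedCategory SSet.{w} J]
  {φ : EnrichedFunctor SSet.{w} J (Disc I)} {M : SimplicialQuillenPresheaf.{w, u} I}

namespace SimplicialSection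

section

variable {j : J} {X Y : M.obj (φ.obj j).as} {P Q : ∀ j' : J, M.obj (φ.obj j').as}
  {c : ∀ (j' : J) (α : (φ.obj j).as ⟶ (φ.obj j').as),
    ((mapOver φ α : (j ⟶[SSet.{w}] j').Subcomplex) : SSet.{w}) ⟶ (M.push α X ⟶[SSet.{w}] P j')}
  (hc : ∀ j', (discreteCocone (c j')).IsUniversal)
  {d : ∀ (j' : J) (α : (φ.obj j).as ⟶ (φ.obj j').as),
    ((mapOver φ α : (j ⟶[SSet.{w}] j').Subcomplex) : SSet.{w}) ⟶ (M.push α Y ⟶[SSet.{w}] Q j')}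
  (hd : ∀ j', (discreteCocone (d j')).IsUniversal)

lemma genSimplex_comp_map {f : X ⟶ Y} {g : freeSection hc ⟶ freeSection hd}
    (hg : freeUnit hc ≫ Hom.app g j = f ≫ freeUnit hd) {j' : J} {n : SimplexCategoryᵒᵖ}
    (γ : (j ⟶[SSet.{w}] j').obj n) (α : (φ.obj j).as ⟶ (φ.obj j').as) (h : baseHom φ γ = α) :
    sComp (genSimplex c γ α h) (sHomOf (Hom.app g j') n) =
      sComp (M.pushMap α (sHomOf f n)) (genSimplex d γ α h) := by
  rw [genSimplex_comp_app, hg, sHomOf_comp, M.pushMap_sComp, sComp_assoc, pushMap_freeUnit]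
  rfl

/-- Levelwise, `g` is a coproduct of maps `Map^α(j, j') ⊗ α_! f`. Lifts against a fibration are
therefore found separately for each `α`, as `α_! f` is a trivial cofibration, and then glued by the
universal property of `Q j'`. -/
lemma trivialCofibration_app_of_freeUnit_comp {f : X ⟶ Y} (hf : trivialCofibrations _ f)
    {g : freeSection hc ⟶ freeSection hd}
    (hg : freeUnit hc ≫ Hom.app g j = f ≫ freeUnit hd) (j' : J) :
    trivialCofibrations _ (Hom.app g j') := by
  rw [← fibrations_llp]
  intro A B p hp
  refine ⟨fun {a b} sq ↦ ?_⟩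
  -- The square restricted to the summand of index `α`, transposed to mapping spaces.
  have key (α : (φ.obj j).as ⟶ (φ.obj j').as) :
      (c j' α ≫ eHomWhiskerLeft SSet.{w} _ a) ≫ eHomWhiskerLeft SSet.{w} _ p =
      (d j' α ≫ eHomWhiskerLeft SSet.{w} _ b) ≫
        eHomWhiskerRight SSet.{w} ((underlying (M.map α).left).map f) B := by
    apply NatTrans.ext
    ext n γ
    refine (sComp_assoc _ _ _).trans ((congrArg (sComp _) ((sHomOf_comp _ _ n).symm.trans
      ((congrArg (sHomOf · n) sq.w).trans (sHomOf_comp _ _ n)))).trans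
      ((sComp_assoc _ _ _).symm.trans ?_))
    refine (congrArg (sComp · _) (genSimplex_comp_map hc hd hg γ.1 α γ.2)).trans
      ((sComp_assoc _ _ _).trans ?_)
    exact congrArg (sComp · _) (sHomOf_underlying_map _ f n).symm
  choose l hl₁ hl₂ using fun α ↦ exists_comp_eHomWhiskerRight_eq
    (M.obj _).isSimplicialModelCategory _ p ((M.map α).trivialCofibration_map f hf) hp _ _ (key α)
  obtain ⟨e, he⟩ := (hd j').exists_hom (discreteCocone l)
  refine ⟨⟨⟨e, (hc j').ordinary_hom_ext (fun α n γ ↦ ?_),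
    (hd j').ordinary_hom_ext (fun α n γ ↦ ?_)⟩⟩⟩
  · refine (congrArg (sComp _) (sHomOf_comp _ _ n)).trans ((sComp_assoc _ _ _).symm.trans ?_)
    refine (congrArg (sComp · _) (genSimplex_comp_map hc hd hg γ.1 α γ.2)).trans
      ((sComp_assoc _ _ _).trans ((congrArg (sComp _) (he α n γ)).trans ?_))
    refine Eq.trans ?_ (ConcreteCategory.congr_hom (NatTrans.congr_app (hl₁ α) n) γ)
    exact congrArg (sComp · _) (sHomOf_underlying_map _ f n).symm
  · refine (congrArg (sComp _) (sHomOf_comp _ _ n)).trans ((sComp_assoc _ _ _).symm.trans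
      ((congrArg (sComp · _) (he α n γ)).trans ?_))
    exact ConcreteCategory.congr_hom (NatTrans.congr_app (hl₂ α) n) γ

end

section

variable [∀ i, HasColimitsOfSize.{w, w} (M.obj i)]

/-- The chosen tensors of which the free section is a coproduct. -/
noncomputable def freeTensor (j : J) (X : M.obj (φ.obj j).as) (j' : J)
    (α : (φ.obj j).as ⟶ (φ.obj j').as) :
    SimplicialTensor ((mapOver φ α : (j ⟶[SSet.{w}] j').Subcomplex) : SSet.{w}) (M.push α X) :=
  ((M.obj _).isSimplicialModelCategory.tensored _ _).some

lemma isUniversal_freeTensor (j : J) (X : M.obj (φ.obj j).as) (j' : J) :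
    (discreteCocone (fun α ↦ (freeTensor j X j' α).unit ≫ eHomWhiskerLeft SSet.{w} (M.push α X)
      (Cofan.inj (colimit.cocone (Discrete.functor fun α ↦ (freeTensor j X j' α).obj))
        α))).IsUniversal :=
  isUniversal_coproduct_tensor (M.obj _).isSimplicialModelCategory.cotensored _
    (colimit.isColimit _)

/-- The bijection between morphisms from the free section and morphisms from its generator. -/
noncomputable def freeEquiv (j : J) (X : M.obj (φ.obj j).as) (t : SimplicialSection φ M) :
    (freeSection (isUniversal_freeTensor j X) ⟶ t) ≃ (X ⟶ (ev φ M j).obj t) :=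
  Equiv.ofBijective _ (bijective_freeUnit_comp (isUniversal_freeTensor j X) t)

lemma freeEquiv_comp (j : J) (X : M.obj (φ.obj j).as) (t t' : SimplicialSection φ M)
    (g : t ⟶ t') (h : freeSection (isUniversal_freeTensor j X) ⟶ t) :
    freeEquiv j X t' (h ≫ g) = freeEquiv j X t h ≫ (ev φ M j).map g :=
  (Category.assoc _ _ _).symm

variable (φ M) in
/-- The free section functor. -/
noncomputable def free (j : J) : M.obj (φ.obj j).as ⥤ SimplicialSection φ M :=
  Adjunction.leftAdjointOfEquiv (freeEquiv j) (freeEquiv_comp j)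

variable (φ M) in
/-- The free section functor is left adjoint to the evaluation functor. -/
noncomputable def freeAdj (j : J) : free φ M j ⊣ ev φ M j :=
  Adjunction.adjunctionOfEquivLeft (freeEquiv j) (freeEquiv_comp j)

lemma freeAdj_unit_app (j : J) (X : M.obj (φ.obj j).as) :
    (freeAdj φ M j).unit.app X = freeUnit (isUniversal_freeTensor j X) := by
  refine (Adjunction.adjunctionOfEquivLeft_unit_app _ _ X).trans ?_
  exact Category.comp_id _

lemma isFreeSection_freeAdj_unit_app (j : J) (X : M.obj (φ.obj j).as) :
    IsFreeSection (s := (free φ M j).obj X) ((freeAdj φ M j).unit.app X) := by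
  rw [freeAdj_unit_app]
  exact isFreeSection_freeUnit (isUniversal_freeTensor j X)

lemma trivialCofibration_free_map (j j' : J) {X Y : M.obj (φ.obj j).as} (f : X ⟶ Y)
    (hf : trivialCofibrations _ f) :
    trivialCofibrations _ ((ev φ M j').map ((free φ M j).map f)) :=
  trivialCofibration_app_of_freeUnit_comp (isUniversal_freeTensor j X)
    (isUniversal_freeTensor j Y) hf (by
      have h := (freeAdj φ M j).unit.naturality f
      rw [freeAdj_unit_app, freeAdj_unit_app] at h
      exact h.symm) j'

end

/-- The levelwise inverses are natural: conjugate the naturality square of `f` by them. -/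
lemma isIso_of_isIso_app {s t : SimplicialSection φ M} (f : s ⟶ t)
    (hf : ∀ j, IsIso ((ev φ M j).map f)) : IsIso f := by
  have hf' (j : J) : IsIso (Hom.app f j) := hf j
  have h₁ (j : J) (n : SimplexCategoryᵒᵖ) :
      sComp (sHomOf (inv (Hom.app f j)) n) (sHomOf (Hom.app f j) n) = sId _ n := by
    rw [← sHomOf_comp, IsIso.inv_hom_id, sHomOf_id]
  have h₂ (j : J) (n : SimplexCategoryᵒᵖ) :
      sComp (sHomOf (Hom.app f j) n) (sHomOf (inv (Hom.app f j)) n) = sId _ n := by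
    rw [← sHomOf_comp, IsIso.hom_inv_id, sHomOf_id]
  let g : t ⟶ s := Hom.mk (fun j ↦ inv (Hom.app f j)) (fun n j j' γ ↦ by
    have h := Hom.naturality f γ
    rw [← Total.pre_sId (t.act γ), ← h₁ j n, Total.pre_sComp, ← h, Total.post_pre,
      ← Total.post_sComp, h₂, Total.post_sId])
  exact ⟨g, Hom.ext (funext fun j ↦ IsIso.hom_inv_id (Hom.app f j)),
    Hom.ext (funext fun j ↦ IsIso.inv_hom_id (Hom.app f j))⟩

/-- (SM7) is checked in transposed form: `i` is lifted against the pullback-cotensor map of `p`,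
whose being a fibration or a weak equivalence is decided levelwise. No explicit description of the
cofibrations of sections is then needed. -/
lemma isSimplicialModelCategory_of_levelwise [ModelCategory (SimplicialSection φ M)]
    (hW : weakEquivalences (SimplicialSection φ M) = levelwiseWeakEquivalences φ M)
    (hfib : fibrations (SimplicialSection φ M) = levelwiseFibrations φ M) :
    IsSimplicialModelCategory (SimplicialSection φ M) where
  tensored K s := nonempty_simplicialTensor K s
  cotensored K s := ⟨(exists_levelwise_cotensor K s).choose⟩
  kanFibration {A B X Y} i p hi hp sq K L k hk := by
    rw [hasLiftingProperty_pullbackObjObj_iff]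
    obtain ⟨Q, hQ⟩ := exists_pullbackCotensor k p
    rw [← Q.hasLiftingProperty_iff]
    have hp' : levelwiseFibrations φ M p := hfib ▸ hp.mem
    have hQ' (j : J) : trivialFibrations _ ((ev φ M j).map Q.π) := by
      obtain ⟨Q', e⟩ := hQ j
      have h := (M.obj _).isSimplicialModelCategory.trivialFibration_pullbackCotensor_of_horn
        hk Q' (hp' j)
      exact (MorphismProperty.arrow_mk_mem_toSet_iff _ _).1
        (e ▸ (MorphismProperty.arrow_mk_mem_toSet_iff _ _).2 h)
    have : Fibration Q.π := ⟨hfib ▸ fun j ↦ (hQ' j).1⟩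
    have : WeakEquivalence Q.π := ⟨hW ▸ fun j ↦ (hQ' j).2⟩
    infer_instance
  trivialKanFibration {A B X Y} i p hi hp h sq K L k hk := by
    have : Mono k := SSet.modelCategoryQuillen.I_le_monomorphisms _ hk
    rw [hasLiftingProperty_pullbackObjObj_iff]
    obtain ⟨Q, hQ⟩ := exists_pullbackCotensor k p
    rw [← Q.hasLiftingProperty_iff]
    have hp' : levelwiseFibrations φ M p := hfib ▸ hp.mem
    have hQ' (j : J) : fibrations _ ((ev φ M j).map Q.π) := by
      obtain ⟨Q', e⟩ := hQ j
      have h := (M.obj _).isSimplicialModelCategory.fibration_pullbackCotensor Q' (hp' j)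
      exact (MorphismProperty.arrow_mk_mem_toSet_iff _ _).1
        (e ▸ (MorphismProperty.arrow_mk_mem_toSet_iff _ _).2 h)
    have : Fibration Q.π := ⟨hfib ▸ hQ'⟩
    obtain h | h := h
    · infer_instance
    · have hp'' : levelwiseWeakEquivalences φ M p := hW ▸ h.mem
      have hQ'' (j : J) : weakEquivalences _ ((ev φ M j).map Q.π) := by
        obtain ⟨Q', e⟩ := hQ j
        have h := ((M.obj _).isSimplicialModelCategory.trivialFibration_pullbackCotensor Q'
          ⟨hp' j, hp'' j⟩).2
        exact (MorphismProperty.arrow_mk_mem_toSet_iff _ _).1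
          (e ▸ (MorphismProperty.arrow_mk_mem_toSet_iff _ _).2 h)
      have : WeakEquivalence Q.π := ⟨hW ▸ hQ''⟩
      infer_instance

end SimplicialSection

end SimplicialSections

theorem propositionp {I : Type u₁} [Category.{w} I] {J : Type w} [EnrichedCategory SSet.{w} J]
    (φ : EnrichedFunctor SSet.{w} J (Disc I))
    (M : SimplicialQuillenPresheaf.{w, u} I)
    (hM : ∀ i, IsCombinatorial (M.obj i)) :
    ∃ (_ : ModelCategory (SimplicialSection φ M)),
      IsCombinatorial (SimplicialSection φ M) ∧
      IsSimplicialModelCategory (SimplicialSection φ M) ∧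
      weakEquivalences (SimplicialSection φ M) =
        SimplicialSection.levelwiseWeakEquivalences φ M ∧
      fibrations (SimplicialSection φ M) =
        SimplicialSection.levelwiseFibrations φ M ∧
      cofibrations (SimplicialSection φ M) =
        (SimplicialSection.levelwiseFibrations φ M ⊓
          SimplicialSection.levelwiseWeakEquivalences φ M).llp ∧
      ∃ (F : ∀ j : J, M.obj (φ.obj j).as ⥤ SimplicialSection φ M)
        (adj : ∀ j : J, F j ⊣ SimplicialSection.ev φ M j),
        (∀ (j : J) (X : M.obj (φ.obj j).as),
          SimplicialSection.IsFreeSection ((adj j).unit.app X)) ∧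
        (∀ S : ∀ j : J, MorphismProperty (M.obj (φ.obj j).as),
          (∀ j, trivialFibrations (M.obj (φ.obj j).as) = (S j).rlp) →
            trivialFibrations (SimplicialSection φ M) =
              (⨆ j, (S j).strictMap (F j)).rlp) ∧
        (∀ S : ∀ j : J, MorphismProperty (M.obj (φ.obj j).as),
          (∀ j, fibrations (M.obj (φ.obj j).as) = (S j).rlp) →
            fibrations (SimplicialSection φ M) =
              (⨆ j, (S j).strictMap (F j)).rlp) := by
  have (i : I) : IsLocallyPresentable.{w} (M.obj i) := (hM i).isLocallyPresentable
  have (i : I) : HasColimitsOfSize.{w, w} (M.obj i) := hasColimitsOfSize_of_isLocallyPresentable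
  -- Presentability precedes the model structure: the transfer relies on it for the small object
  -- argument.
  have : IsLocallyPresentable.{w} (SimplicialSection φ M) :=
    isLocallyPresentable_of_adjunctions (SimplicialSection.freeAdj φ M)
      (fun f g h ↦ SimplicialSection.Hom.ext (funext h)) SimplicialSection.isIso_of_isIso_app
  obtain ⟨_, hW, hfib, hcof⟩ := exists_modelCategory_of_adjunctions
    (SimplicialSection.freeAdj φ M) (fun j ↦ hM _)
    (fun j j' _ _ f hf ↦ SimplicialSection.trivialCofibration_free_map j j' f hf)
  have hW' : weakEquivalences (SimplicialSection φ M) =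
    SimplicialSection.levelwiseWeakEquivalences φ M := hW
  have hfib' : fibrations (SimplicialSection φ M) =
    SimplicialSection.levelwiseFibrations φ M := hfib
  -- Transposing along the free section adjunctions detects trivial fibrations from arbitrary
  -- classes `S j`. The same statement, applied to generating sets of the fibers, shows that the
  -- transferred structure is cofibrantly generated.
  have h₁ (S : ∀ j : J, MorphismProperty (M.obj (φ.obj j).as))
      (hS : ∀ j, trivialFibrations (M.obj (φ.obj j).as) = (S j).rlp) :
      trivialFibrations (SimplicialSection φ M) =
        (⨆ j, (S j).strictMap (SimplicialSection.free φ M j)).rlp := by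
    ext X Y p
    rw [rlp_iSup_strictMap_iff (SimplicialSection.freeAdj φ M), trivialFibrations, hW', hfib']
    simp only [← hS]
    exact forall_and.symm
  have h₂ (S : ∀ j : J, MorphismProperty (M.obj (φ.obj j).as))
      (hS : ∀ j, fibrations (M.obj (φ.obj j).as) = (S j).rlp) :
      fibrations (SimplicialSection φ M) =
        (⨆ j, (S j).strictMap (SimplicialSection.free φ M j)).rlp := by
    ext X Y p
    rw [rlp_iSup_strictMap_iff (SimplicialSection.freeAdj φ M), hfib']
    simp only [← hS]
    rfl
  refine ⟨inferInstance, ⟨inferInstance, ?_, ?_⟩,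
    SimplicialSection.isSimplicialModelCategory_of_levelwise hW' hfib', hW', hfib', ?_,
    SimplicialSection.free φ M, SimplicialSection.freeAdj φ M,
    SimplicialSection.isFreeSection_freeAdj_unit_app, h₁, h₂⟩
  · choose S hS hS' using fun i ↦ (hM i).exists_generating_cofibrations
    have (j : J) := isSmall_strictMap (S (φ.obj j).as) (SimplicialSection.free φ M j)
    exact ⟨_, inferInstance, h₁ _ (fun j ↦ hS' _)⟩
  · choose S hS hS' using fun i ↦ (hM i).exists_generating_trivialCofibrations
    have (j : J) := isSmall_strictMap (S (φ.obj j).as) (SimplicialSection.free φ M j)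
    exact ⟨_, inferInstance, h₂ _ (fun j ↦ hS' _)⟩
  · rw [hcof, hW', hfib']
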